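/- **Setting.** Let $D\ge1$, $T\ge 0$, let $\mathcal C$ be a standard Borel space with a probability law $\mathsf P_{\mathcal C}$, and let $\pi^\star(\cdot\mid c)$ be a Markov kernel from $\mathcal C$ to $\mathbb R^D$ having a density $\pi^\star(x\mid c)$ for a.e. $c$. Let $q_s(dx_{s+1}\mid x_s)$, $0\le s<T$, be Markov kernels on $\mathbb R^D$ with strictly positive densities and $\nu$ an absolutely continuous probability law. Under $\mathsf Q$: $C\sim\mathsf P_{\mathcal C}$, $X_0\mid C\sim\pi^\star(\cdot\mid C)$, $X_{s+1}\mid X_s\sim q_s(\cdot\mid X_s)$; $q_s^{\pi^\star}(\cdot\mid c)$ is the law of $X_s$ given $C=c$ (also its density), and $r_t^\star(\cdot\mid c,x_t)$, $1\le t\le T$, the conditional law of $X_{t-1}$ given $(C,X_t)=(c,x_t)$. A reverse model $p=(p_t(dx_{t-1}\mid c,x_t))_{t=1}^T$ started from $X_T\sim\nu$ produces an output law $\pi_{p,\nu}(\cdot\mid c)$ of $X_0$. Put $\mathcal E_{KL}(\pi)=\mathbb E\,KL(\pi^\star(\cdot\mid C)\,\|\,\pi(\cdot\mid C))$ and $\mathrm{Comp}(c)=KL(q_T^{\pi^\star}(\cdot\mid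 c)\,\|\,\nu)$. $C_r(y)$ denotes the closed axis-parallel cube of side $r$ centered at $y$. **Regularity (for $0\le s<T$).** For a.e. $c$, $\pi^\star(\cdot\mid c)$ is continuous and positive; $u\mapsto q_s(u\mid v)$ is continuous for every $v$; for a.e. $c$ and every compact $K$, $\sup_{u\in K}q_s(u\mid v)\le g(v)$ for some $g\in L^1(q_s^{\pi^\star}(\cdot\mid c))$; $\mathbb E\|X_s\|^2<\infty$; there are $r_s>0$, cubes $C_s(x)\ni x$ of side $r_s$ and functions $a,b\ge0$ (depending on $s$) with $\log\frac{q_s^{\pi^\star}(x\mid c)}{\inf_{C_s(x)}q_s^{\pi^\star}(\cdot\mid c)}\le a(x)$ for a.e. $c,x$, $\log\frac{q_s(x'\mid x)}{\inf_{y\in C_s(x)}q_s(x'\mid y)}\le b(x,x')$ for a.e. $(x,x')$, and $\mathbb E[a(X_s)+b(X_s,X_{s+1})]<\infty$. **Features.** For each $t\in\{1,\dots,T\}$ there are $d_t\ge1$, a measurable $\phi_t:\mathcal C\times\mathbb R^D\to\mathbb R^{d_t}$, a compact $K_t$ and a measurable $f_t(y\mid z)\ge0$ such that, with $Z_t=\phi_t(C,X_t)$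 and $F_t$ the law of $(X_{t-1},Z_t)$: $\Pr(Z_t\in K_t)=1$; $F_t(dy,dz)=f_t(y\mid z)\,dy\,(F_t)_{Z_t}(dz)$; and $r_t^\star(\cdot\mid c,x_t)$ has density $f_t(\cdot\mid\phi_t(c,x_t))$ for a.e. $(c,x_t)$. **Partitions.** For each $t$ a sequence, indexed by $n\in\mathbb N$, of families of $m_t=m_t(n)\ge1$ distinct cells $A_1,\dots,A_{m_t}$ of a cubic grid of side $h$ (half-open cubes with centers $\mu_j$) is given, with $m_t\to\infty$, $h\to0$, $A_0=\mathbb R^D\setminus\bigcup_{j\ge1}A_j$, and scales $\delta,\sigma,\sigma_{t,0}>0$ ($h,\delta,\sigma$ depending on $n$), $\delta\to0$, such that for every $y$ the cube $C_\delta(y)$ eventually misses $A_0$, $\sigma/\delta\to0$, $\delta^{D-1}h/\sigma^D\to0$, $(r_{t-1}/2)^D/(2\pi\sigma_{t,0}^2)^{D/2}\le2^{-(D+1)}$, and, for all large $n$, every $y\in A_0$ (resp. $y\notin A_0$) is a vertex of a cube of side $r_{t-1}/2$ contained in $A_0$ (resp. in $\mathbb R^D\setminus A_0$). Let $G_j(z)=\int_{A_j}f_t(y\mid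 z)\,dy$ and $\Lambda_{j}(z)=\log(G_j(z)/G_0(z))$. Let $Q_t\supset K_t$ be a nondegenerate closed cube, $\Psi_t:[0,1]^{d_t}\to Q_t$ its affine parametrization and $s_t\ge1$ an integer; for every $n,j$ the function $\Lambda_j|_{K_t}$ is assumed to extend to a $C^{s_t}$ function (still denoted $\Lambda_j$) on a neighborhood of $Q_t$. Put $\Lambda^{\max}_{t,m_t}=\max_j\max_{|\alpha|\le s_t}\sup_{[0,1]^{d_t}}|\partial^\alpha(\Lambda_j\circ\Psi_t)|$. **Neural reverse models.** For ReLU networks $a_t:\mathbb R^{d_t}\to\mathbb R^{m_t}$ let $p_t^{NN}(\cdot\mid c,x_t)$ be the mixture of the normal laws $N(\mu_j,\sigma^2I_D)$, $j\ge1$, and $N(0,\sigma_{t,0}^2I_D)$ with weights $\frac{e^{a_{t,j}(z)}}{1+\sum_ke^{a_{t,k}(z)}}$ and $\frac1{1+\sum_ke^{a_{t,k}(z)}}$, $z=\phi_t(c,x_t)$. For integers $N_t,L_t\ge1$ write $R_t=(s_t+1)^{d_t}8^{s_t}\Lambda^{\max}_{t,m_t}N_t^{-2s_t/d_t}L_t^{-2s_t/d_t}$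 and call $a_t$ *$(N_t,L_t)$-accurate* if $\max_j\sup_{z\in K_t}|a_{t,j}(z)-\Lambda_j(z)|\le85\,R_t$. **Explicit bound.** Let $\mathcal D_rf_t(y\mid z)=\log\frac{f_t(y\mid z)}{\inf_{C_r(y)}f_t(\cdot\mid z)}$ or, at steps where $f_t(\cdot\mid z)\in C^1$ for a.e. $z$, alternatively $\mathcal D_rf_t(y\mid z)=\frac{r\sqrt D}2\sup_{u\in C_r(y)}\|\nabla_u\log f_t(u\mid z)\|$. With $\mathcal B=\{(y,z):C_\delta(y)\cap A_0\ne\emptyset\}$, $$B_t^{Nor}=\int\mathcal D_\delta f_t\,dF_t+\int_{\mathcal B}\mathcal D_{r_{t-1}}f_t\,dF_t+\int_{\mathcal B}\Bigl(\frac{\|y\|^2}{2\sigma_{t,0}^2}-\log\frac{(r_{t-1}/2)^D}{(2\pi\sigma_{t,0}^2)^{D/2}}\Bigr)dF_t+\frac{6D^{3/2}\delta^{D-1}h}{(2\pi)^{D/2}\sigma^D}+2e^{-(\delta/\sigma)^2/8}.$$ **Theorem.** Under these hypotheses (all quantities being in $[0,\infty]$): 1. For all $t,n$ and all $N_t,L_t\ge1$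 there is an $(N_t,L_t)$-accurate ReLU network with width at most $m_t\cdot17s_t^{d_t+1}3^{d_t}d_t(N_t+2)\log_2(8N_t)$ and depth at most $18s_t^2(L_t+2)\log_2(4L_t)+2d_t$. 2. There are thresholds, depending on neither $N_t,L_t$ nor the networks, such that if at every step $t$ the index $n=n_t$ of the partition is above its threshold, then for all $N_t,L_t\ge1$ and all $(N_t,L_t)$-accurate networks (for either choice of $\mathcal D$ where it is available) $$\mathcal E_{KL}(\pi_{p^{NN},\nu})\le\mathbb E[\mathrm{Comp}(C)]+\sum_{t=1}^T\Bigl(B_t^{Nor}+170(s_t+1)^{d_t}8^{s_t}\Lambda^{\max}_{t,m_t}N_t^{-2s_t/d_t}L_t^{-2s_t/d_t}\Bigr).$$ 3. Suppose in addition that for each $t$: $f_t(\cdot\mid z)\in C^1$ for a.e. $z$, $\theta_t>2$, $\int|y_i|^{\theta_t}dF_t<\infty$ for all $i$, and, with $S_t(y,z)=\sup_{u\in C_{r_{t-1}}(y)}\|\nabla_u\log f_t(u\mid z)\|$, both $\int S_t\,dF_t<\infty$ and $\int|y_{i_t}|^{\theta_t-2}S_t\,dF_t<\infty$ for some $i_t$.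 Let $\xi_t>0$ and $\beta_t=D^{-1}/(2+\frac1{\theta_t-2}+\xi_t)$. Then there exist partition sequences as above which are *tuned*, meaning that $\delta$, $\delta^{D-1}h/\sigma^D$ and $e^{-(\delta/\sigma)^2/8}$ are all $O(m_t^{-\beta_t})$ and, for some $\kappa>0$ and all large $n$, $C_\delta(y)$ misses $A_0$ whenever $\max_i|y_i|\le\kappa m_t^{\beta_t/(\theta_t-2)}$. If the given partition sequences are tuned, there are constants $C_t<\infty$, not depending on $n_t,N_t,L_t$ or the networks, such that for all $n_t$, all $N_t,L_t\ge1$ and all $(N_t,L_t)$-accurate networks $$\mathcal E_{KL}(\pi_{p^{NN},\nu})\le\mathbb E[\mathrm{Comp}(C)]+\sum_{t=1}^T\Bigl(C_tm_t^{-\beta_t}+170(s_t+1)^{d_t}8^{s_t}\Lambda^{\max}_{t,m_t}N_t^{-2s_t/d_t}L_t^{-2s_t/d_t}\Bigr).$$ -/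

import Mathlib

open MeasureTheory ProbabilityTheory InformationTheory Filter Topology Asymptotics
open scoped ENNReal NNReal

noncomputable section

namespace CondDiffusion

/-- The state space `ℝ^D` with the Euclidean norm and Lebesgue measure. -/
abbrev Vec (D : ℕ) := EuclideanSpace ℝ (Fin D)

/-! ### Markov paths and diffusion problems -/

/-- Law of the path `(x₀, …, xₙ)` of an inhomogeneous Markov chain with parameter `a : A`:
`init(dx₀ | a) ∏_{i<n} step i (dx_{i+1} | a, xᵢ)`. -/
def pathKernel {A X : Type*} [MeasurableSpace A] [MeasurableSpace X] (init : Kernel A X) :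
    (n : ℕ) → (Fin n → Kernel (A × X) X) → Kernel A (Fin (n + 1) → X)
  | 0, _ => init.map (fun x _ => x)
  | n + 1, step =>
      (pathKernel init n (fun i => step i.castSucc) ⊗ₖ
        (step (Fin.last n)).comap (fun p : A × (Fin (n + 1) → X) => (p.1, p.2 (Fin.last n)))
          (measurable_fst.prodMk ((measurable_pi_apply _).comp measurable_snd))).map
        (fun p => (Fin.snoc p.1 p.2 : Fin (n + 2) → X))

/-- A conditional prediction problem on `ℝ^D` with a forward diffusion of horizon `T`:
context law, true conditional law with a density, forward kernels `q_s(dx_{s+1} | x_s)`,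
`s = 0, …, T-1`, with strictly positive densities, and a reference law with a density. -/
structure DiffusionProblem (𝒞 : Type*) [MeasurableSpace 𝒞] (D T : ℕ) where
  /-- the law of the context -/
  context : Measure 𝒞
  /-- the true conditional law -/
  target : Kernel 𝒞 (Vec D)
  targetDensity : 𝒞 → Vec D → ℝ
  /-- `forward s x` is the law of `X_{s+1}` given `X_s = x` -/
  forward : Fin T → Kernel (Vec D) (Vec D)
  /-- `forwardDensity s v u` is the density `q_s(u | v)` -/
  forwardDensity : Fin T → Vec D → Vec D → ℝ
  /-- the initial law `ν` of the reverse chain -/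
  reference : Measure (Vec D)
  isProbabilityMeasure_context : IsProbabilityMeasure context
  isMarkovKernel_target : IsMarkovKernel target
  isMarkovKernel_forward : ∀ s, IsMarkovKernel (forward s)
  isProbabilityMeasure_reference : IsProbabilityMeasure reference
  measurable_targetDensity : Measurable (Function.uncurry targetDensity)
  targetDensity_nonneg : ∀ c x, 0 ≤ targetDensity c x
  target_eq : ∀ᵐ c ∂context,
    target c = volume.withDensity (fun x => ENNReal.ofReal (targetDensity c x))
  measurable_forwardDensity : ∀ s, Measurable (Function.uncurry (forwardDensity s))
  forwardDensity_pos : ∀ s v u, 0 < forwardDensity s v u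
  forward_eq : ∀ s v,
    forward s v = volume.withDensity (fun u => ENNReal.ofReal (forwardDensity s v u))
  reference_absolutelyContinuous : reference ≪ volume

namespace DiffusionProblem

variable {𝒞 : Type*} [MeasurableSpace 𝒞] {D T : ℕ} (X : DiffusionProblem 𝒞 D T)

/-- Forward path kernel, `c ↦` law of `(X₀, …, X_T)`. -/
def forwardPath : Kernel 𝒞 (Fin (T + 1) → Vec D) :=
  pathKernel X.target T (fun s => (X.forward s).comap Prod.snd measurable_snd)

/-- Conditional law of `X_j` given the context. -/
def marginal (j : Fin (T + 1)) : Kernel 𝒞 (Vec D) :=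
  X.forwardPath.map (fun x => x j)

/-- Density of `X_j` given the context: the target density for `j = 0`, and
`u ↦ ∫ q_s(u | v) (law of X_s)(dv)` for `j = s + 1`. -/
def marginalDensity (j : Fin (T + 1)) : 𝒞 → Vec D → ℝ :=
  Fin.cases X.targetDensity
    (fun s c u => ∫ v, X.forwardDensity s v u ∂(X.marginal s.castSucc c)) j

/-- Joint law of `((C, X_{s+1}), X_s)`. -/
def jointLaw (s : Fin T) : Measure ((𝒞 × Vec D) × Vec D) :=
  (X.context ⊗ₘ X.forwardPath).map (fun p => ((p.1, p.2 s.succ), p.2 s.castSucc))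

instance instIsFiniteMeasureJointLaw (s : Fin T) : IsFiniteMeasure (X.jointLaw s) := by
  have := X.isProbabilityMeasure_context
  have := X.isMarkovKernel_target
  have := X.isMarkovKernel_forward
  have h : ∀ (n : ℕ) (step : Fin n → Kernel (𝒞 × Vec D) (Vec D)),
      (∀ i, IsMarkovKernel (step i)) → IsFiniteKernel (pathKernel X.target n step) := by
    intro n
    induction n with
    | zero => intro step _; unfold pathKernel; infer_instance
    | succ n ih =>
      intro step hs
      have := ih (fun i => step i.castSucc) (fun i => hs _)
      have := hs (Fin.last n)
      unfold pathKernel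
      infer_instance
  have : IsFiniteKernel X.forwardPath := h _ _ (fun _ => inferInstance)
  unfold jointLaw
  infer_instance

/-- The true reverse kernel: conditional law of `X_s` given `(C, X_{s+1})`. -/
def reverseKernel (s : Fin T) : Kernel (𝒞 × Vec D) (Vec D) :=
  (X.jointLaw s).condKernel

/-- Output law of the reverse chain: start from `X_T ∼ ν`, and for `s = T-1, …, 0` draw `X_s`
from `p s (· | c, X_{s+1})`; the output is `X₀`, the last state of this chain. -/
def predictor (p : Fin T → Kernel (𝒞 × Vec D) (Vec D)) : Kernel 𝒞 (Vec D) :=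
  (pathKernel (Kernel.const 𝒞 X.reference) T (fun k => p k.rev)).map (fun x => x (Fin.last T))

/-- Context-averaged conditional KL error of a predictor. -/
def outputKL (π : Kernel 𝒞 (Vec D)) : ℝ≥0∞ :=
  ∫⁻ c, klDiv (X.target c) (π c) ∂X.context

/-- Expected terminal mismatch `E[KL(law of X_T given C ‖ ν)]`. -/
def terminalMismatch : ℝ≥0∞ :=
  ∫⁻ c, klDiv (X.marginal (Fin.last T) c) X.reference ∂X.context

/-- Joint law of `(X_s, φ(C, X_{s+1}))`. -/
def featureLaw (s : Fin T) {d : ℕ} (φ : 𝒞 × Vec D → Fin d → ℝ) :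
    Measure (Vec D × (Fin d → ℝ)) :=
  (X.jointLaw s).map (fun p => (p.2, φ p.1))

end DiffusionProblem

/-! ### Assumptions on the features and on the forward densities -/

/-- Closed axis-parallel hypercube of side-length `r` centered at `y`. -/
def cube {D : ℕ} (r : ℝ) (y : Vec D) : Set (Vec D) :=
  {u | ∀ i, |u i - y i| ≤ r / 2}

/-- `φ` is a sufficient feature map for the reverse step `X_{s+1} → X_s`, with compact support
`K` and with conditional density `f z y` of `X_s` at `y` given the feature value `z`. -/
structure FeatureAssumption {𝒞 : Type*} [MeasurableSpace 𝒞] {D T : ℕ}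
    (X : DiffusionProblem 𝒞 D T) (s : Fin T) {d : ℕ} (φ : 𝒞 × Vec D → Fin d → ℝ)
    (K : Set (Fin d → ℝ)) (f : (Fin d → ℝ) → Vec D → ℝ) : Prop where
  measurable_feature : Measurable φ
  measurable_density : Measurable (Function.uncurry f)
  density_nonneg : ∀ z y, 0 ≤ f z y
  isCompact : IsCompact K
  compact_support : (X.featureLaw s φ).snd K = 1
  disintegration : X.featureLaw s φ =
    (volume.prod (X.featureLaw s φ).snd).withDensity (fun p => ENNReal.ofReal (f p.2 p.1))
  sufficiency : ∀ᵐ w ∂(X.jointLaw s).fst,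
    X.reverseKernel s w = volume.withDensity (fun y => ENNReal.ofReal (f (φ w) y))

/-- Regularity of the forward densities; `r s` is the side-length of the hypercubes on which the
log-variation is controlled. The two log-variation bounds
`log (g x / inf_{C(x)} g) ≤ a x` are written as `g x ≤ exp (a x) * g y` for all `y ∈ C(x)`. -/
structure RegularityAssumption {𝒞 : Type*} [MeasurableSpace 𝒞] {D T : ℕ}
    (X : DiffusionProblem 𝒞 D T) (r : Fin T → ℝ) : Prop where
  targetDensity_pos : ∀ᵐ c ∂X.context, ∀ x, 0 < X.targetDensity c x
  continuous_targetDensity : ∀ᵐ c ∂X.context, Continuous (X.targetDensity c)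
  continuous_forwardDensity : ∀ s v, Continuous (X.forwardDensity s v)
  dominated : ∀ s, ∀ᵐ c ∂X.context, ∀ K : Set (Vec D), IsCompact K →
    ∃ g : Vec D → ℝ, Integrable g (X.marginal (Fin.castSucc s) c) ∧
      ∀ v, ∀ u ∈ K, X.forwardDensity s v u ≤ g v
  second_moment : ∀ s : Fin T,
    ∫⁻ c, ∫⁻ y, ‖y‖ₑ ^ 2 ∂(X.marginal s.castSucc c) ∂X.context < ∞
  side_pos : ∀ s, 0 < r s
  log_variation : ∀ s : Fin T, ∃ (cen : Vec D → Vec D) (a : Vec D → ℝ) (b : Vec D → Vec D → ℝ),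
    (∀ x, x ∈ cube (r s) (cen x)) ∧ (∀ x, 0 ≤ a x) ∧ (∀ x x', 0 ≤ b x x') ∧
    Measurable a ∧ Measurable (Function.uncurry b) ∧
    (∀ᵐ c ∂X.context, ∀ᵐ x, ∀ y ∈ cube (r s) (cen x),
      X.marginalDensity s.castSucc c x ≤ Real.exp (a x) * X.marginalDensity s.castSucc c y) ∧
    (∀ᵐ p : Vec D × Vec D, ∀ y ∈ cube (r s) (cen p.1),
      X.forwardDensity s p.1 p.2 ≤ Real.exp (b p.1 p.2) * X.forwardDensity s y p.2) ∧
    Integrable (fun p => a p.2 + b p.2 p.1.2) (X.jointLaw s)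

/-! ### Partitions and Gaussian mixtures -/

/-- Half-open axis-parallel hypercube of side-length `h` with center `μ`. -/
def cell {D : ℕ} (h : ℝ) (μ : Vec D) : Set (Vec D) :=
  {y | ∀ i, μ i - h / 2 ≤ y i ∧ y i < μ i + h / 2}

/-- `S` contains a hypercube of side-length `ℓ` that has `y` as a vertex. -/
def HasCornerCube {D : ℕ} (ℓ : ℝ) (S : Set (Vec D)) (y : Vec D) : Prop :=
  ∃ ε : Fin D → ℝ, (∀ i, ε i = 1 ∨ ε i = -1) ∧
    {u : Vec D | ∀ i, 0 ≤ ε i * (u i - y i) ∧ ε i * (u i - y i) ≤ ℓ} ⊆ S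

/-- A sequence of partitions of `ℝ^D` into finitely many cells of a cubic grid and a remainder
set, with the associated scales. The `n`-th partition has `m = size n` cubic cells. -/
structure PartitionData (D : ℕ) (r : ℝ) where
  size : ℕ → ℕ
  /-- side-length `h` of the cells -/
  side : ℕ → ℝ
  /-- centers `μ_j` of the cells -/
  center : (n : ℕ) → Fin (size n) → Vec D
  /-- boundary scale `δ` -/
  delta : ℕ → ℝ
  /-- bandwidth of the components centered in the cells -/
  sigma : ℕ → ℝ
  /-- bandwidth of the component of the remainder set -/
  sigmaZero : ℝ
  size_pos : ∀ n, 0 < size n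
  tendsto_size : Tendsto size atTop atTop
  side_pos : ∀ n, 0 < side n
  tendsto_side : Tendsto side atTop (𝓝 0)
  center_injective : ∀ n, Function.Injective (center n)
  grid : ∀ n, ∃ o : Fin D → ℝ, ∀ j, ∃ k : Fin D → ℤ, ∀ i, center n j i = o i + side n * k i
  delta_pos : ∀ n, 0 < delta n
  tendsto_delta : Tendsto delta atTop (𝓝 0)
  sigma_pos : ∀ n, 0 < sigma n
  sigmaZero_pos : 0 < sigmaZero
  eventually_misses : ∀ y : Vec D, ∀ᶠ n in atTop,
    cube (delta n) y ⊆ ⋃ j, cell (side n) (center n j)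
  eventually_corner : ∀ᶠ n in atTop,
    (∀ y ∉ ⋃ j, cell (side n) (center n j),
      HasCornerCube (r / 2) (⋃ j, cell (side n) (center n j))ᶜ y) ∧
    (∀ y ∈ ⋃ j, cell (side n) (center n j),
      HasCornerCube (r / 2) (⋃ j, cell (side n) (center n j)) y)
  tendsto_sigma_div_delta : Tendsto (fun n => sigma n / delta n) atTop (𝓝 0)
  tendsto_riemann :
    Tendsto (fun n => delta n ^ (D - 1) * side n / sigma n ^ D) atTop (𝓝 0)
  sigmaZero_bound :
    (r / 2) ^ D / (2 * Real.pi * sigmaZero ^ 2) ^ ((D : ℝ) / 2) ≤ (2 ^ (D + 1) : ℝ)⁻¹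

namespace PartitionData

variable {D : ℕ} {r : ℝ} (P : PartitionData D r)

/-- The remainder set `A₀` of the `n`-th partition. -/
def remainder (n : ℕ) : Set (Vec D) := (⋃ j, cell (P.side n) (P.center n j))ᶜ

/-- Exact log-odds `log (G_j(z) / G_0(z))`, where `G_j(z)` is the integral of `f z` over the
cell `A_j`. -/
def logOdds {d : ℕ} (f : (Fin d → ℝ) → Vec D → ℝ) (n : ℕ) (j : Fin (P.size n))
    (z : Fin d → ℝ) : ℝ :=
  Real.log ((∫ y in cell (P.side n) (P.center n j), f z y) / ∫ y in P.remainder n, f z y)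

end PartitionData

/-- Density of the normal law `N(μ, σ² I_D)`. -/
def gaussianDensity {D : ℕ} (μ : Vec D) (σ : ℝ) (y : Vec D) : ℝ :=
  Real.exp (-‖y - μ‖ ^ 2 / (2 * σ ^ 2)) / (2 * Real.pi * σ ^ 2) ^ ((D : ℝ) / 2)

/-- Gaussian mixture density whose weights are the baseline softmax of the logits `u`. -/
def mixtureDensity {D : ℕ} {r : ℝ} (P : PartitionData D r) (n : ℕ) (u : Fin (P.size n) → ℝ)
    (y : Vec D) : ℝ :=
  (∑ j, Real.exp (u j) / (1 + ∑ k, Real.exp (u k)) * gaussianDensity (P.center n j) (P.sigma n) y)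
    + 1 / (1 + ∑ k, Real.exp (u k)) * gaussianDensity 0 P.sigmaZero y

/-! ### ReLU networks -/

/-- Fully connected feed-forward ReLU networks with `i` inputs and `o` outputs. -/
inductive ReLUNet : ℕ → ℕ → Type
  /-- affine output layer -/
  | output {i o : ℕ} (A : Matrix (Fin o) (Fin i) ℝ) (b : Fin o → ℝ) : ReLUNet i o
  /-- a hidden layer with `k` neurons, followed by the rest of the network -/
  | hidden {i k o : ℕ} (A : Matrix (Fin k) (Fin i) ℝ) (b : Fin k → ℝ) (rest : ReLUNet k o) :
      ReLUNet i o

namespace ReLUNet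

/-- The function realized by the network. -/
def eval : {i o : ℕ} → ReLUNet i o → (Fin i → ℝ) → Fin o → ℝ
  | _, _, output A b, x => A.mulVec x + b
  | _, _, hidden A b rest, x => rest.eval (fun l => max ((A.mulVec x + b) l) 0)

/-- Maximal number of neurons in a hidden layer. -/
def width : {i o : ℕ} → ReLUNet i o → ℕ
  | _, _, output _ _ => 0
  | _, _, hidden (k := k) _ _ rest => max k rest.width

/-- Number of hidden layers. -/
def depth : {i o : ℕ} → ReLUNet i o → ℕ
  | _, _, output _ _ => 0
  | _, _, hidden _ _ rest => rest.depth + 1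

end ReLUNet

/-- Neural reverse kernel: the Gaussian mixture with logits `a (φ (c, x))`. -/
def neuralKernel {𝒞 : Type*} [MeasurableSpace 𝒞] {D d : ℕ} {r : ℝ}
    (φ : 𝒞 × Vec D → Fin d → ℝ) (P : PartitionData D r) (n : ℕ) (a : ReLUNet d (P.size n)) :
    Kernel (𝒞 × Vec D) (Vec D) :=
  (Kernel.const (𝒞 × Vec D) (volume : Measure (Vec D))).withDensity
    (fun w y => ENNReal.ofReal (mixtureDensity P n (a.eval (φ w)) y))

/-! ### Smooth log-odds and the network error -/

/-- `C^s` norm on `[0,1]^d`: the largest supremum of a partial derivative of order at most `s`. -/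
def csNorm {d : ℕ} (s : ℕ) (g : (Fin d → ℝ) → ℝ) : ℝ≥0∞ :=
  ⨆ (k : ℕ) (_ : k ≤ s) (ι : Fin k → Fin d) (x ∈ Set.Icc (0 : Fin d → ℝ) 1),
    ‖iteratedFDeriv ℝ k g x (fun l => Pi.single (ι l) 1)‖ₑ

/-- The closed cube with lowest corner `lo` and side-length `len`. -/
def featureCube {d : ℕ} (lo : Fin d → ℝ) (len : ℝ) : Set (Fin d → ℝ) :=
  Set.Icc lo (fun i => lo i + len)

/-- The functions `Lam n j` are extensions of the log-odds from `K` to functions that are `C^s`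
on a neighborhood of the cube `featureCube lo len ⊇ K`. -/
structure SmoothLogOdds {D d : ℕ} {r : ℝ} (P : PartitionData D r)
    (f : (Fin d → ℝ) → Vec D → ℝ) (K : Set (Fin d → ℝ)) (s : ℕ) (lo : Fin d → ℝ) (len : ℝ)
    (Lam : (n : ℕ) → Fin (P.size n) → (Fin d → ℝ) → ℝ) : Prop where
  len_pos : 0 < len
  subset_cube : K ⊆ featureCube lo len
  smooth : ∀ n j, ∃ U, IsOpen U ∧ featureCube lo len ⊆ U ∧ ContDiffOn ℝ s (Lam n j) U
  eqOn : ∀ n j, Set.EqOn (Lam n j) (P.logOdds f n j) K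

/-- `max_j ‖Lam_j ∘ Ψ‖_{C^s([0,1]^d)}` with `Ψ(u) = lo + len • u` mapping `[0,1]^d` onto the
cube. -/
def lamMax {d m : ℕ} (s : ℕ) (lo : Fin d → ℝ) (len : ℝ) (Lam : Fin m → (Fin d → ℝ) → ℝ) : ℝ≥0∞ :=
  ⨆ j, csNorm s (fun u => Lam j (lo + len • u))

/-- `(s+1)^d 8^s Λ N^{-2s/d} L^{-2s/d}`. -/
def logitRate (s d N L : ℕ) (Λ : ℝ≥0∞) : ℝ≥0∞ :=
  ENNReal.ofReal ((s + 1 : ℝ) ^ d * 8 ^ s) * Λ *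
    ENNReal.ofReal ((N : ℝ) ^ (-(2 * s : ℝ) / d) * (L : ℝ) ^ (-(2 * s : ℝ) / d))

/-- `sup_{z ∈ K} max_j |a_j(z) - log-odds_j(z)|`. -/
def logitError {D d : ℕ} {r : ℝ} (P : PartitionData D r) (f : (Fin d → ℝ) → Vec D → ℝ)
    (K : Set (Fin d → ℝ)) (n : ℕ) (a : ReLUNet d (P.size n)) : ℝ≥0∞ :=
  ⨆ (j : Fin (P.size n)) (z ∈ K), ‖a.eval z j - P.logOdds f n j z‖ₑ

/-! ### The explicit mixture bound -/

/-- `sup_{u ∈ C_r(y)} ‖∇_u log f(u | z)‖`. -/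
def gradSup {D d : ℕ} (f : (Fin d → ℝ) → Vec D → ℝ) (r : ℝ) (z : Fin d → ℝ) (y : Vec D) :
    ℝ≥0∞ :=
  ⨆ u ∈ cube r y, ‖gradient (fun v => Real.log (f z v)) u‖ₑ

/-- Local oscillation `𝒟_r f(y | z)`: `log (f(y|z) / inf_{C_r(y)} f(·|z))` in general, and the
gradient form if `c1 = true`. -/
def localOsc {D d : ℕ} (c1 : Bool) (f : (Fin d → ℝ) → Vec D → ℝ) (r : ℝ) (z : Fin d → ℝ)
    (y : Vec D) : ℝ≥0∞ :=
  if c1 then ENNReal.ofReal (r * √D / 2) * gradSup f r z y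
  else (ENNReal.log
    (ENNReal.ofReal (f z y) / ⨅ u ∈ cube r y, ENNReal.ofReal (f z u))).toENNReal

/-- The boundary event `{(y, z) : C_δ(y) ∩ A₀ ≠ ∅}`. -/
def boundaryEvent {D : ℕ} {r : ℝ} (P : PartitionData D r) (n d : ℕ) :
    Set (Vec D × (Fin d → ℝ)) :=
  {p | (cube (P.delta n) p.1 ∩ P.remainder n).Nonempty}

/-- The explicit bound for the Gaussian mixture with exact log-odds, for a joint law `F` of
`(y, z)` with conditional density `f`. -/
def noretsBound {D d : ℕ} {r : ℝ} (P : PartitionData D r) (n : ℕ) (c1 : Bool)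
    (f : (Fin d → ℝ) → Vec D → ℝ) (F : Measure (Vec D × (Fin d → ℝ))) : ℝ≥0∞ :=
  (∫⁻ p, localOsc c1 f (P.delta n) p.2 p.1 ∂F)
  + (∫⁻ p in boundaryEvent P n d, localOsc c1 f r p.2 p.1 ∂F)
  + (∫⁻ p in boundaryEvent P n d, ENNReal.ofReal
      (‖p.1‖ ^ 2 / (2 * P.sigmaZero ^ 2)
        - Real.log ((r / 2) ^ D / (2 * Real.pi * P.sigmaZero ^ 2) ^ ((D : ℝ) / 2))) ∂F)
  + ENNReal.ofReal (6 * (D : ℝ) ^ (3 / 2 : ℝ) * P.delta n ^ (D - 1) * P.side n /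
      ((2 * Real.pi) ^ ((D : ℝ) / 2) * P.sigma n ^ D))
  + ENNReal.ofReal (2 * Real.exp (-(P.delta n / P.sigma n) ^ 2 / 8))

/-- The densities `f(· | z)` are continuously differentiable for almost all `z`. -/
def IsC1Density {D d : ℕ} (f : (Fin d → ℝ) → Vec D → ℝ) (F : Measure (Vec D × (Fin d → ℝ))) :
    Prop :=
  ∀ᵐ z ∂F.snd, ContDiff ℝ 1 (f z)

/-- Moment hypotheses of the `C¹` branch. -/
structure PowerRateHyp {D d : ℕ} (r : ℝ) (f : (Fin d → ℝ) → Vec D → ℝ)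
    (F : Measure (Vec D × (Fin d → ℝ))) (θ : ℝ) : Prop where
  isC1 : IsC1Density f F
  two_lt : 2 < θ
  moment : ∀ i, ∫⁻ p, ‖p.1 i‖ₑ ^ θ ∂F < ∞
  gradient_integrable : ∫⁻ p, gradSup f r p.2 p.1 ∂F < ∞
  gradient_moment : ∃ i, ∫⁻ p, ‖p.1 i‖ₑ ^ (θ - 2) * gradSup f r p.2 p.1 ∂F < ∞

/-- The rate exponent `β = D⁻¹ / (2 + 1 / (θ - 2) + ξ)`. -/
def rateExponent (D : ℕ) (θ ξ : ℝ) : ℝ := (D : ℝ)⁻¹ / (2 + 1 / (θ - 2) + ξ)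

/-- The scales of the partition are tuned to the exponent `β = rateExponent D θ ξ`: up to
constants, every scale-dependent error term is at most `m^{-β}`, and the cells cover a cube of
half-width `m^{β/(θ-2)}`, where `m` is the number of cells. -/
structure PartitionData.Calibrated {D : ℕ} {r : ℝ} (P : PartitionData D r) (θ ξ : ℝ) :
    Prop where
  delta_isBigO : P.delta =O[atTop] fun n => (P.size n : ℝ) ^ (-rateExponent D θ ξ)
  riemann_isBigO : (fun n => P.delta n ^ (D - 1) * P.side n / P.sigma n ^ D) =O[atTop]
    fun n => (P.size n : ℝ) ^ (-rateExponent D θ ξ)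
  exp_isBigO : (fun n => Real.exp (-(P.delta n / P.sigma n) ^ 2 / 8)) =O[atTop]
    fun n => (P.size n : ℝ) ^ (-rateExponent D θ ξ)
  covers : ∃ κ > 0, ∀ᶠ n in atTop, ∀ y : Vec D,
    (∀ i, |y i| ≤ κ * (P.size n : ℝ) ^ (rateExponent D θ ξ / (θ - 2))) →
      Disjoint (cube (P.delta n) y) (P.remainder n)

end CondDiffusion

end

open CondDiffusion

/-!
The error splits into a probabilistic and an approximation-theoretic part.

*Chain of divergences.* By the chain rule and the data processing inequality for the
Kullback-Leibler divergence, undoing the reverse steps one at a time bounds the output error by the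
terminal mismatch plus the averaged divergences of the single steps
(`DiffusionProblem.outputKL_predictor_le`). By sufficiency of the features, the divergence of one
step is at most the integral of the positive part of `log (f / mixture)` against the law of state
and feature. Logits with uniform error `ε` change the mixture by at most the factor `exp (2 ε)`, so
that one step costs at most the error of the mixture with exact cell probabilities plus twice the
logit error (`lintegral_klDiv_le_exactError`). Positivity of the forward densities makes all cell
probabilities positive, so the log-odds are genuine.

*The mixture with exact weights.* At a point whose `δ`-cube is covered by cells the mixture is a
Riemann sum for the convolution of `f` with a Gaussian kernel of bandwidth `σ`. Up to the
oscillation of `f` on the `δ`-cube, the Gaussian tail outside this cube and the Riemann error are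
all that is lost. At any other point one uses the corner cube inside the cells, which carries
about `2⁻ᴰ` of the Gaussian mass, or the corner cube inside the remainder set together with the
wide Gaussian. This gives `FeatureAssumption.eventually_exactError_le`.

*Networks.* The networks approximate a `C^s` function by its Taylor polynomials on a grid with
about `N^{2/d} L^{2/d}` cells per direction. Ramps extract the digits of the coordinates, which
determine the cell and the position in it; the quantized Taylor coefficients are stored as digits
of `N² L` numbers, `L` cells to a number, and read off by a table lookup followed by digit
extraction; products of digits are computed exactly by gating. All of this is exact unless a
coordinate is close to a boundary of the grid of truncated positions. Taking medians of three
shifted copies, one coordinate direction after the other, removes this restriction, since at most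
one of three shifts is bad. The bookkeeping of widths and depths is done by the predicate `Avail`,
and the result is `exists_net_approx`.

*The power rate.* Inside the cube covered by the cells, `𝒟_δ f` and the Gaussian terms are
`O(m^{-β})`. Outside of it, `log (f / mixture)` is bounded for every partition by a gradient term,
`‖y‖²`, and the logarithm of the reciprocal probability of the set of the partition that contains
`y`. The mean of this reciprocal is the number `m + 1` of sets, so that after linearizing the
logarithm only a term logarithmic in `m` remains, which the `θ`-th moment makes `O(m^{-β})`
(`FeatureAssumption.exists_exactError_le`). The same bound shows that the error is finite for every
single partition, which extends the rate from large indices to all. Tuned partitions are obtained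
by tiling a cube around the origin (`exists_calibrated`).
-/

namespace CondDiffusion

/-! ### A calculus of layers for ReLU networks -/

/-- Composition of a real function with the ReLU activation. -/
def relu {X : Type*} (f : X → ℝ) : X → ℝ := fun x => max (f x) 0

/-- Affine combinations of the functions in `S`: the linear span of `S` and the constants. -/
def affSpan {X : Type*} (S : Set (X → ℝ)) : Submodule ℝ (X → ℝ) :=
  Submodule.span ℝ (insert 1 S)

section AffSpan

variable {X : Type*} {S T : Set (X → ℝ)} {f g : X → ℝ}

lemma subset_affSpan : S ⊆ affSpan S :=
  (Set.subset_insert _ _).trans Submodule.subset_span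

lemma mem_affSpan (h : f ∈ S) : f ∈ affSpan S := subset_affSpan h

lemma one_mem_affSpan : (1 : X → ℝ) ∈ affSpan S :=
  Submodule.subset_span (Set.mem_insert _ _)

lemma const_mem_affSpan (c : ℝ) : (fun _ => c) ∈ affSpan S := by
  have := (affSpan S).smul_mem c one_mem_affSpan
  convert this using 1
  ext; simp

lemma add_mem_affSpan (hf : f ∈ affSpan S) (hg : g ∈ affSpan S) :
    (fun x => f x + g x) ∈ affSpan S := (affSpan S).add_mem hf hg

lemma sub_mem_affSpan (hf : f ∈ affSpan S) (hg : g ∈ affSpan S) :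
    (fun x => f x - g x) ∈ affSpan S := (affSpan S).sub_mem hf hg

lemma neg_mem_affSpan (hf : f ∈ affSpan S) : (fun x => -f x) ∈ affSpan S :=
  (affSpan S).neg_mem hf

lemma mul_mem_affSpan (a : ℝ) (hf : f ∈ affSpan S) : (fun x => a * f x) ∈ affSpan S :=
  (affSpan S).smul_mem a hf

lemma sum_mem_affSpan {ι : Type*} (s : Finset ι) {F : ι → X → ℝ}
    (hF : ∀ i ∈ s, F i ∈ affSpan S) : (fun x => ∑ i ∈ s, F i x) ∈ affSpan S := by
  have := (affSpan S).sum_mem hF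
  convert this using 1
  ext; simp

lemma affSpan_le (h : S ⊆ affSpan T) : affSpan S ≤ affSpan T := by
  refine Submodule.span_le.2 (Set.insert_subset one_mem_affSpan h)

lemma affSpan_mono (h : S ⊆ T) : affSpan S ≤ affSpan T :=
  affSpan_le (h.trans subset_affSpan)

lemma exists_of_mem_affSpan_range {k : ℕ} {g : Fin k → X → ℝ}
    (hf : f ∈ affSpan (Set.range g)) :
    ∃ (a : Fin k → ℝ) (c : ℝ), ∀ x, f x = ∑ i, a i * g i x + c := by
  obtain ⟨c, z, hz, rfl⟩ := Submodule.mem_span_insert.1 hf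
  obtain ⟨a, rfl⟩ := (Submodule.mem_span_range_iff_exists_fun ℝ).1 hz
  exact ⟨a, c, fun x => by simp [add_comm]⟩

lemma comp_mem_affSpan {Y : Type*} (τ : Y → X) (hf : f ∈ affSpan S) :
    f ∘ τ ∈ affSpan ((· ∘ τ) '' S) := by
  induction hf using Submodule.span_induction with
  | mem x h =>
    rcases h with rfl | h
    · exact one_mem_affSpan
    · exact mem_affSpan ⟨x, h, rfl⟩
  | zero => exact Submodule.zero_mem _
  | add x y _ _ hx hy => exact Submodule.add_mem _ hx hy
  | smul a x _ hx => exact Submodule.smul_mem _ a hx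

end AffSpan

/-- The coordinate functions on `ℝ^d`. -/
def coords (d : ℕ) : Set ((Fin d → ℝ) → ℝ) := Set.range fun i x => x i

/-- `Avail W D S`: the functions in `S` of the network input can all be read off affinely from
the `D`-th hidden layer of one ReLU network whose hidden layers have at most `W` neurons. -/
def Avail {d : ℕ} (W : ℕ) : ℕ → Set ((Fin d → ℝ) → ℝ) → Prop
  | 0, S => S ⊆ affSpan (coords d)
  | D + 1, S => ∃ R : Set ((Fin d → ℝ) → ℝ), Avail W D R ∧ R.encard ≤ W ∧
      S ⊆ (affSpan (relu '' R) : Set ((Fin d → ℝ) → ℝ))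

namespace Avail

variable {d W W' D : ℕ} {S T C : Set ((Fin d → ℝ) → ℝ)}

lemma of_affSpan (h : Avail W D S) (hT : T ⊆ affSpan S) : Avail W D T := by
  cases D with
  | zero => exact hT.trans (affSpan_le h)
  | succ D =>
    obtain ⟨R, h1, h2, h3⟩ := h
    exact ⟨R, h1, h2, hT.trans (affSpan_le h3)⟩

lemma subset (h : Avail W D S) (hT : T ⊆ S) : Avail W D T :=
  h.of_affSpan (hT.trans subset_affSpan)

lemma mono_width (h : Avail W D S) (hW : W ≤ W') : Avail W' D S := by
  induction D generalizing S with
  | zero => exact h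
  | succ D ih =>
    obtain ⟨R, h1, h2, h3⟩ := h
    exact ⟨R, ih h1, h2.trans (by exact_mod_cast hW), h3⟩

lemma relu_sub_relu_neg {X : Type*} (f : X → ℝ) (x : X) :
    relu f x - relu (fun x => -f x) x = f x := by
  simp only [relu]
  rcases le_total 0 (f x) with h | h
  · rw [max_eq_left h, max_eq_right (by linarith)]; ring
  · rw [max_eq_right h, max_eq_left (by linarith)]; ring

/-- One more hidden layer: the neurons in `T` cost one unit each; the functions in `C` are passed
on unchanged at a cost of two units each, as `f = relu f - relu (-f)`. -/
lemma step (h : Avail W D S) (hT : T ⊆ affSpan S) (hC : C ⊆ affSpan S)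
    (hW : T.encard + 2 * C.encard ≤ W) : Avail W (D + 1) (relu '' T ∪ C) := by
  refine ⟨T ∪ (C ∪ (fun f x => -f x) '' C), h.of_affSpan ?_, ?_, ?_⟩
  · refine Set.union_subset hT (Set.union_subset hC ?_)
    rintro _ ⟨f, hf, rfl⟩
    exact neg_mem_affSpan (hC hf)
  · refine (Set.encard_union_le _ _).trans (le_trans ?_ hW)
    gcongr
    refine (Set.encard_union_le _ _).trans ?_
    rw [two_mul]
    exact add_le_add le_rfl (Set.encard_image_le _ _)
  · refine Set.union_subset ?_ ?_
    · exact (Set.image_mono Set.subset_union_left).trans subset_affSpan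
    · intro f hf
      have h1 : relu f ∈ relu '' (T ∪ (C ∪ (fun f x => -f x) '' C)) :=
        ⟨f, Or.inr (Or.inl hf), rfl⟩
      have h2 : relu (fun x => -f x) ∈ relu '' (T ∪ (C ∪ (fun f x => -f x) '' C)) :=
        ⟨_, Or.inr (Or.inr ⟨f, hf, rfl⟩), rfl⟩
      have h3 := sub_mem_affSpan (mem_affSpan h1) (mem_affSpan h2)
      simp only [relu_sub_relu_neg] at h3
      exact h3

lemma carry (h : Avail W D S) (hW : 2 * S.encard ≤ W) (n : ℕ) : Avail W (D + n) S := by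
  induction n with
  | zero => exact h
  | succ n ih =>
    have := ih.step (T := ∅) (C := S) (by simp) subset_affSpan (by simpa using hW)
    exact this.subset Set.subset_union_right

/-- Two networks of equal depth run in parallel. -/
lemma union (h : Avail W D S) (h' : Avail W' D T) : Avail (W + W') D (S ∪ T) := by
  induction D generalizing S T with
  | zero => exact Set.union_subset h h'
  | succ D ih =>
    obtain ⟨R, h1, h2, h3⟩ := h
    obtain ⟨R', h1', h2', h3'⟩ := h'
    refine ⟨R ∪ R', ih h1 h1', (Set.encard_union_le _ _).trans ?_, Set.union_subset ?_ ?_⟩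
    · push_cast; gcongr
    · exact h3.trans (affSpan_mono (Set.image_mono Set.subset_union_left))
    · exact h3'.trans (affSpan_mono (Set.image_mono Set.subset_union_right))

lemma empty : Avail W D (∅ : Set ((Fin d → ℝ) → ℝ)) := by
  induction D with
  | zero => exact Set.empty_subset _
  | succ D ih => exact ⟨∅, ih, by simp, by simp⟩

/-- Finitely many networks of equal depth run in parallel. -/
lemma biUnion {J : Type*} (s : Finset J) {S : J → Set ((Fin d → ℝ) → ℝ)}
    (h : ∀ j ∈ s, Avail W D (S j)) : Avail (s.card * W) D (⋃ j ∈ s, S j) := by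
  classical
  induction s using Finset.induction_on with
  | empty => simpa using empty
  | insert a s ha ih =>
    rw [Finset.card_insert_of_notMem ha, Finset.set_biUnion_insert, add_mul, one_mul, add_comm]
    exact (h a (by simp)).union (ih fun j hj => h j (by simp [hj]))

lemma comp {d' : ℕ} (h : Avail W D S) (τ : (Fin d' → ℝ) → Fin d → ℝ)
    (hτ : ∀ i, (fun x => τ x i) ∈ affSpan (coords d')) : Avail W D ((· ∘ τ) '' S) := by
  induction D generalizing S with
  | zero =>
    rintro _ ⟨f, hf, rfl⟩
    refine affSpan_le ?_ (comp_mem_affSpan τ (h hf))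
    rintro _ ⟨_, ⟨i, rfl⟩, rfl⟩
    exact hτ i
  | succ D ih =>
    obtain ⟨R, h1, h2, h3⟩ := h
    refine ⟨(· ∘ τ) '' R, ih h1, (Set.encard_image_le _ _).trans h2, ?_⟩
    rintro _ ⟨f, hf, rfl⟩
    refine affSpan_le ?_ (comp_mem_affSpan τ (h3 hf))
    rintro _ ⟨_, ⟨g, hg, rfl⟩, rfl⟩
    exact mem_affSpan ⟨g ∘ τ, ⟨g, hg, rfl⟩, rfl⟩

end Avail

namespace ReLUNet

/-- An affine map of the input can be absorbed into the first layer. -/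
lemma exists_precomp {k o : ℕ} (net : ReLUNet k o) {w : ℕ} (A : Matrix (Fin k) (Fin w) ℝ)
    (c : Fin k → ℝ) : ∃ net' : ReLUNet w o, net'.width = net.width ∧ net'.depth = net.depth ∧
      ∀ v, net'.eval v = net.eval (A.mulVec v + c) := by
  cases net with
  | output M b =>
    refine ⟨output (M * A) (M.mulVec c + b), rfl, rfl, fun v => ?_⟩
    simp only [eval, Matrix.mulVec_add, Matrix.mulVec_mulVec, add_assoc]
  | hidden M b rest =>
    refine ⟨hidden (M * A) (M.mulVec c + b) rest, rfl, rfl, fun v => ?_⟩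
    simp only [eval, Matrix.mulVec_add, Matrix.mulVec_mulVec, add_assoc]

end ReLUNet

/-- A network computing available functions, composed with an arbitrary network that takes them as
input. Induction over the layers needs this form, since `hidden` puts new layers in front. -/
lemma Avail.exists_net_comp {d W D k o : ℕ} {S : Set ((Fin d → ℝ) → ℝ)} (h : Avail W D S)
    (g : Fin k → (Fin d → ℝ) → ℝ) (hg : ∀ j, g j ∈ S) (rest : ReLUNet k o) :
    ∃ net : ReLUNet d o, net.width ≤ max W rest.width ∧ net.depth = D + rest.depth ∧
      ∀ x, net.eval x = rest.eval fun j => g j x := by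
  induction D generalizing S k with
  | zero =>
    have h' : ∀ j, ∃ (a : Fin d → ℝ) (c : ℝ), ∀ x, g j x = ∑ i, a i * x i + c :=
      fun j => exists_of_mem_affSpan_range (h (hg j))
    choose a c hac using h'
    obtain ⟨net, h1, h2, h3⟩ := rest.exists_precomp (Matrix.of a) c
    refine ⟨net, by simp [h1], by simp [h2], fun x => ?_⟩
    rw [h3]
    congr 1
    ext j
    simp [hac, Matrix.mulVec, dotProduct]
  | succ D ih =>
    obtain ⟨R, h1, h2, h3⟩ := h
    have hfin : R.Finite := Set.finite_of_encard_le_coe h2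
    obtain ⟨w, f, hw, rfl⟩ : ∃ (w : ℕ) (f : Fin w → (Fin d → ℝ) → ℝ), w ≤ W ∧
        R = Set.range f := by
      have e := hfin.toFinset.equivFin.symm
      refine ⟨_, fun i => (e i : (Fin d → ℝ) → ℝ), ?_, ?_⟩
      · rw [hfin.encard_eq_coe_toFinset_card] at h2
        exact_mod_cast h2
      · ext y
        constructor
        · intro hy
          exact ⟨e.symm ⟨y, by simpa using hy⟩, by simp⟩
        · rintro ⟨i, rfl⟩
          exact hfin.mem_toFinset.1 (e i).2
    have h' : ∀ j, ∃ (a : Fin w → ℝ) (c : ℝ), ∀ x, g j x = ∑ i, a i * relu (f i) x + c :=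
      fun j => exists_of_mem_affSpan_range (by
        rw [Set.range_comp' relu f]; exact h3 (hg j))
    choose a c hac using h'
    obtain ⟨net, n1, n2, n3⟩ := rest.exists_precomp (Matrix.of a) c
    obtain ⟨net', m1, m2, m3⟩ := ih h1 f (fun j => ⟨j, rfl⟩) (ReLUNet.hidden 1 0 net)
    refine ⟨net', m1.trans ?_, ?_, fun x => ?_⟩
    · simp only [ReLUNet.width, n1]
      omega
    · rw [m2]; simp only [ReLUNet.depth, n2]; omega
    · rw [m3]
      simp only [ReLUNet.eval, Matrix.one_mulVec, add_zero]
      rw [n3]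
      congr 1
      ext j
      simp [hac, Matrix.mulVec, dotProduct, relu]

/-- Available functions are the outputs of a network. -/
lemma Avail.exists_net {d W D o : ℕ} {S : Set ((Fin d → ℝ) → ℝ)} (h : Avail W D S)
    (g : Fin o → (Fin d → ℝ) → ℝ) (hg : ∀ j, g j ∈ S) :
    ∃ net : ReLUNet d o, net.width ≤ W ∧ net.depth = D ∧ ∀ x j, net.eval x j = g j x := by
  obtain ⟨net, h1, h2, h3⟩ := h.exists_net_comp g hg (ReLUNet.output (1 : Matrix (Fin o) (Fin o) ℝ) 0)
  refine ⟨net, by simpa [ReLUNet.width] using h1, by simpa [ReLUNet.depth] using h2, ?_⟩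
  intro x j
  rw [h3]; simp [ReLUNet.eval]

/-! ### Digit extraction -/

/-- A continuous version, with slope `c`, of the indicator of `0 ≤ u`. -/
def ramp (c u : ℝ) : ℝ := max (c * u + 1) 0 - max (c * u) 0

lemma ramp_eq_one {c u : ℝ} (h : 0 ≤ c * u) : ramp c u = 1 := by
  rw [ramp, max_eq_left (by linarith), max_eq_left h]; ring

lemma ramp_eq_zero {c u : ℝ} (h : c * u ≤ -1) : ramp c u = 0 := by
  rw [ramp, max_eq_right (by linarith), max_eq_right (by linarith)]; ring

/-- The leading digit in base `B` of `y ∈ [0,1]`, computed by ramps of slope `c`. -/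
def digit (c : ℝ) (B : ℕ) (y : ℝ) : ℝ := ∑ k ∈ Finset.range (B - 1), ramp c (B * y - (k + 1))

/-- The base `B` expansion of `y` without its leading digit. -/
def fracStep (c : ℝ) (y : ℝ) (B : ℕ) : ℝ := B * y - digit c B y

/-- What remains of `y` when its leading digits in the mixed radix `Bs` are removed. -/
def fracs (c : ℝ) (Bs : List ℕ) (y : ℝ) : ℝ := Bs.foldl (fracStep c) y

lemma ramp_digit_eq {c y : ℝ} {B j : ℕ} (hc : 0 ≤ c) (hy : (j : ℝ) ≤ B * y)
    (h : j + 1 = B ∨ c * (B * y - (j + 1)) ≤ -1) {k : ℕ} (hk : k < B - 1) :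
    ramp c (B * y - (k + 1)) = if k < j then 1 else 0 := by
  split_ifs with hkj
  · apply ramp_eq_one
    have : ((k : ℝ) + 1) ≤ j := by exact_mod_cast hkj
    exact mul_nonneg hc (by linarith)
  · rcases h with h | h
    · omega
    · apply ramp_eq_zero
      have : (j : ℝ) ≤ k := by exact_mod_cast not_lt.1 hkj
      refine le_trans (mul_le_mul_of_nonneg_left ?_ hc) h
      linarith

lemma digit_eq {c y : ℝ} {B j : ℕ} (hc : 0 ≤ c) (hj : j < B) (hy : (j : ℝ) ≤ B * y)
    (h : j + 1 = B ∨ c * (B * y - (j + 1)) ≤ -1) : digit c B y = j := by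
  rw [digit, Finset.sum_congr rfl fun k hk => ramp_digit_eq hc hy h (Finset.mem_range.1 hk)]
  rw [Finset.sum_ite, Finset.sum_const_zero, add_zero, Finset.sum_const, nsmul_eq_mul, mul_one]
  congr 1
  rw [show (Finset.range (B - 1)).filter (· < j) = Finset.range j from ?_, Finset.card_range]
  ext k; simp; omega

/-- `y` has the expansion `(j + t) / M` with digits `j` and remainder `t`, and `t` is at distance
at least `η` from `1` unless all digits are maximal. -/
def GoodAt (η : ℝ) (M : ℕ) (y : ℝ) (j : ℕ) (t : ℝ) : Prop :=
  j < M ∧ y = (j + t) / M ∧ 0 ≤ t ∧ t ≤ 1 ∧ (t ≤ 1 - η ∨ j + 1 = M)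

/-- The expansion in base `M * M'` read as a base `M` digit followed by a base `M'` digit. The
leading digit keeps the fraction `η / M'` of the margin. -/
lemma GoodAt.split {η y t : ℝ} {M M' j : ℕ} (h : GoodAt η (M * M') y j t) :
    GoodAt (η / M') M y (j / M') (((j % M' : ℕ) + t) / M') ∧
      GoodAt η M' (((j % M' : ℕ) + t) / M') (j % M') t := by
  obtain ⟨hj, hy, h0, h1, h2⟩ := h
  have hM' : 0 < M' := Nat.pos_of_ne_zero (by rintro rfl; simp at hj)
  have hM : 0 < M := Nat.pos_of_ne_zero (by rintro rfl; simp at hj)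
  have hM'R : (0 : ℝ) < M' := by exact_mod_cast hM'
  have hMR : (0 : ℝ) < M := by exact_mod_cast hM
  have hmod := Nat.mod_lt j hM'
  have hmodR : ((j % M' : ℕ) : ℝ) + 1 ≤ M' := by exact_mod_cast hmod
  have hdm : (j : ℝ) = M' * (j / M' : ℕ) + (j % M' : ℕ) := by
    exact_mod_cast (Nat.div_add_mod j M').symm
  have hlast : j + 1 = M * M' → j / M' + 1 = M ∧ j % M' + 1 = M' := by
    intro h
    have e : j = (M' - 1) + M' * (M - 1) := by
      obtain ⟨a, rfl⟩ := Nat.exists_eq_succ_of_ne_zero hM.ne'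
      obtain ⟨b, rfl⟩ := Nat.exists_eq_succ_of_ne_zero hM'.ne'
      simp only [Nat.succ_eq_add_one, Nat.add_sub_cancel] at *
      nlinarith
    constructor
    · rw [e, Nat.add_mul_div_left _ _ hM', Nat.div_eq_of_lt (by omega)]; omega
    · rw [e, Nat.add_mul_mod_self_left, Nat.mod_eq_of_lt (by omega)]; omega
  refine ⟨⟨(Nat.div_lt_iff_lt_mul hM').2 hj, ?_, by positivity, ?_, ?_⟩,
    ⟨hmod, rfl, h0, h1, ?_⟩⟩
  · rw [hy, hdm]; push_cast; field_simp; ring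
  · rw [div_le_one hM'R]; linarith
  · rcases h2 with h2 | h2
    · left
      rw [div_le_iff₀ hM'R, sub_mul, div_mul_cancel₀ _ hM'R.ne']; linarith
    · exact Or.inr (hlast h2).1
  · rcases h2 with h2 | h2
    · exact Or.inl h2
    · exact Or.inr (hlast h2).2

lemma GoodAt.digit_eq {c η y t : ℝ} {B j : ℕ} (h : GoodAt η B y j t) (hc : 0 ≤ c)
    (hcη : 1 ≤ c * η) : digit c B y = j ∧ fracStep c y B = t ∧
      ∀ k < B - 1, ramp c (B * y - (k + 1)) = if k < j then 1 else 0 := by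
  obtain ⟨hj, hy, h0, h1, h2⟩ := h
  have hB : (0 : ℝ) < B := by exact_mod_cast (Nat.zero_le j).trans_lt hj
  have hBy : B * y = j + t := by rw [hy]; field_simp
  have h3 : j + 1 = B ∨ c * (B * y - (j + 1)) ≤ -1 := by
    rcases h2 with h2 | h2
    · right; rw [hBy]; nlinarith
    · exact Or.inl h2
  have h4 : (j : ℝ) ≤ B * y := by linarith
  have h5 := CondDiffusion.digit_eq hc hj h4 h3
  exact ⟨h5, by rw [fracStep, h5, hBy]; ring, fun k hk => ramp_digit_eq hc h4 h3 hk⟩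

/-- Ramps of finite slope extract all digits exactly where the margin `η` is large enough for the
slope. -/
lemma GoodAt.fracs_eq {c η : ℝ} {Bs : List ℕ} (hc : 0 ≤ c)
    (hcη : Bs.prod ≤ c * η) {y t : ℝ} {j : ℕ} (h : GoodAt η Bs.prod y j t) :
    fracs c Bs y = t := by
  induction Bs generalizing y j with
  | nil =>
    obtain ⟨hj, hy, -⟩ := h
    have : j = 0 := by simpa using hj
    subst this
    simpa [fracs] using hy
  | cons B Bs ih =>
    rw [List.prod_cons] at h hcη
    obtain ⟨h1, h2⟩ := h.split
    have hpos : 0 < B * Bs.prod := (Nat.zero_le j).trans_lt h.1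
    have hB : 0 < B := Nat.pos_of_mul_pos_right hpos
    have hP : 0 < Bs.prod := Nat.pos_of_mul_pos_left hpos
    have hPR : (0 : ℝ) < Bs.prod := by exact_mod_cast hP
    have hle : ((Bs.prod : ℕ) : ℝ) ≤ c * η := by
      refine le_trans ?_ hcη
      exact_mod_cast Nat.le_mul_of_pos_left _ hB
    have h3 := (h1.digit_eq hc (by rw [← mul_div_assoc, le_div_iff₀ hPR, one_mul]; exact hle)).2.1
    show fracs c Bs (fracStep c y B) = t
    rw [h3]
    exact ih hle h2

section AvailDigits

variable {d W D : ℕ} {C : Set ((Fin d → ℝ) → ℝ)}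

/-- The two neurons of a ramp. -/
def rampUnits {X : Type*} (c : ℝ) (u : X → ℝ) : Set (X → ℝ) :=
  {fun x => c * u x + 1, fun x => c * u x}

lemma encard_rampUnits_le {X : Type*} (c : ℝ) (u : X → ℝ) : (rampUnits c u).encard ≤ 2 :=
  (Set.encard_insert_le _ _).trans (by rw [Set.encard_singleton, one_add_one_eq_two])

lemma rampUnits_subset {X : Type*} {S : Set (X → ℝ)} (c : ℝ) {u : X → ℝ} (hu : u ∈ affSpan S) :
    rampUnits c u ⊆ affSpan S := by
  rintro _ (rfl | rfl)
  · exact add_mem_affSpan (mul_mem_affSpan c hu) (const_mem_affSpan 1)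
  · exact mul_mem_affSpan c hu

lemma ramp_mem_affSpan {X : Type*} {S T : Set (X → ℝ)} {c : ℝ} {u : X → ℝ}
    (hT : rampUnits c u ⊆ T) (hS : relu '' T ⊆ S) : (fun x => ramp c (u x)) ∈ affSpan S :=
  sub_mem_affSpan (f := relu fun x => c * u x + 1) (g := relu fun x => c * u x)
    (mem_affSpan (hS ⟨_, hT (Or.inl rfl), rfl⟩)) (mem_affSpan (hS ⟨_, hT (Or.inr rfl), rfl⟩))

lemma encard_biUnion_le {α ι : Type*} (s : Finset ι) (f : ι → Set α) (n : ℕ)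
    (h : ∀ i ∈ s, (f i).encard ≤ n) : (⋃ i ∈ s, f i).encard ≤ (s.card * n : ℕ) := by
  classical
  induction s using Finset.induction_on with
  | empty => simp
  | insert a s ha ih =>
    rw [Finset.card_insert_of_notMem ha, Finset.set_biUnion_insert]
    refine (Set.encard_union_le _ _).trans ?_
    rw [add_mul, one_mul, add_comm, Nat.cast_add]
    exact add_le_add (ih fun i hi => h i (by simp [hi])) (h a (by simp))

/-- All ramps of `u i`, `i ∈ s`, in one layer. -/
lemma Avail.ramps {ι : Type*} (s : Finset ι) {S : Set ((Fin d → ℝ) → ℝ)} (h : Avail W D S) (c : ℝ)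
    (u : ι → (Fin d → ℝ) → ℝ) (hu : ∀ i ∈ s, u i ∈ affSpan S) (hC : C ⊆ affSpan S)
    (hW : ((s.card * 2 : ℕ) : ℕ∞) + 2 * C.encard ≤ W) :
    Avail W (D + 1) ((fun i x => ramp c (u i x)) '' s ∪ C) := by
  have := h.step (T := ⋃ i ∈ s, rampUnits c (u i)) (C := C)
    (Set.iUnion₂_subset fun i hi => rampUnits_subset c (hu i hi)) hC
    (le_trans (by gcongr; exact encard_biUnion_le s _ 2 fun i _ => encard_rampUnits_le _ _) hW)
  refine this.of_affSpan (Set.union_subset ?_ ?_)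
  · rintro _ ⟨i, hi, rfl⟩
    exact ramp_mem_affSpan (Set.subset_biUnion_of_mem (u := fun i => rampUnits c (u i)) hi)
      Set.subset_union_left
  · exact Set.subset_union_right.trans subset_affSpan

lemma encard_range_le {α ι : Type*} [Fintype ι] (f : ι → α) :
    (Set.range f).encard ≤ Fintype.card ι := by
  rw [← Set.image_univ]
  refine (Set.encard_image_le _ _).trans ?_
  simp

/-- One layer removes the leading base `B` digit from all the functions `y i`. -/
lemma Avail.fracStep_layer {ι : Type*} [Fintype ι] {y : ι → (Fin d → ℝ) → ℝ} {B : ℕ} (hB : 1 ≤ B)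
    (c : ℝ) (h : Avail W D (Set.range y ∪ C))
    (hW : ((Fintype.card ι * (2 * B) : ℕ) : ℕ∞) + 2 * C.encard ≤ W) :
    Avail W (D + 1) (Set.range (fun i x => fracStep c (y i x) B) ∪ C) := by
  have hcard : (Finset.univ ×ˢ Finset.range (B - 1) : Finset (ι × ℕ)).card =
      Fintype.card ι * (B - 1) := by simp
  have := h.ramps (Finset.univ ×ˢ Finset.range (B - 1)) c
    (fun (p : ι × ℕ) x => B * y p.1 x - (p.2 + 1))
    (fun p _ => sub_mem_affSpan (mul_mem_affSpan _ (mem_affSpan (Or.inl ⟨_, rfl⟩)))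
      (const_mem_affSpan _)) (C := Set.range y ∪ C) subset_affSpan ?_
  · refine this.of_affSpan (Set.union_subset ?_ ?_)
    · rintro _ ⟨i, rfl⟩
      refine sub_mem_affSpan (mul_mem_affSpan _ (mem_affSpan (Or.inr (Or.inl ⟨i, rfl⟩)))) ?_
      refine sum_mem_affSpan _ fun k hk => mem_affSpan (Or.inl ⟨(i, k), ?_, rfl⟩)
      simpa using hk
    · exact (Set.subset_union_right.trans Set.subset_union_right).trans subset_affSpan
  · refine le_trans ?_ hW
    rw [hcard]
    have h2 : (Set.range y ∪ C).encard ≤ Fintype.card ι + C.encard :=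
      (Set.encard_union_le _ _).trans (add_le_add (encard_range_le y) le_rfl)
    have h3 : 2 * (Set.range y ∪ C).encard ≤ ((2 * Fintype.card ι : ℕ) : ℕ∞) + 2 * C.encard := by
      refine (mul_le_mul_right h2 2).trans_eq ?_
      push_cast; ring
    refine (add_le_add le_rfl h3).trans_eq ?_
    rw [← add_assoc, ← Nat.cast_add]
    congr 2
    obtain ⟨b, rfl⟩ := Nat.exists_eq_add_of_le' hB
    simp; ring

lemma Avail.fracs_layers {ι : Type*} [Fintype ι] {y : ι → (Fin d → ℝ) → ℝ} {Bs : List ℕ} {b : ℕ}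
    (hB : ∀ B ∈ Bs, 1 ≤ B ∧ B ≤ b) (c : ℝ) (h : Avail W D (Set.range y ∪ C))
    (hW : ((Fintype.card ι * (2 * b) : ℕ) : ℕ∞) + 2 * C.encard ≤ W) :
    Avail W (D + Bs.length) (Set.range (fun i x => fracs c Bs (y i x)) ∪ C) := by
  induction Bs generalizing y D with
  | nil => exact h
  | cons B Bs ih =>
    have h1 := h.fracStep_layer (hB B (by simp)).1 c (le_trans (by
      gcongr; exact (hB B (by simp)).2) hW)
    have h2 := ih (fun B' hB' => hB B' (by simp [hB'])) h1
    rw [List.length_cons, add_comm Bs.length, ← add_assoc]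
    exact h2

end AvailDigits

/-! ### Memorization and multiplication -/

section Memorization

variable {d W D c : ℕ} {C : Set ((Fin d → ℝ) → ℝ)}

/-- The indicator of `u = k` for integers `u`. -/
def unitBump (u k : ℝ) : ℝ := ramp 1 (u - k) - ramp 1 (u - (k + 1))

lemma ramp_natCast (m k : ℕ) : ramp 1 ((m : ℝ) - k) = if k ≤ m then 1 else 0 := by
  split_ifs with h
  · apply ramp_eq_one
    have : (k : ℝ) ≤ m := by exact_mod_cast h
    linarith
  · apply ramp_eq_zero
    have : (m : ℝ) + 1 ≤ k := by exact_mod_cast not_le.1 h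
    linarith

lemma unitBump_natCast (m k : ℕ) : unitBump m k = if k = m then 1 else 0 := by
  have h := ramp_natCast m (k + 1)
  push_cast at h
  rw [unitBump, ramp_natCast, h]
  split_ifs <;> first | omega | norm_num

/-- A gate: for `i ∈ {0, 1}` and `0 ≤ w ≤ 1` the neuron `max (w + i - 1) 0` equals `i * w`. -/
lemma gate {w i : ℝ} (hw : 0 ≤ w) (hw1 : w ≤ 1) (hi : i = 0 ∨ i = 1) :
    max (w + (i - 1)) 0 = i * w := by
  rcases hi with rfl | rfl
  · rw [max_eq_right (by linarith)]; ring
  · rw [max_eq_left (by linarith)]; ring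

lemma encard_insert_le' {α : Type*} {s : Set α} {n : ℕ} (a : α) (h : s.encard ≤ n) :
    (insert a s).encard ≤ (n + 1 : ℕ) := by
  refine (Set.encard_insert_le _ _).trans ?_
  push_cast; gcongr

lemma width_le {α β : Type*} {s : Set α} {t : Set β} {m n W : ℕ} (hs : s.encard ≤ m)
    (ht : t.encard ≤ n) (h : m + 2 * n ≤ W) : s.encard + 2 * t.encard ≤ W := by
  calc s.encard + 2 * t.encard ≤ (m : ℕ∞) + 2 * (n : ℕ∞) := by gcongr
    _ = ((m + 2 * n : ℕ) : ℕ∞) := by push_cast; rfl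
    _ ≤ W := by exact_mod_cast h

lemma width_le' {β : Type*} {t : Set β} {m n W : ℕ}
    (ht : t.encard ≤ n) (h : m + 2 * n ≤ W) : (m : ℕ∞) + 2 * t.encard ≤ W := by
  calc (m : ℕ∞) + 2 * t.encard ≤ (m : ℕ∞) + 2 * (n : ℕ∞) := by gcongr
    _ = ((m + 2 * n : ℕ) : ℕ∞) := by push_cast; rfl
    _ ≤ W := by exact_mod_cast h

/-- One row of an `N × N × L` table: if `λ` lies in the `l`-th interval of length `L`, the entry
`T a b` is added to `acc`; the remainder `r` is decreased by `L` once `λ` is beyond it. -/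
lemma Avail.table_step {N L l : ℕ} (hC : C.encard ≤ c) (hW : 4 * N + 20 + 2 * c ≤ W)
    {T : ℕ → ℕ → ℝ} (hT : ∀ i j, 0 ≤ T i j ∧ T i j ≤ 1) {a b lam r acc : (Fin d → ℝ) → ℝ}
    (h : Avail W D (insert a (insert b (insert lam (insert r (insert acc C)))))) :
    ∃ r' acc', Avail W (D + 2) (insert a (insert b (insert lam (insert r' (insert acc' C))))) ∧
      ∀ x, ∀ i j m : ℕ, i < N → j < N → a x = i → b x = j → lam x = m →
        (r' x = r x - if (l + 1) * L ≤ m then (L : ℝ) else 0) ∧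
        (acc' x = acc x + if l * L ≤ m ∧ m < (l + 1) * L then T i j else 0) := by
  set S := insert a (insert b (insert lam (insert r (insert acc C))))
  have hS : S.encard ≤ (c + 1 + 1 + 1 + 1 + 1 : ℕ) :=
    encard_insert_le' _ (encard_insert_le' _ (encard_insert_le' _ (encard_insert_le' _
      (encard_insert_le' _ hC))))
  have ha : a ∈ S := Or.inl rfl
  have hb : b ∈ S := Or.inr (Or.inl rfl)
  have hlam : lam ∈ S := Or.inr (Or.inr (Or.inl rfl))
  have hr : r ∈ S := Or.inr (Or.inr (Or.inr (Or.inl rfl)))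
  have hacc : acc ∈ S := Or.inr (Or.inr (Or.inr (Or.inr (Or.inl rfl))))
  have hCS : C ⊆ S := fun f hf => Or.inr (Or.inr (Or.inr (Or.inr (Or.inr hf))))
  -- the arguments of the ramps needed to compare `a`, `b` and `lam` with their thresholds
  let u : ℕ ⊕ ℕ ⊕ Bool → (Fin d → ℝ) → ℝ := Sum.elim (fun k x => a x - k)
    (Sum.elim (fun k x => b x - k) (fun e x => lam x - ((l + (if e then 1 else 0) : ℕ) * L : ℕ)))
  have h1 := h.ramps (Finset.disjSum (Finset.range (N + 1)) (Finset.disjSum (Finset.range (N + 1))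
    Finset.univ)) 1 u (C := S) (by
      rintro (k | k | e) _
      · exact sub_mem_affSpan (mem_affSpan ha) (const_mem_affSpan _)
      · exact sub_mem_affSpan (mem_affSpan hb) (const_mem_affSpan _)
      · exact sub_mem_affSpan (mem_affSpan hlam) (const_mem_affSpan _)) subset_affSpan
    (width_le' hS (by simp; omega))
  set S1 := (fun i x => ramp 1 (u i x)) '' ↑(Finset.disjSum (Finset.range (N + 1))
    (Finset.disjSum (Finset.range (N + 1)) (Finset.univ : Finset Bool))) ∪ S
  have hS1 : S ⊆ S1 := Set.subset_union_right
  have hu1 : ∀ k < N + 1, (fun x => ramp 1 (a x - (k : ℕ))) ∈ affSpan S1 := fun k hk =>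
    mem_affSpan (Or.inl ⟨Sum.inl k, by simpa using hk, rfl⟩)
  have hu2 : ∀ k < N + 1, (fun x => ramp 1 (b x - (k : ℕ))) ∈ affSpan S1 := fun k hk =>
    mem_affSpan (Or.inl ⟨Sum.inr (Sum.inl k), by simpa using hk, rfl⟩)
  have hu3 : ∀ e : Bool, (fun x => ramp 1 (lam x - ((l + (if e then 1 else 0) : ℕ) * L : ℕ))) ∈
      affSpan S1 := fun e => mem_affSpan (Or.inl ⟨Sum.inr (Sum.inr e), by simp, rfl⟩)
  have hu3f := hu3 false
  have hu3t := hu3 true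
  simp only [Bool.false_eq_true, if_false, if_true, add_zero] at hu3f hu3t
  -- The neuron `g k` is the gate `T a k + (indicator of b = k) + (indicator of row l) - 2`: it is
  -- positive only if both indicators are one, as the entries of `T` lie in `[0, 1]`.
  let r' : (Fin d → ℝ) → ℝ := fun x => r x - L * ramp 1 (lam x - ((l + 1) * L : ℕ))
  let g : ℕ → (Fin d → ℝ) → ℝ := fun k x => (∑ i ∈ Finset.range N, T i k * unitBump (a x) i) +
    ((unitBump (b x) k + (ramp 1 (lam x - (l * L : ℕ)) - ramp 1 (lam x - ((l + 1) * L : ℕ)))) - 2)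
  have hg : ∀ k < N, g k ∈ affSpan S1 := by
    intro k hk
    refine add_mem_affSpan (sum_mem_affSpan _ fun i hi => mul_mem_affSpan _ ?_)
      (sub_mem_affSpan (add_mem_affSpan ?_ (sub_mem_affSpan hu3f hu3t)) (const_mem_affSpan _))
    · have hi := Finset.mem_range.1 hi
      have := sub_mem_affSpan (hu1 i (by omega)) (hu1 (i + 1) (by omega))
      push_cast at this
      exact this
    · have := sub_mem_affSpan (hu2 k (by omega)) (hu2 (k + 1) (by omega))
      push_cast at this
      exact this
  have hr' : r' ∈ affSpan S1 := sub_mem_affSpan (mem_affSpan (hS1 hr)) (mul_mem_affSpan _ hu3t)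
  let S2 := insert a (insert b (insert lam (insert r' (insert acc C))))
  have hS2 : S2.encard ≤ (c + 1 + 1 + 1 + 1 + 1 : ℕ) :=
    encard_insert_le' _ (encard_insert_le' _ (encard_insert_le' _ (encard_insert_le' _
      (encard_insert_le' _ hC))))
  have h2 := h1.step (T := g '' (Finset.range N)) (C := S2)
    (by rintro _ ⟨k, hk, rfl⟩; exact hg k (by simpa using hk))
    (by
      rintro f (rfl | rfl | rfl | rfl | rfl | hf)
      exacts [mem_affSpan (hS1 ha), mem_affSpan (hS1 hb), mem_affSpan (hS1 hlam), hr',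
        mem_affSpan (hS1 hacc), mem_affSpan (hS1 (hCS hf))])
    (width_le (m := N) ((Set.encard_image_le _ _).trans
      (by rw [Set.encard_coe_eq_coe_finsetCard, Finset.card_range])) hS2 (by omega))
  refine ⟨r', fun x => acc x + ∑ k ∈ Finset.range N, relu (g k) x, h2.of_affSpan ?_, ?_⟩
  · rintro f (rfl | rfl | rfl | rfl | rfl | hf)
    · exact mem_affSpan (Or.inr (Or.inl rfl))
    · exact mem_affSpan (Or.inr (Or.inr (Or.inl rfl)))
    · exact mem_affSpan (Or.inr (Or.inr (Or.inr (Or.inl rfl))))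
    · exact mem_affSpan (Or.inr (Or.inr (Or.inr (Or.inr (Or.inl rfl)))))
    · exact add_mem_affSpan (mem_affSpan (Or.inr (Or.inr (Or.inr (Or.inr (Or.inr (Or.inl rfl)))))))
        (sum_mem_affSpan _ fun k hk => mem_affSpan (Or.inl ⟨g k, ⟨k, by simpa using hk, rfl⟩, rfl⟩))
    · exact mem_affSpan (Or.inr (Or.inr (Or.inr (Or.inr (Or.inr (Or.inr hf))))))
  · intro x i j m hi hj hax hbx hlx
    constructor
    · simp only [r']
      rw [hlx, ramp_natCast]
      split_ifs <;> ring
    · have hgk : ∀ k, g k x = T i k + ((if k = j then 1 else 0) +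
          (if l * L ≤ m ∧ m < (l + 1) * L then 1 else 0) - 2) := by
        intro k
        simp only [g]
        rw [hax, hbx, hlx, unitBump_natCast, ramp_natCast, ramp_natCast]
        simp only [unitBump_natCast, mul_ite, mul_one, mul_zero, Finset.sum_ite_eq',
          Finset.mem_range, hi, if_true]
        congr 3
        have : l * L ≤ (l + 1) * L := Nat.mul_le_mul_right _ (by omega)
        split_ifs <;> first | omega | norm_num
      simp only [relu]
      congr 1
      by_cases hm : l * L ≤ m ∧ m < (l + 1) * L
      · simp only [hgk, hm, and_self, if_true]
        rw [Finset.sum_eq_single_of_mem j (Finset.mem_range.2 hj)]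
        · rw [if_pos rfl, max_eq_left (by linarith [(hT i j).1])]; ring
        · intro k _ hk
          rw [if_neg hk, max_eq_right (by linarith [(hT i k).2])]
      · simp only [hgk, hm, if_false]
        refine Finset.sum_eq_zero fun k _ => max_eq_right ?_
        split_ifs <;> linarith [(hT i k).2]

/-- Lookup in an `N × N × L` table of numbers in `[0,1]`, at the cost of width `O(N)` and depth
`O(L)`. The first index `m / L` of the table is computed along with the remainder `m % L`. -/
lemma Avail.table {N L : ℕ} (hL : 0 < L) (hC : C.encard ≤ c) (hW : 4 * N + 20 + 2 * c ≤ W)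
    {T : ℕ → ℕ → ℕ → ℝ} (hT : ∀ l i j, 0 ≤ T l i j ∧ T l i j ≤ 1) {a b lam : (Fin d → ℝ) → ℝ}
    (h : Avail W D (insert a (insert b (insert lam C)))) :
    ∃ v r, Avail W (D + 2 * L) (insert v (insert r C)) ∧
      ∀ x, ∀ i j m : ℕ, i < N → j < N → m < L * L → a x = i → b x = j → lam x = m →
        v x = T (m / L) i j ∧ r x = (m % L : ℕ) := by
  -- after `l` rows the remainder is `m - L * min l (m / L)`, and the entry has been read if its row
  -- is among them
  have key : ∀ l : ℕ, ∃ r acc,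
      Avail W (D + 2 * l) (insert a (insert b (insert lam (insert r (insert acc C))))) ∧
      ∀ x, ∀ i j m : ℕ, i < N → j < N → a x = i → b x = j → lam x = m →
        (r x = m - (L : ℝ) * (min l (m / L) : ℕ)) ∧
        (acc x = if m / L < l then T (m / L) i j else 0) := by
    intro l
    induction l with
    | zero =>
      refine ⟨lam, fun _ => 0, h.of_affSpan ?_, ?_⟩
      · rintro f (rfl | rfl | rfl | rfl | rfl | hf)
        · exact mem_affSpan (Or.inl rfl)
        · exact mem_affSpan (Or.inr (Or.inl rfl))
        · exact mem_affSpan (Or.inr (Or.inr (Or.inl rfl)))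
        · exact mem_affSpan (Or.inr (Or.inr (Or.inl rfl)))
        · exact const_mem_affSpan 0
        · exact mem_affSpan (Or.inr (Or.inr (Or.inr hf)))
      · intro x i j m _ _ _ _ hl
        simp [hl]
    | succ l ih =>
      obtain ⟨r, acc, h1, h2⟩ := ih
      obtain ⟨r', acc', h3, h4⟩ := h1.table_step (l := l) (L := L) hC hW (hT l)
      refine ⟨r', acc', h3, ?_⟩
      intro x i j m hi hj ha hb hl
      obtain ⟨e1, e2⟩ := h2 x i j m hi hj ha hb hl
      obtain ⟨f1, f2⟩ := h4 x i j m hi hj ha hb hl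
      have q1 : (l + 1) * L ≤ m ↔ l + 1 ≤ m / L := (Nat.le_div_iff_mul_le hL).symm
      have q0 : l * L ≤ m ↔ l ≤ m / L := (Nat.le_div_iff_mul_le hL).symm
      have q2 : m < (l + 1) * L ↔ m / L < l + 1 := (Nat.div_lt_iff_lt_mul hL).symm
      rw [f1, f2, e1, e2]
      simp only [q0, q1, q2]
      constructor
      · by_cases hq : l + 1 ≤ m / L
        · rw [if_pos hq, min_eq_left (by omega), min_eq_left (by omega)]; push_cast; ring
        · rw [if_neg hq, min_eq_right (by omega), min_eq_right (by omega)]; ring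
      · rcases lt_trichotomy (m / L) l with hq | hq | hq
        · rw [if_pos hq, if_neg (by omega), if_pos (by omega), add_zero]
        · rw [if_neg (by omega), if_pos (by omega), if_pos (by omega), zero_add, hq]
        · rw [if_neg (by omega), if_neg (by omega), if_neg (by omega), add_zero]
  obtain ⟨r, v, h1, h2⟩ := key L
  refine ⟨v, r, h1.subset ?_, ?_⟩
  · rintro f (rfl | rfl | hf)
    · exact Or.inr (Or.inr (Or.inr (Or.inr (Or.inl rfl))))
    · exact Or.inr (Or.inr (Or.inr (Or.inl rfl)))
    · exact Or.inr (Or.inr (Or.inr (Or.inr (Or.inr hf))))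
  · intro x i j m hi hj hm ha hb hl
    obtain ⟨e1, e2⟩ := h2 x i j m hi hj ha hb hl
    have hlt : m / L < L := (Nat.div_lt_iff_lt_mul hL).2 hm
    refine ⟨by rw [e2, if_pos hlt], ?_⟩
    rw [e1, min_eq_right hlt.le]
    have : (m : ℝ) = L * (m / L : ℕ) + (m % L : ℕ) := by exact_mod_cast (Nat.div_add_mod m L).symm
    linarith

end Memorization

section Blocks

variable {d W D c : ℕ} {C : Set ((Fin d → ℝ) → ℝ)}

/-- A natural number with prescribed base `Q` digits. -/
lemma exists_code {Q : ℕ} (L : ℕ) (u : ℕ → ℕ) (hu : ∀ j, u j < Q) :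
    ∃ m < Q ^ L, ∀ j < L, m / Q ^ j % Q = u j := by
  have hQ : 0 < Q := (Nat.zero_le _).trans_lt (hu 0)
  induction L generalizing u with
  | zero => exact ⟨0, by simp, by simp⟩
  | succ L ih =>
    obtain ⟨m, hm, h⟩ := ih (fun j => u (j + 1)) fun j => hu _
    refine ⟨u 0 + Q * m, ?_, fun j hj => ?_⟩
    · rw [pow_succ]; nlinarith [hu 0]
    · cases j with
      | zero => simp [Nat.add_mul_mod_self_left, Nat.mod_eq_of_lt (hu 0)]
      | succ j =>
        rw [pow_succ', ← Nat.div_div_eq_div_mul, Nat.add_mul_div_left _ _ hQ,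
          Nat.div_eq_of_lt (hu 0), zero_add]
        exact h j (by omega)

/-- One block of a number `m / Q ^ L`: the leading base `Q` digit is removed from `y`, and it is
added (divided by `Q`) to `acc` if `r = l`. -/
lemma Avail.block_step {Bs : List ℕ} {β l : ℕ} {s : ℝ} (hB : ∀ B ∈ Bs, 1 ≤ B ∧ B ≤ β)
    (hs : 0 ≤ s) (hC : C.encard ≤ c) (hW : 2 * β + 12 + 2 * c ≤ W)
    {y r acc : (Fin d → ℝ) → ℝ} (h : Avail W D (insert y (insert r (insert acc C)))) :
    ∃ y' acc', Avail W (D + (Bs.length + 2)) (insert y' (insert r (insert acc' C))) ∧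
      ∀ x, ∀ j i : ℕ, ∀ η t : ℝ, Bs.prod ≤ s * η → GoodAt η Bs.prod (y x) j t → r x = i →
        y' x = t ∧ acc' x = acc x + if l = i then (j : ℝ) / Bs.prod else 0 := by
  have hC3 : (insert y (insert r (insert acc C))).encard ≤ (c + 1 + 1 + 1 : ℕ) :=
    encard_insert_le' _ (encard_insert_le' _ (encard_insert_le' _ hC))
  have h1 := Avail.fracs_layers (ι := Unit) (y := fun _ => y) (C := insert y (insert r (insert acc C)))
    hB s (h.subset (by rintro f (⟨_, rfl⟩ | hf); exacts [Or.inl rfl, hf]))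
    (width_le' hC3 (by simp; omega))
  set y' : (Fin d → ℝ) → ℝ := fun x => fracs s Bs (y x)
  set S1 := insert y' (insert y (insert r (insert acc C)))
  have h1 : Avail W (D + Bs.length) S1 := h1.subset (by
    rintro f (rfl | hf); exacts [Or.inl ⟨(), rfl⟩, Or.inr hf])
  let u : Bool → (Fin d → ℝ) → ℝ := fun e x => r x - ((l + (if e then 1 else 0) : ℕ) : ℝ)
  have h2 := h1.ramps (Finset.univ : Finset Bool) 1 u (C := S1)
    (fun e _ => sub_mem_affSpan (mem_affSpan (Or.inr (Or.inr (Or.inl rfl)))) (const_mem_affSpan _))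
    subset_affSpan (width_le' (encard_insert_le' _ hC3) (by simp; omega))
  set S2 := (fun i x => ramp 1 (u i x)) '' ↑(Finset.univ : Finset Bool) ∪ S1
  have hS2 : S1 ⊆ S2 := Set.subset_union_right
  have hu : ∀ e : Bool, (fun x => ramp 1 (r x - ((l + (if e then 1 else 0) : ℕ) : ℝ))) ∈
      affSpan S2 := fun e => mem_affSpan (Or.inl ⟨e, by simp, rfl⟩)
  have hu0 := hu false
  have hu1 := hu true
  simp only [Bool.false_eq_true, if_false, if_true, add_zero] at hu0 hu1
  -- `y - y' / Q` is the removed digit divided by `Q`; it passes the gate only if `r = l`.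
  let g : (Fin d → ℝ) → ℝ := fun x => (y x - (1 / Bs.prod : ℝ) * y' x) + (unitBump (r x) l - 1)
  have hg : g ∈ affSpan S2 := by
    refine add_mem_affSpan (sub_mem_affSpan (mem_affSpan (hS2 (Or.inr (Or.inl rfl))))
      (mul_mem_affSpan _ (mem_affSpan (hS2 (Or.inl rfl)))))
      (sub_mem_affSpan ?_ (const_mem_affSpan _))
    have := sub_mem_affSpan hu0 hu1
    push_cast at this
    exact this
  have h3 := h2.step (T := {g}) (C := insert y' (insert r (insert acc C)))
    (by rintro _ rfl; exact hg)
    (by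
      rintro f (rfl | rfl | rfl | hf)
      · exact mem_affSpan (hS2 (Or.inl rfl))
      · exact mem_affSpan (hS2 (Or.inr (Or.inr (Or.inl rfl))))
      · exact mem_affSpan (hS2 (Or.inr (Or.inr (Or.inr (Or.inl rfl)))))
      · exact mem_affSpan (hS2 (Or.inr (Or.inr (Or.inr (Or.inr hf))))))
    (width_le (m := 1) (by simp) (encard_insert_le' _ (encard_insert_le' _
      (encard_insert_le' _ hC))) (by omega))
  refine ⟨y', fun x => acc x + relu g x, h3.of_affSpan ?_, ?_⟩
  · rintro f (rfl | rfl | rfl | hf)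
    · exact mem_affSpan (Or.inr (Or.inl rfl))
    · exact mem_affSpan (Or.inr (Or.inr (Or.inl rfl)))
    · exact add_mem_affSpan (mem_affSpan (Or.inr (Or.inr (Or.inr (Or.inl rfl)))))
        (mem_affSpan (Or.inl ⟨g, rfl, rfl⟩))
    · exact mem_affSpan (Or.inr (Or.inr (Or.inr (Or.inr hf))))
  · intro x j i η t hη hy hr
    have hy' : y' x = t := hy.fracs_eq hs hη
    refine ⟨hy', ?_⟩
    obtain ⟨hj, hyx, h0, h1, -⟩ := hy
    have hP : (0 : ℝ) < Bs.prod := by exact_mod_cast (Nat.zero_le j).trans_lt hj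
    have e : y x - (1 / Bs.prod : ℝ) * y' x = j / Bs.prod := by rw [hyx, hy']; field_simp; ring
    simp only [relu, g, e, hr, unitBump_natCast]
    have hjle : (j : ℝ) / Bs.prod ≤ 1 := by
      rw [div_le_one hP]; exact_mod_cast hj.le
    rw [gate (by positivity) hjle (by split_ifs <;> simp)]
    split_ifs <;> simp

/-- Bit extraction: the `r`-th base `Q` digit of `v = m / Q ^ L`, counted from the front and
divided by `Q`. -/
lemma Avail.blocks {Bs : List ℕ} {β L : ℕ} {s : ℝ} (hB : ∀ B ∈ Bs, 1 ≤ B ∧ B ≤ β)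
    (hs : (Bs.prod : ℝ) ^ (L + 1) ≤ s) (hC : C.encard ≤ c) (hW : 2 * β + 12 + 2 * c ≤ W)
    {v r : (Fin d → ℝ) → ℝ} (h : Avail W D (insert v (insert r C))) :
    ∃ w, Avail W (D + L * (Bs.length + 2)) (insert w C) ∧
      ∀ x, ∀ m i : ℕ, i < L → m < Bs.prod ^ L → v x = m / (Bs.prod : ℝ) ^ L → r x = i →
        w x = (m / Bs.prod ^ (L - 1 - i) % Bs.prod : ℕ) / (Bs.prod : ℝ) := by
  have hP : 0 < Bs.prod := by
    refine Nat.pos_of_ne_zero fun h0 => ?_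
    have := (hB 0 (List.prod_eq_zero_iff.1 h0)).1
    omega
  set Q := Bs.prod with hQ
  have hQR : (1 : ℝ) ≤ Q := by exact_mod_cast hP
  have hs0 : 0 ≤ s := le_trans (by positivity) hs
  -- after `l` blocks, `y` has lost its `l` leading digits
  have key : ∀ l ≤ L, ∃ y acc, Avail W (D + l * (Bs.length + 2)) (insert y (insert r (insert acc C)))
      ∧ ∀ x, ∀ m i : ℕ, i < L → m < Q ^ L → v x = m / (Q : ℝ) ^ L → r x = i →
        y x = (m % Q ^ (L - l) : ℕ) / (Q : ℝ) ^ (L - l) ∧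
        acc x = if i < l then (m / Q ^ (L - 1 - i) % Q : ℕ) / (Q : ℝ) else 0 := by
    intro l hl
    induction l with
    | zero =>
      refine ⟨v, fun _ => 0, ?_, ?_⟩
      · rw [zero_mul, add_zero]
        refine h.of_affSpan ?_
        rintro f (rfl | rfl | rfl | hf)
        · exact mem_affSpan (Or.inl rfl)
        · exact mem_affSpan (Or.inr (Or.inl rfl))
        · exact const_mem_affSpan 0
        · exact mem_affSpan (Or.inr (Or.inr hf))
      · intro x m i hi hm hv hr
        simp [hv, Nat.mod_eq_of_lt hm]
    | succ l ih =>
      obtain ⟨y, acc, h1, h2⟩ := ih (by omega)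
      obtain ⟨y', acc', h3, h4⟩ := h1.block_step (l := l) hB hs0 hC hW
      refine ⟨y', acc', ?_, ?_⟩
      · rw [add_mul, one_mul, ← add_assoc]; exact h3
      intro x m i hi hm hv hr
      obtain ⟨e1, e2⟩ := h2 x m i hi hm hv hr
      obtain ⟨n, hn⟩ : ∃ n, L - l = n + 1 := ⟨L - l - 1, by omega⟩
      have hn' : L - (l + 1) = n := by omega
      rw [hn] at e1
      rw [hn']
      have hpow : 0 < Q ^ n := Nat.pow_pos hP
      have hlt : m % Q ^ (n + 1) < Q ^ (n + 1) := Nat.mod_lt _ (Nat.pow_pos hP)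
      have hgood : GoodAt (1 / (Q : ℝ) ^ n) Q (y x) (m % Q ^ (n + 1) / Q ^ n)
          ((m % Q ^ n : ℕ) / (Q : ℝ) ^ n) := by
        have hg : GoodAt 1 (Q * Q ^ n) (y x) (m % Q ^ (n + 1)) 0 := by
          refine ⟨by rwa [← pow_succ'], ?_, le_rfl, zero_le_one, Or.inl (by simp)⟩
          rw [e1, add_zero, Nat.cast_mul, Nat.cast_pow, ← pow_succ']
        have := hg.split.1
        rw [add_zero, Nat.mod_mod_of_dvd _ (Dvd.intro _ (pow_succ Q n).symm)] at this
        push_cast at this ⊢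
        exact this
      obtain ⟨f1, f2⟩ := h4 x _ i _ _ (by
        rw [mul_one_div, le_div_iff₀ (by positivity), ← pow_succ']
        exact (pow_le_pow_right₀ hQR (by omega)).trans hs) hgood hr
      refine ⟨f1, ?_⟩
      rw [f2, e2]
      have hdiv : m % Q ^ (n + 1) / Q ^ n = m / Q ^ n % Q := by
        rw [pow_succ, Nat.mod_mul_right_div_self]
      rcases lt_trichotomy i l with hi | hi | hi
      · rw [if_pos hi, if_neg (by omega), if_pos (by omega), add_zero]
      · rw [if_neg (by omega), if_pos hi.symm, if_pos (by omega), zero_add, hdiv]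
        congr 5
        omega
      · rw [if_neg (by omega), if_neg (by omega), if_neg (by omega), add_zero]
  obtain ⟨y, w, h1, h2⟩ := key L le_rfl
  refine ⟨w, h1.subset ?_, ?_⟩
  · rintro f (rfl | hf)
    · exact Or.inr (Or.inr (Or.inl rfl))
    · exact Or.inr (Or.inr (Or.inr hf))
  · intro x m i hi hm hv hr
    rw [(h2 x m i hi hm hv hr).2, if_pos hi]

end Blocks

section Multiplication

variable {d W D c : ℕ} {C : Set ((Fin d → ℝ) → ℝ)}

/-- The leading base `B` digit of `z` times `w`, exactly: the digit is a sum of `B - 1`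
indicators, each of which gates `w`. -/
lemma Avail.digit_mul {B β : ℕ} (hB1 : 1 ≤ B) (hBβ : B ≤ β) {s : ℝ} (hs : 0 ≤ s)
    (hC : C.encard ≤ c) (hW : 2 * β + 12 + 2 * c ≤ W) (p : ℝ)
    {z w acc : (Fin d → ℝ) → ℝ} (h : Avail W D (insert z (insert w (insert acc C)))) :
    ∃ z' acc', Avail W (D + 2) (insert z' (insert w (insert acc' C))) ∧
      ∀ x, ∀ j : ℕ, ∀ η t : ℝ, 1 ≤ s * η → GoodAt η B (z x) j t → 0 ≤ w x → w x ≤ 1 →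
        z' x = t ∧ acc' x = acc x + p * (j * w x) := by
  set S := insert z (insert w (insert acc C))
  have hS : S.encard ≤ (c + 1 + 1 + 1 : ℕ) :=
    encard_insert_le' _ (encard_insert_le' _ (encard_insert_le' _ hC))
  have h1 := h.ramps (Finset.range (B - 1)) s (fun k x => B * z x - (k + 1)) (C := S)
    (fun k _ => sub_mem_affSpan (mul_mem_affSpan _ (mem_affSpan (Or.inl rfl)))
      (const_mem_affSpan _)) subset_affSpan (width_le' hS (by simp; omega))
  set S1 := (fun (k : ℕ) x => ramp s (B * z x - (k + 1))) '' ↑(Finset.range (B - 1)) ∪ S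
  have hS1 : S ⊆ S1 := Set.subset_union_right
  have hr : ∀ k ∈ Finset.range (B - 1), (fun x => ramp s (B * z x - (k + 1))) ∈ affSpan S1 :=
    fun k hk => mem_affSpan (Or.inl ⟨k, by simpa using hk, rfl⟩)
  let z' : (Fin d → ℝ) → ℝ := fun x => fracStep s (z x) B
  have hz' : z' ∈ affSpan S1 := sub_mem_affSpan
    (mul_mem_affSpan _ (mem_affSpan (hS1 (Or.inl rfl)))) (sum_mem_affSpan _ hr)
  let g : ℕ → (Fin d → ℝ) → ℝ := fun k x => w x + (ramp s (B * z x - (k + 1)) - 1)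
  have h2 := h1.step (T := g '' (Finset.range (B - 1))) (C := insert z' (insert w (insert acc C)))
    (by
      rintro _ ⟨k, hk, rfl⟩
      exact add_mem_affSpan (mem_affSpan (hS1 (Or.inr (Or.inl rfl))))
        (sub_mem_affSpan (hr k hk) (const_mem_affSpan _)))
    (by
      rintro f (rfl | rfl | rfl | hf)
      · exact hz'
      · exact mem_affSpan (hS1 (Or.inr (Or.inl rfl)))
      · exact mem_affSpan (hS1 (Or.inr (Or.inr (Or.inl rfl))))
      · exact mem_affSpan (hS1 (Or.inr (Or.inr (Or.inr hf)))))
    (width_le (m := B - 1) ((Set.encard_image_le _ _).trans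
      (by rw [Set.encard_coe_eq_coe_finsetCard, Finset.card_range]))
      (encard_insert_le' _ (encard_insert_le' _ (encard_insert_le' _ hC))) (by omega))
  refine ⟨z', fun x => acc x + p * ∑ k ∈ Finset.range (B - 1), relu (g k) x,
    h2.of_affSpan ?_, ?_⟩
  · rintro f (rfl | rfl | rfl | hf)
    · exact mem_affSpan (Or.inr (Or.inl rfl))
    · exact mem_affSpan (Or.inr (Or.inr (Or.inl rfl)))
    · exact add_mem_affSpan (mem_affSpan (Or.inr (Or.inr (Or.inr (Or.inl rfl)))))
        (mul_mem_affSpan _ (sum_mem_affSpan _ fun k hk =>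
          mem_affSpan (Or.inl ⟨g k, ⟨k, hk, rfl⟩, rfl⟩)))
    · exact mem_affSpan (Or.inr (Or.inr (Or.inr (Or.inr hf))))
  · intro x j η t hη hz hw hw1
    obtain ⟨_, e2, e3⟩ := hz.digit_eq hs hη
    refine ⟨e2, ?_⟩
    show acc x + p * ∑ k ∈ Finset.range (B - 1), relu (g k) x = _
    have : ∀ k ∈ Finset.range (B - 1), relu (g k) x = if k < j then w x else 0 := by
      intro k hk
      simp only [relu, g]
      rw [e3 k (Finset.mem_range.1 hk), gate hw hw1 (by split_ifs <;> simp)]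
      split_ifs <;> simp
    rw [Finset.sum_congr rfl this, Finset.sum_ite, Finset.sum_const_zero, add_zero,
      Finset.sum_const, nsmul_eq_mul]
    have hj := hz.1
    rw [show (Finset.range (B - 1)).filter (· < j) = Finset.range j from ?_, Finset.card_range]
    ext k; simp; omega

/-- The truncation of `z` to the digits with bases `Bs`, times `p * w`, is added to `acc`. It is a
sum over the digits, each weighted by the inverse of the product of the bases up to it. -/
lemma Avail.trunc_mul {Bs : List ℕ} {β : ℕ} (hB : ∀ B ∈ Bs, 1 ≤ B ∧ B ≤ β) {s : ℝ}
    (hs : 0 ≤ s) (hC : C.encard ≤ c) (hW : 2 * β + 12 + 2 * c ≤ W)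
    {z w acc : (Fin d → ℝ) → ℝ} (p : ℝ) (h : Avail W D (insert z (insert w (insert acc C)))) :
    ∃ acc', Avail W (D + 2 * Bs.length) (insert acc' C) ∧
      ∀ x, ∀ j : ℕ, ∀ η t : ℝ, Bs.prod ≤ s * η → GoodAt η Bs.prod (z x) j t →
        0 ≤ w x → w x ≤ 1 → acc' x = acc x + p * ((j / Bs.prod : ℝ) * w x) := by
  induction Bs generalizing D z acc p with
  | nil =>
    refine ⟨acc, h.subset ?_, ?_⟩
    · rintro f (rfl | hf)
      · exact Or.inr (Or.inr (Or.inl rfl))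
      · exact Or.inr (Or.inr (Or.inr hf))
    · intro x j η t _ hz _ _
      have : j = 0 := by simpa using hz.1
      simp [this]
  | cons B Bs ih =>
    obtain ⟨hB1, hB2⟩ := hB B (by simp)
    obtain ⟨z', acc1, h1, h2⟩ := h.digit_mul hB1 hB2 hs hC hW (p / B)
    obtain ⟨acc', h3, h4⟩ := ih (fun B' hB' => hB B' (by simp [hB'])) (p / B) h1
    refine ⟨acc', ?_, ?_⟩
    · rw [List.length_cons, mul_add, mul_one, add_comm (2 * _), ← add_assoc]; exact h3
    · intro x j η t hη hz hw hw1
      rw [List.prod_cons] at hη hz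
      obtain ⟨g1, g2⟩ := hz.split
      have hpos : 0 < B * Bs.prod := (Nat.zero_le j).trans_lt hz.1
      have hP : 0 < Bs.prod := Nat.pos_of_mul_pos_left hpos
      have hPR : (0 : ℝ) < Bs.prod := by exact_mod_cast hP
      have hBR : (0 : ℝ) < B := by exact_mod_cast hB1
      have hle : ((Bs.prod : ℕ) : ℝ) ≤ s * η := by
        refine le_trans ?_ hη
        exact_mod_cast Nat.le_mul_of_pos_left _ hB1
      obtain ⟨e1, e2⟩ := h2 x _ _ _ (by rw [← mul_div_assoc, le_div_iff₀ hPR, one_mul]; exact hle)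
        g1 hw hw1
      rw [h4 x (j % Bs.prod) η t hle (by rw [e1]; exact g2) hw hw1, e2, List.prod_cons]
      have hdm : (j : ℝ) = Bs.prod * (j / Bs.prod : ℕ) + (j % Bs.prod : ℕ) := by
        exact_mod_cast (Nat.div_add_mod j Bs.prod).symm
      rw [hdm, Nat.cast_mul]
      field_simp
      ring

/-- Multiplication of `w ∈ [0,1]` by a product of truncations of the functions `y i ∈ [0,1]` to
finitely many digits. -/
lemma Avail.trunc_prod {Bs : List ℕ} {β : ℕ} (hB : ∀ B ∈ Bs, 1 ≤ B ∧ B ≤ β) {s : ℝ}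
    (hs : 0 ≤ s) {y : Fin d → (Fin d → ℝ) → ℝ} (hW : 2 * β + 12 + 2 * d ≤ W)
    (is : List (Fin d)) {w : (Fin d → ℝ) → ℝ} (h : Avail W D (insert w (Set.range y))) :
    ∃ w', Avail W (D + 2 * Bs.length * is.length) (insert w' (Set.range y)) ∧
      ∀ x, ∀ j : Fin d → ℕ, ∀ η : ℝ, ∀ t : Fin d → ℝ, Bs.prod ≤ s * η →
        (∀ i, GoodAt η Bs.prod (y i x) (j i) (t i)) →
        0 ≤ w x → w x ≤ 1 → w' x = w x * (is.map fun i => (j i / Bs.prod : ℝ)).prod := by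
  induction is generalizing D w with
  | nil => exact ⟨w, h, by simp⟩
  | cons i is ih =>
    have hC : (Set.range y).encard ≤ d := (encard_range_le y).trans (by simp)
    obtain ⟨w1, h1, h2⟩ := Avail.trunc_mul (z := y i) (w := w) (acc := fun _ => 0) hB hs hC hW 1
      (h.of_affSpan (by
        rintro f (rfl | rfl | rfl | hf)
        · exact mem_affSpan (Or.inr ⟨i, rfl⟩)
        · exact mem_affSpan (Or.inl rfl)
        · exact const_mem_affSpan 0
        · exact mem_affSpan (Or.inr hf)))
    obtain ⟨w', h3, h4⟩ := ih h1
    refine ⟨w', ?_, ?_⟩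
    · rw [List.length_cons, mul_add, mul_one, add_comm (2 * Bs.length * _), ← add_assoc]; exact h3
    · intro x j η t hη hy hw hw1
      have e := h2 x (j i) η (t i) hη (hy i) hw hw1
      have hP : (0 : ℝ) < Bs.prod := by exact_mod_cast (Nat.zero_le _).trans_lt (hy i).1
      have hj : (j i : ℝ) / Bs.prod ≤ 1 := by
        rw [div_le_one hP]; exact_mod_cast (hy i).1.le
      rw [zero_add, one_mul] at e
      rw [h4 x j η t hη hy (by rw [e]; positivity) (by rw [e]; exact mul_le_one₀ hj hw hw1), e,
        List.map_cons, List.prod_cons]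
      ring

end Multiplication

/-! ### Networks for one Taylor coefficient times a monomial -/

section Piece

/-- The bases `n, n, 2, …, 2` of the digits of a grid index below `n² 2^k`. -/
def gridBases (n k : ℕ) : List ℕ := [n, n] ++ List.replicate k 2

/-- The digits of `s` grid indices. -/
def fineBases (n k s : ℕ) : List ℕ := (List.replicate s (gridBases n k)).flatten

lemma prod_gridBases (n k : ℕ) : (gridBases n k).prod = n * (n * 2 ^ k) := by
  simp [gridBases]

lemma prod_fineBases (n k s : ℕ) : (fineBases n k s).prod = (n * (n * 2 ^ k)) ^ s := by
  induction s with
  | zero => simp [fineBases]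
  | succ s ih =>
    rw [fineBases, List.replicate_succ, List.flatten_cons, List.prod_append, prod_gridBases,
      ← fineBases, ih, pow_succ']

lemma length_fineBases (n k s : ℕ) : (fineBases n k s).length = s * (k + 2) := by
  simp [fineBases, gridBases, add_comm]
  omega

lemma mem_fineBases {n k s B : ℕ} (hn : 1 ≤ n) (hB : B ∈ fineBases n k s) :
    1 ≤ B ∧ B ≤ n + 1 := by
  simp only [fineBases, List.mem_flatten, List.mem_replicate] at hB
  obtain ⟨l, ⟨_, rfl⟩, hB⟩ := hB
  simp only [gridBases, List.mem_append, List.mem_cons, List.mem_replicate, List.not_mem_nil,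
    or_false] at hB
  omega

/-- The `i`-th base `m` digit. -/
def natDigit (m a i : ℕ) : ℕ := a / m ^ i % m

lemma natDigit_sum {d m : ℕ} {f : Fin d → ℕ} (hf : ∀ i, f i < m) (i : Fin d) :
    natDigit m (∑ i, f i * m ^ (i : ℕ)) i = f i ∧ ∑ i, f i * m ^ (i : ℕ) < m ^ d := by
  have h1 := finFunctionFinEquiv_apply (fun i => (⟨f i, hf i⟩ : Fin m))
  have h2 := finFunctionFinEquiv_symm_apply_val (finFunctionFinEquiv fun i => (⟨f i, hf i⟩ : Fin m)) i
  rw [Equiv.symm_apply_apply, h1] at h2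
  refine ⟨h2.symm, ?_⟩
  have := (finFunctionFinEquiv fun i => (⟨f i, hf i⟩ : Fin m)).2
  rwa [h1] at this

variable {d W D : ℕ}

/-- Removing leading digits from all coordinates, while recording them in the single number
`∑ i, (digits of coordinate i) * (∏ Bs) ^ i`. -/
lemma Avail.index_layers {Bs : List ℕ} {β c : ℕ} (hB : ∀ B ∈ Bs, 1 ≤ B ∧ B ≤ β) {s : ℝ}
    (hs : 0 ≤ s) {y : Fin d → (Fin d → ℝ) → ℝ} {C : Set ((Fin d → ℝ) → ℝ)} (hC : C.encard ≤ c)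
    (hW : d * (2 * β) + 2 * (c + d) ≤ W) (h : Avail W D (C ∪ Set.range y)) :
    ∃ (y' : Fin d → (Fin d → ℝ) → ℝ) (a : (Fin d → ℝ) → ℝ),
      Avail W (D + Bs.length) (insert a C ∪ Set.range y') ∧
      ∀ x, ∀ j : Fin d → ℕ, ∀ η : ℝ, ∀ M : ℕ, ∀ t : Fin d → ℝ, (Bs.prod * M : ℕ) ≤ s * η →
        (∀ i, GoodAt η (Bs.prod * M) (y i x) (j i) (t i)) →
        (∀ i, GoodAt η M (y' i x) (j i % M) (t i)) ∧
        a x = (∑ i, (j i / M) * Bs.prod ^ (i : ℕ) : ℕ) := by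
  have hC' : (C ∪ Set.range y).encard ≤ (c + d : ℕ) := by
    refine (Set.encard_union_le _ _).trans ?_
    push_cast
    exact add_le_add hC ((encard_range_le y).trans (by simp))
  have h1 := Avail.fracs_layers (ι := Fin d) (y := y) (C := C ∪ Set.range y) hB s
    (h.subset (Set.union_subset Set.subset_union_right subset_rfl))
    (width_le' hC' (by simpa using hW))
  refine ⟨fun i x => fracs s Bs (y i x),
    fun x => ∑ i : Fin d, ((Bs.prod ^ (i : ℕ) : ℕ) : ℝ) * (Bs.prod * y i x - fracs s Bs (y i x)),
    h1.of_affSpan ?_, ?_⟩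
  · rintro f ((rfl | hf) | ⟨i, rfl⟩)
    · exact sum_mem_affSpan _ fun i _ => mul_mem_affSpan _ (sub_mem_affSpan
        (mul_mem_affSpan _ (mem_affSpan (Or.inr (Or.inr ⟨i, rfl⟩))))
        (mem_affSpan (Or.inl ⟨i, rfl⟩)))
    · exact mem_affSpan (Or.inr (Or.inl hf))
    · exact mem_affSpan (Or.inl ⟨i, rfl⟩)
  · intro x j η M t hη hy
    have key : ∀ i, fracs s Bs (y i x) = ((j i % M : ℕ) + t i) / M ∧
        GoodAt η M (((j i % M : ℕ) + t i) / M) (j i % M) (t i) ∧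
        Bs.prod * y i x - ((j i % M : ℕ) + t i) / M = (j i / M : ℕ) := by
      intro i
      obtain ⟨g1, g2⟩ := (hy i).split
      have hpos : 0 < Bs.prod * M := (Nat.zero_le _).trans_lt (hy i).1
      have hM : (0 : ℝ) < M := by exact_mod_cast Nat.pos_of_mul_pos_left hpos
      have hP : (0 : ℝ) < Bs.prod := by exact_mod_cast Nat.pos_of_mul_pos_right hpos
      refine ⟨g1.fracs_eq hs ?_, g2, ?_⟩
      · rw [← mul_div_assoc, le_div_iff₀ hM]; exact_mod_cast hη
      · rw [g1.2.1, mul_div_cancel₀ _ hP.ne']; ring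
    refine ⟨fun i => by simpa only [(key i).1] using (key i).2.1, ?_⟩
    rw [Nat.cast_sum]
    refine Finset.sum_congr rfl fun i _ => ?_
    rw [(key i).1, (key i).2.2, Nat.cast_mul, mul_comm]

/-- A network for one coefficient times one monomial. Here `u J / Q` with `Q = (n² 2^k)^s` is a
coefficient depending on the cell `J` of a grid with `n² 2^k` cells in each direction, and the
factors of the monomial are the coordinates, relative to the cell and truncated to multiples of
`1 / Q`. -/
lemma exists_avail_piece {n k s N L : ℕ} (hd : 1 ≤ d) (hn : 1 ≤ n) (hL : 1 ≤ L)
    (hnN : n ^ d ≤ N) (hkL : (2 ^ k) ^ d ≤ L * L) {η : ℝ} (hη : 0 < η)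
    (u : (Fin d → ℕ) → ℕ) (hu : ∀ J, u J < (n * (n * 2 ^ k)) ^ s) (is : List (Fin d))
    (his : is.length ≤ s) (hW : 4 * N + 24 + 2 * d * (n + 2) ≤ W) :
    ∃ w : (Fin d → ℝ) → ℝ,
      Avail W ((k + 2) + 2 * L + L * (s * (k + 2) + 2) + 2 * (s * (k + 2)) * s) {w} ∧
      ∀ x : Fin d → ℝ, ∀ J : Fin d → ℕ, ∀ t : Fin d → ℝ,
        (∀ i, GoodAt η (n * (n * 2 ^ k) * (n * (n * 2 ^ k)) ^ s) (x i) (J i) (t i)) →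
        w x = u (fun i => J i / (n * (n * 2 ^ k)) ^ s) / ((n * (n * 2 ^ k) : ℕ) : ℝ) ^ s *
          (is.map fun i => ((J i % (n * (n * 2 ^ k)) ^ s : ℕ) : ℝ) /
            ((n * (n * 2 ^ k) : ℕ) : ℝ) ^ s).prod := by
  set K := n * (n * 2 ^ k) with hK
  set Q := K ^ s with hQ
  have hKpos : 0 < K := by positivity
  have hQpos : 0 < Q := Nat.pow_pos hKpos
  have hprod : (fineBases n k s).prod = Q := prod_fineBases n k s
  -- One slope `c` for all ramps: steep enough for the digits of the coordinates, which have the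
  -- margin `η`, and for those of the encoded coefficients, whose margin is a power of `Q`.
  obtain ⟨c, hc1, hc2⟩ : ∃ c : ℝ, ((K * Q : ℕ) : ℝ) ≤ c * η ∧ (Q : ℝ) ^ (L + 1) ≤ c := by
    refine ⟨max ((K * Q : ℕ) / η) ((Q : ℝ) ^ (L + 1)), ?_, le_max_right _ _⟩
    rw [← div_le_iff₀ hη]
    exact le_max_left _ _
  have hc0 : 0 ≤ c := le_trans (by positivity) hc2
  have hexp : 2 * d * (n + 2) = d * (2 * (n + 1)) + 2 * d := by ring
  have hn2 : d * (2 * n) ≤ d * (2 * (n + 1)) := Nat.mul_le_mul_left _ (by omega)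
  have hnd : n ≤ d * (n + 1) + n := by omega
  have hd2 : n + 1 ≤ d * (n + 1) := Nat.le_mul_of_pos_left _ hd
  have hexp' : d * (2 * (n + 1)) = 2 * (d * (n + 1)) := by ring
  -- The leading digits of all coordinates, in the bases `n`, `n` and `2, …, 2`, combined to the
  -- numbers `a`, `b < N` and `lam < L²`; `y` keeps the positions relative to the cell.
  have h0 : Avail W 0 ((∅ : Set ((Fin d → ℝ) → ℝ)) ∪ Set.range fun (i : Fin d) x => x i) := by
    rw [Set.empty_union]; exact subset_affSpan
  obtain ⟨y1, a, h1, s1⟩ := Avail.index_layers (Bs := [n]) (β := n) (c := 0) (by simpa using hn)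
    hc0 (by simp) (by omega) h0
  obtain ⟨y2, b, h2, s2⟩ := Avail.index_layers (Bs := [n]) (β := n) (c := 1) (by simpa using hn)
    hc0 (encard_insert_le' a (by simp)) (by omega) h1
  obtain ⟨y, lam, h3, s3⟩ := Avail.index_layers (Bs := List.replicate k 2) (β := n + 1) (c := 2)
    (by intro B hB; have := List.eq_of_mem_replicate hB; omega) hc0
    (encard_insert_le' b (encard_insert_le' a (by simp))) (by omega) h2
  have hy : (Set.range y).encard ≤ d := (encard_range_le y).trans (by simp)
  -- The table of encoded coefficients: an entry packs the coefficients of the `L` cells with the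
  -- same `a`, `b` and `lam / L` into the base `Q` digits of a single number. They are packed in
  -- reverse order, since `Avail.blocks` counts digits from the front.
  let U : ℕ → ℕ → ℕ → ℕ := fun i j m =>
    u fun e : Fin d => (natDigit n i e * n + natDigit n j e) * 2 ^ k + natDigit (2 ^ k) m e
  have hcode : ∀ l i j : ℕ, ∃ m < Q ^ L, ∀ e < L, m / Q ^ e % Q = U i j (l * L + (L - 1 - e)) :=
    fun l i j => exists_code L (fun e => U i j (l * L + (L - 1 - e))) fun e => hu _
  choose code hcode1 hcode2 using hcode
  have hQR : (0 : ℝ) < Q := by exact_mod_cast hQpos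
  obtain ⟨v, r, h4, s4⟩ := Avail.table (N := N) (L := L) (C := Set.range y) (c := d)
    (a := a) (b := b) (lam := lam) (T := fun l i j => code l i j / (Q : ℝ) ^ L) hL hy (by omega)
    (fun l i j => ⟨by positivity, by
      rw [div_le_one (by positivity)]; exact_mod_cast (hcode1 l i j).le⟩)
    (h3.subset (by
      rintro f (rfl | rfl | rfl | hf)
      exacts [Or.inl (Or.inr (Or.inr (Or.inl rfl))), Or.inl (Or.inr (Or.inl rfl)),
        Or.inl (Or.inl rfl), Or.inr hf]))
  obtain ⟨w0, h5, s5⟩ := h4.blocks (Bs := fineBases n k s) (β := n + 1) (L := L) (s := c)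
    (fun B hB => mem_fineBases hn hB) (by rw [hprod]; exact hc2) hy
    (by omega)
  obtain ⟨w, h6, s6⟩ := h5.trunc_prod (Bs := fineBases n k s) (β := n + 1) (s := c)
    (fun B hB => mem_fineBases hn hB) hc0 (by omega) is
  have h7 := (h6.subset (T := {w}) (by simp)).carry (by rw [Set.encard_singleton]; exact_mod_cast (by omega : 2 * 1 ≤ W))
    (2 * (s * (k + 2)) * s - 2 * (s * (k + 2)) * is.length)
  refine ⟨w, ?_, ?_⟩
  · convert h7 using 1
    have := Nat.mul_le_mul_left (2 * (s * (k + 2))) his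
    simp only [length_fineBases, List.length_cons, List.length_nil, List.length_replicate]
    omega
  intro x J t hx
  have hM1 : n * (n * 2 ^ k) * Q = [n].prod * (n * (2 ^ k * Q)) := by simp; ring
  have hM2 : n * (2 ^ k * Q) = [n].prod * (2 ^ k * Q) := by simp
  have hM3 : 2 ^ k * Q = (List.replicate k 2).prod * Q := by simp
  have hle2 : 2 ^ k * Q ≤ n * (2 ^ k * Q) := Nat.le_mul_of_pos_left _ hn
  have hle1 : n * (2 ^ k * Q) ≤ K * Q := by
    rw [hM1]; simpa using Nat.le_mul_of_pos_left _ hn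
  obtain ⟨g1, e1⟩ := s1 x J η (n * (2 ^ k * Q)) t (by rw [← hM1]; exact hc1)
    (fun i => by rw [← hM1]; exact hx i)
  obtain ⟨g2, e2⟩ := s2 x _ η (2 ^ k * Q) t
    (by rw [← hM2]; exact le_trans (by exact_mod_cast hle1) hc1)
    (fun i => by rw [← hM2]; exact g1 i)
  obtain ⟨g3, e3⟩ := s3 x _ η Q t
    (by rw [← hM3]; exact le_trans (by exact_mod_cast hle2.trans hle1) hc1)
    (fun i => by rw [← hM3]; exact g2 i)
  have hA : ∀ i, J i / (n * (2 ^ k * Q)) < n := fun i =>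
    Nat.div_lt_of_lt_mul (by
      have := (hx i).1
      rwa [hM1, List.prod_singleton, mul_comm] at this)
  have hBd : ∀ i, J i % (n * (2 ^ k * Q)) / (2 ^ k * Q) < n := fun i =>
    Nat.div_lt_of_lt_mul ((g1 i).1.trans_eq (by ring))
  have hLm : ∀ i, J i % (n * (2 ^ k * Q)) % (2 ^ k * Q) / Q < 2 ^ k := fun i =>
    Nat.div_lt_of_lt_mul ((g2 i).1.trans_eq (by ring))
  simp only [List.prod_singleton] at e1 e2
  simp only [List.prod_replicate] at e3
  set ia := ∑ i : Fin d, J i / (n * (2 ^ k * Q)) * n ^ (i : ℕ) with hia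
  set ib := ∑ i : Fin d, J i % (n * (2 ^ k * Q)) / (2 ^ k * Q) * n ^ (i : ℕ) with hib
  set m := ∑ i : Fin d, J i % (n * (2 ^ k * Q)) % (2 ^ k * Q) / Q * (2 ^ k) ^ (i : ℕ) with hm
  have hia' : ia < N := ((natDigit_sum hA ⟨0, hd⟩).2).trans_le hnN
  have hib' : ib < N := ((natDigit_sum hBd ⟨0, hd⟩).2).trans_le hnN
  have hm' : m < L * L := ((natDigit_sum hLm ⟨0, hd⟩).2).trans_le hkL
  obtain ⟨f1, f2⟩ := s4 x ia ib m hia' hib' hm' e1 e2 e3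
  have hmod : m % L < L := Nat.mod_lt _ hL
  have f3 := s5 x _ (m % L) hmod (by rw [hprod]; exact hcode1 (m / L) ia ib)
    (by rw [hprod]; exact f1) f2
  rw [hprod, hcode2 _ _ _ _ (by omega)] at f3
  have hU : U ia ib (m / L * L + (L - 1 - (L - 1 - m % L))) = u fun i => J i / Q := by
    rw [show L - 1 - (L - 1 - m % L) = m % L by omega, Nat.div_add_mod']
    simp only [U]
    congr 1
    ext i
    rw [hia, (natDigit_sum hA i).1, hib, (natDigit_sum hBd i).1, hm, (natDigit_sum hLm i).1]
    have q1 := Nat.div_add_mod (J i) (n * (2 ^ k * Q))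
    have q2 := Nat.div_add_mod (J i % (n * (2 ^ k * Q))) (2 ^ k * Q)
    have q3 := Nat.div_add_mod (J i % (n * (2 ^ k * Q)) % (2 ^ k * Q)) Q
    set r1 := J i % (n * (2 ^ k * Q))
    set r2 := r1 % (2 ^ k * Q)
    have q4 : r2 % Q < Q := Nat.mod_lt _ hQpos
    refine (Nat.div_eq_of_lt_le ?_ ?_).symm
    · calc _ = n * (2 ^ k * Q) * (J i / (n * (2 ^ k * Q))) + (2 ^ k * Q * (r1 / (2 ^ k * Q)) +
            Q * (r2 / Q)) := by ring
        _ ≤ _ := by omega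
    · calc J i < n * (2 ^ k * Q) * (J i / (n * (2 ^ k * Q))) + (2 ^ k * Q * (r1 / (2 ^ k * Q)) +
            (Q * (r2 / Q) + Q)) := by omega
        _ = _ := by rw [Nat.succ_mul]; ring
  rw [hU] at f3
  have hJQ : ∀ i, J i % (n * (2 ^ k * Q)) % (2 ^ k * Q) % Q = J i % Q := fun i => by
    rw [Nat.mod_mod_of_dvd _ (Dvd.intro_left _ rfl), Nat.mod_mod_of_dvd]
    exact ⟨n * 2 ^ k, by ring⟩
  have f4 := s6 x (fun i => J i % Q) η t
    (by rw [hprod]; exact le_trans (by exact_mod_cast Nat.le_mul_of_pos_left Q hKpos) hc1)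
    (fun i => by rw [hprod, ← hJQ]; exact g3 i) (by rw [f3]; positivity)
    (by rw [f3, div_le_one hQR]; exact_mod_cast (hu _).le)
  rw [f4, f3, hprod, hQ]
  push_cast
  rfl

end Piece

/-! ### Taylor polynomials with grouped monomials -/

section Taylor

open scoped Nat

variable {d : ℕ}

/-- Number of times that the index sequence `ι` takes the value `i`. -/
def indexCount {k : ℕ} (ι : Fin k → Fin d) (i : Fin d) : ℕ := (Finset.univ.filter (ι · = i)).card

lemma sum_indexCount {k : ℕ} (ι : Fin k → Fin d) : ∑ i, indexCount ι i = k := by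
  simp only [indexCount]
  rw [← Finset.card_eq_sum_card_fiberwise (fun x _ => Finset.mem_univ (ι x))]
  simp

lemma prod_eq_prod_pow_indexCount {k : ℕ} (ι : Fin k → Fin d) (h : Fin d → ℝ) :
    ∏ l, h (ι l) = ∏ i, h i ^ indexCount ι i := by
  rw [← Finset.prod_fiberwise Finset.univ ι]
  refine Finset.prod_congr rfl fun i _ => ?_
  rw [Finset.prod_congr rfl (fun l hl => by rw [(Finset.mem_filter.1 hl).2]), Finset.prod_const,
    indexCount]

/-- At most `k!` index sequences of length `k` have the same counts, as any two of them differ by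
a permutation. -/
lemma card_indexCount_eq_le {k : ℕ} (α : Fin d → ℕ) :
    (Finset.univ.filter fun ι : Fin k → Fin d => indexCount ι = α).card ≤ k ! := by
  classical
  rcases (Finset.univ.filter fun ι : Fin k → Fin d => indexCount ι = α).eq_empty_or_nonempty
    with h | ⟨ι₀, h₀⟩
  · rw [h]; simp
  · have h₀' := (Finset.mem_filter.1 h₀).2
    calc _ ≤ (Finset.univ.image fun σ : Equiv.Perm (Fin k) => ι₀ ∘ σ).card := by
          refine Finset.card_le_card fun ι hι => ?_
          have hι' := (Finset.mem_filter.1 hι).2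
          have e : ∀ c, Nonempty ({ a // ι a = c } ≃ { b // ι₀ b = c }) := by
            intro c
            refine Fintype.card_eq.1 ?_
            have : indexCount ι c = indexCount ι₀ c := by rw [hι', h₀']
            simpa [indexCount, Fintype.card_subtype] using this
          refine Finset.mem_image.2 ⟨Equiv.ofFiberEquiv fun c => (e c).some, Finset.mem_univ _, ?_⟩
          exact funext fun a => Equiv.ofFiberEquiv_map (g := ι₀) (fun c => (e c).some) a
      _ ≤ k ! := Finset.card_image_le.trans (by rw [Finset.card_univ, Fintype.card_perm,
          Fintype.card_fin])

/-- Partial derivative along the index sequence `ι`. -/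
noncomputable def partialDeriv (g : (Fin d → ℝ) → ℝ) (x : Fin d → ℝ) {k : ℕ} (ι : Fin k → Fin d) : ℝ :=
  iteratedFDeriv ℝ k g x fun l => Pi.single (ι l) 1

lemma iteratedFDeriv_const_eq_sum (g : (Fin d → ℝ) → ℝ) (x h : Fin d → ℝ) (k : ℕ) :
    iteratedFDeriv ℝ k g x (fun _ => h) = ∑ ι : Fin k → Fin d, (∏ l, h (ι l)) *
      partialDeriv g x ι := by
  have h1 : h = ∑ i, h i • (Pi.single i 1 : Fin d → ℝ) := by
    ext j; simp [Finset.sum_apply, Pi.single_apply]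
  conv_lhs => rw [h1]
  rw [ContinuousMultilinearMap.map_sum]
  refine Finset.sum_congr rfl fun ι _ => ?_
  rw [ContinuousMultilinearMap.map_smul_univ]
  rfl

/-- Coefficient of the monomial with exponents `α` in the Taylor polynomial of degree `< s`. -/
noncomputable def taylorCoeff (g : (Fin d → ℝ) → ℝ) (s : ℕ) (x : Fin d → ℝ) (α : Fin d → ℕ) : ℝ :=
  ∑ k ∈ Finset.range s, (k ! : ℝ)⁻¹ *
    ∑ ι ∈ Finset.univ.filter (fun ι : Fin k → Fin d => indexCount ι = α), partialDeriv g x ι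

/-- The exponents of the monomials of degree less than `s` in `d` variables. -/
def exponents (d s : ℕ) : Finset (Fin d → ℕ) :=
  (Fintype.piFinset fun _ : Fin d => Finset.range s).filter fun α => ∑ i, α i < s

lemma card_exponents_le (d s : ℕ) : (exponents d s).card ≤ s ^ d := by
  refine (Finset.card_filter_le _ _).trans ?_
  simp

lemma sum_taylorCoeff (g : (Fin d → ℝ) → ℝ) (s : ℕ) (x h : Fin d → ℝ) :
    ∑ k ∈ Finset.range s, (k ! : ℝ)⁻¹ * iteratedFDeriv ℝ k g x (fun _ => h) =
      ∑ α ∈ exponents d s, taylorCoeff g s x α * ∏ i, h i ^ α i := by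
  simp only [taylorCoeff, Finset.sum_mul]
  rw [Finset.sum_comm]
  refine Finset.sum_congr rfl fun k hk => ?_
  have hk := Finset.mem_range.1 hk
  simp only [mul_assoc]
  rw [← Finset.mul_sum]
  congr 1
  rw [iteratedFDeriv_const_eq_sum, ← Finset.sum_fiberwise_of_maps_to (t := exponents d s)
    (g := fun ι => indexCount ι)]
  · refine Finset.sum_congr rfl fun α _ => ?_
    rw [Finset.sum_mul]
    refine Finset.sum_congr rfl fun ι hι => ?_
    rw [prod_eq_prod_pow_indexCount, (Finset.mem_filter.1 hι).2, mul_comm]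
  · intro ι _
    have h1 := sum_indexCount ι
    refine Finset.mem_filter.2 ⟨Fintype.mem_piFinset.2 fun i => Finset.mem_range.2 ?_, by omega⟩
    have := Finset.single_le_sum (f := indexCount ι) (fun _ _ => Nat.zero_le _) (Finset.mem_univ i)
    omega

/-- Only the order `∑ i, α i` contributes to the coefficient, and there the factor `1 / k!`
compensates the number of index sequences. -/
lemma abs_taylorCoeff_le {g : (Fin d → ℝ) → ℝ} {s : ℕ} {x : Fin d → ℝ} {Λ : ℝ} (hΛ : 0 ≤ Λ)
    (h : ∀ k < s, ∀ ι : Fin k → Fin d, |partialDeriv g x ι| ≤ Λ) (α : Fin d → ℕ) :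
    |taylorCoeff g s x α| ≤ Λ := by
  have h0 : ∀ k ≠ ∑ i, α i, Finset.univ.filter (fun ι : Fin k → Fin d => indexCount ι = α) = ∅ := by
    intro k hk
    refine Finset.filter_eq_empty_iff.2 fun ι _ h' => hk ?_
    rw [← h', sum_indexCount]
  have hterm : ∀ k < s, |(k ! : ℝ)⁻¹ * ∑ ι ∈ Finset.univ.filter
      (fun ι : Fin k → Fin d => indexCount ι = α), partialDeriv g x ι| ≤ Λ := by
    intro k hk
    have hf : (0 : ℝ) < k ! := by exact_mod_cast Nat.factorial_pos k
    rw [abs_mul, abs_of_pos (inv_pos.2 hf), inv_mul_le_iff₀ hf]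
    refine (Finset.abs_sum_le_sum_abs _ _).trans ((Finset.sum_le_card_nsmul _ _ Λ
      fun ι _ => h k hk ι).trans ?_)
    rw [nsmul_eq_mul]
    gcongr
    exact card_indexCount_eq_le α
  rw [taylorCoeff]
  by_cases hα : ∑ i, α i < s
  · rw [Finset.sum_eq_single_of_mem _ (Finset.mem_range.2 hα)]
    · exact hterm _ hα
    · intro k _ hk
      rw [h0 k hk, Finset.sum_empty, mul_zero]
  · rw [Finset.sum_eq_zero]
    · simpa using hΛ
    · intro k hk
      have hk := Finset.mem_range.1 hk
      rw [h0 k (by omega), Finset.sum_empty, mul_zero]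

/-- Taylor's formula with integral remainder, for partial derivatives bounded by `Λ`. -/
lemma taylor_remainder_le {g : (Fin d → ℝ) → ℝ} {s : ℕ} (hs : 1 ≤ s) {U : Set (Fin d → ℝ)}
    (hU : IsOpen U) (hUI : Set.Icc 0 1 ⊆ U) (hg : ContDiffOn ℝ s g U) {Λ : ℝ}
    (hΛ : ∀ k ≤ s, ∀ ι : Fin k → Fin d, ∀ x ∈ Set.Icc (0 : Fin d → ℝ) 1, |partialDeriv g x ι| ≤ Λ)
    {x h : Fin d → ℝ} (hx : x ∈ Set.Icc (0 : Fin d → ℝ) 1)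
    (hxh : x + h ∈ Set.Icc (0 : Fin d → ℝ) 1)
    {ρ : ℝ} (hρ : ∀ i, |h i| ≤ ρ) :
    |g (x + h) - ∑ α ∈ exponents d s, taylorCoeff g s x α * ∏ i, h i ^ α i| ≤
      d ^ s / s ! * ρ ^ s * Λ := by
  obtain ⟨n, rfl⟩ := Nat.exists_eq_add_of_le' hs
  have hseg : ∀ t ∈ Set.Icc (0 : ℝ) 1, x + t • h ∈ Set.Icc (0 : Fin d → ℝ) 1 := by
    intro t ht
    have := (convex_Icc (0 : Fin d → ℝ) 1).add_smul_mem hx hxh ht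
    exact this
  have hcd : ∀ t ∈ Set.Icc (0 : ℝ) 1, ContDiffAt ℝ (n + 1) g (x + t • h) := fun t ht =>
    (hg.contDiffAt (hU.mem_nhds (hUI (hseg t ht)))).of_le (by norm_cast)
  have hT := map_add_eq_sum_add_integral_iteratedFDeriv hcd
  rw [← sum_taylorCoeff]
  simp only [smul_eq_mul] at hT
  rw [hT, add_sub_cancel_left, abs_mul]
  have hbd : ∀ t ∈ Set.Icc (0 : ℝ) 1, |iteratedFDeriv ℝ (n + 1) g (x + t • h) (fun _ => h)| ≤
      d ^ (n + 1) * (ρ ^ (n + 1) * Λ) := by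
    intro t ht
    rw [iteratedFDeriv_const_eq_sum]
    refine (Finset.abs_sum_le_sum_abs _ _).trans ((Finset.sum_le_card_nsmul _ _
      (ρ ^ (n + 1) * Λ) fun ι _ => ?_).trans (le_of_eq ?_))
    · rw [abs_mul, Finset.abs_prod]
      refine mul_le_mul ?_ (hΛ _ le_rfl ι _ (hseg t ht)) (abs_nonneg _) ?_
      · refine (Finset.prod_le_prod (fun _ _ => abs_nonneg _) fun l _ => hρ (ι l)).trans ?_
        simp
      · exact pow_nonneg ((abs_nonneg _).trans (hρ (ι 0))) _
    · simp
  have hint : |∫ t in (0 : ℝ)..1, (1 - t) ^ n * iteratedFDeriv ℝ (n + 1) g (x + t • h) fun _ => h| ≤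
      ∫ t in (0 : ℝ)..1, (1 - t) ^ n * (d ^ (n + 1) * (ρ ^ (n + 1) * Λ)) := by
    have hcont : Continuous fun t : ℝ => (1 - t) ^ n * (d ^ (n + 1) * (ρ ^ (n + 1) * Λ)) := by
      fun_prop
    rw [← Real.norm_eq_abs]
    refine intervalIntegral.norm_integral_le_of_norm_le (μ := volume) zero_le_one
      (Filter.Eventually.of_forall fun t ht => ?_)
      (hcont.intervalIntegrable (μ := volume) 0 1)
    have ht' : t ∈ Set.Icc (0 : ℝ) 1 := ⟨ht.1.le, ht.2⟩
    rw [Real.norm_eq_abs, abs_mul, abs_of_nonneg (pow_nonneg (by linarith [ht.2]) n)]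
    exact mul_le_mul_of_nonneg_left (hbd t ht') (pow_nonneg (by linarith [ht.2]) n)
  have hpow : ∫ t in (0 : ℝ)..1, (1 - t) ^ n = 1 / (n + 1) := by
    rw [intervalIntegral.integral_comp_sub_left (fun t => t ^ n)]
    simp
  rw [intervalIntegral.integral_mul_const, hpow] at hint
  have hf : (0 : ℝ) < n ! := by exact_mod_cast Nat.factorial_pos n
  rw [abs_of_pos (inv_pos.2 hf)]
  refine (mul_le_mul_of_nonneg_left hint (inv_pos.2 hf).le).trans (le_of_eq ?_)
  rw [Nat.factorial_succ]
  push_cast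
  field_simp

end Taylor

/-! ### Approximation away from the cell boundaries -/

section GoodApprox

open scoped Nat

variable {d : ℕ}

lemma pow_div_factorial_le (d : ℕ) {s : ℕ} (hs : 1 ≤ s) :
    (d : ℝ) ^ s / s ! ≤ ((s : ℝ) + 1) ^ d := by
  rcases hs.eq_or_lt with rfl | hs
  · have : (d : ℝ) ≤ 2 ^ d := by exact_mod_cast Nat.lt_two_pow_self.le
    norm_num
    exact this
  · calc (d : ℝ) ^ s / s ! ≤ Real.exp d := Real.pow_div_factorial_le_exp _ (by positivity) s
      _ = Real.exp 1 ^ d := by rw [← Real.exp_nat_mul, mul_one]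
      _ ≤ ((s : ℝ) + 1) ^ d := by
        have : (2 : ℝ) ≤ s := by exact_mod_cast hs
        exact pow_le_pow_left₀ (Real.exp_pos 1).le (by linarith [Real.exp_one_lt_three]) d

/-- A multiple of `1 / Q` in `[0, 1)` close to `v ∈ [0,1]`. -/
noncomputable def quantize (Q : ℕ) (v : ℝ) : ℕ := min ⌊Q * v⌋₊ (Q - 1)

lemma quantize_lt {Q : ℕ} (hQ : 0 < Q) (v : ℝ) : quantize Q v < Q :=
  (min_le_right _ _).trans_lt (by omega)

lemma abs_quantize_sub_le {Q : ℕ} (hQ : 0 < Q) {v : ℝ} (h0 : 0 ≤ v) (h1 : v ≤ 1) :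
    |(quantize Q v : ℝ) / Q - v| ≤ 1 / Q := by
  have hQR : (0 : ℝ) < Q := by exact_mod_cast hQ
  have e : (quantize Q v : ℝ) / Q - v = (quantize Q v - Q * v) / Q := by field_simp
  rw [e, abs_div, abs_of_pos hQR]
  gcongr
  have hf := Nat.floor_le (mul_nonneg hQR.le h0)
  have hf' := Nat.lt_floor_add_one (Q * v)
  rw [quantize]
  rcases le_total ⌊Q * v⌋₊ (Q - 1) with h | h
  · rw [min_eq_left h, abs_le]; constructor <;> linarith
  · rw [min_eq_right h]
    have : ((Q - 1 : ℕ) : ℝ) = Q - 1 := by rw [Nat.cast_sub hQ, Nat.cast_one]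
    have h' : ((Q - 1 : ℕ) : ℝ) ≤ ⌊Q * v⌋₊ := by exact_mod_cast h
    rw [this] at h' ⊢
    have : Q * v ≤ Q := by nlinarith
    rw [abs_le]; constructor <;> linarith

lemma abs_prod_sub_prod_le {ι : Type*} (is : List ι) {f f' : ι → ℝ} {ε : ℝ}
    (h : ∀ i, 0 ≤ f i ∧ f i ≤ 1 ∧ 0 ≤ f' i ∧ f' i ≤ 1 ∧ |f i - f' i| ≤ ε) :
    0 ≤ (is.map f).prod ∧ (is.map f).prod ≤ 1 ∧ 0 ≤ (is.map f').prod ∧ (is.map f').prod ≤ 1 ∧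
      |(is.map f).prod - (is.map f').prod| ≤ is.length * ε := by
  induction is with
  | nil => simp
  | cons i is ih =>
    obtain ⟨a1, a2, a3, a4, a5⟩ := ih
    obtain ⟨b1, b2, b3, b4, b5⟩ := h i
    simp only [List.map_cons, List.prod_cons, List.length_cons]
    refine ⟨mul_nonneg b1 a1, mul_le_one₀ b2 a1 a2, mul_nonneg b3 a3, mul_le_one₀ b4 a3 a4, ?_⟩
    calc |f i * (is.map f).prod - f' i * (is.map f').prod|
        = |(f i - f' i) * (is.map f).prod + f' i * ((is.map f).prod - (is.map f').prod)| := by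
          congr 1; ring
      _ ≤ |f i - f' i| * 1 + 1 * |(is.map f).prod - (is.map f').prod| := by
          refine (abs_add_le _ _).trans ?_
          rw [abs_mul, abs_mul, abs_of_nonneg a1, abs_of_nonneg b3]
          gcongr
      _ ≤ ((is.length + 1 : ℕ) : ℝ) * ε := by push_cast; linarith

/-- The list in which `i` occurs `α i` times. -/
def exponentList (α : Fin d → ℕ) : List (Fin d) :=
  (List.finRange d).flatMap fun i => List.replicate (α i) i

lemma length_exponentList (α : Fin d → ℕ) : (exponentList α).length = ∑ i, α i := by
  simp [exponentList, List.length_flatMap, List.sum_ofFn, ← List.ofFn_eq_map]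

lemma prod_exponentList (α : Fin d → ℕ) (f : Fin d → ℝ) :
    ((exponentList α).map f).prod = ∏ i, f i ^ α i := by
  simp [exponentList, List.flatMap_def, List.prod_flatten, Function.comp_def,
    ← List.ofFn_eq_map, List.prod_ofFn]

/-- Depth of the networks before the corrections near the cell boundaries. -/
def coreDepth (k s L : ℕ) : ℕ := (k + 2) + 2 * L + L * (s * (k + 2) + 2) + 2 * (s * (k + 2)) * s

/-- The point `x` has all its coordinates at distance at least `η / M` from the right boundary of
their cells in the grid of mesh size `1 / M`, except for the rightmost cells. -/
def IsGood (η : ℝ) (M : ℕ) (x : ℝ) : Prop := ∃ J t, GoodAt η M x J t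

/-- Approximation of a `C^s` function by its Taylor polynomials on the cells of a grid with
`K = n² 2^k` cells in each direction, with quantized coefficients. -/
lemma exists_avail_approx_good {n k s N L W : ℕ} (hd : 1 ≤ d) (hs : 1 ≤ s) (hn : 1 ≤ n)
    (hL : 1 ≤ L) (hnN : n ^ d ≤ N) (hkL : (2 ^ k) ^ d ≤ L * L) (hK : 2 ≤ n * (n * 2 ^ k))
    {η : ℝ} (hη : 0 < η) (hW : 4 * N + 24 + 2 * d * (n + 2) ≤ W)
    {g : (Fin d → ℝ) → ℝ} {U : Set (Fin d → ℝ)}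
    (hU : IsOpen U) (hUI : Set.Icc 0 1 ⊆ U) (hg : ContDiffOn ℝ s g U) {Λ : ℝ} (hΛ0 : 0 < Λ)
    (hΛ : ∀ k ≤ s, ∀ ι : Fin k → Fin d, ∀ x ∈ Set.Icc (0 : Fin d → ℝ) 1,
      |partialDeriv g x ι| ≤ Λ) :
    ∃ F : (Fin d → ℝ) → ℝ, Avail (2 * s ^ d * W) (coreDepth k s L) {F} ∧
      ∀ x : Fin d → ℝ, (∀ i, IsGood η (n * (n * 2 ^ k) * (n * (n * 2 ^ k)) ^ s) (x i)) →
        |F x - g x| ≤ 4 * ((s : ℝ) + 1) ^ d * Λ / ((n * (n * 2 ^ k) : ℕ) : ℝ) ^ s := by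
  set K := n * (n * 2 ^ k) with hKdef
  have hKR : (2 : ℝ) ≤ K := by exact_mod_cast hK
  have hQ : 0 < K ^ s := Nat.pow_pos (by omega)
  have hQR : (0 : ℝ) < (K : ℝ) ^ s := by positivity
  -- positive and negative parts of the coefficients, divided by `Λ`, are tabulated separately
  let sg : Bool → ℝ := fun e => if e then 1 else -1
  let cf : (Fin d → ℕ) → (Fin d → ℕ) → ℝ := fun α J =>
    taylorCoeff g s (fun i => (J i : ℝ) / K) α / Λ
  have hpiece : ∀ (α : Fin d → ℕ) (e : Bool), ∃ w : (Fin d → ℝ) → ℝ, α ∈ exponents d s →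
      Avail W (coreDepth k s L) {w} ∧
      ∀ x : Fin d → ℝ, ∀ J : Fin d → ℕ, ∀ t : Fin d → ℝ,
        (∀ i, GoodAt η (K * K ^ s) (x i) (J i) (t i)) →
        w x = (quantize (K ^ s) (max (sg e * cf α (fun i => J i / K ^ s)) 0) : ℕ) / (K : ℝ) ^ s *
          ((exponentList α).map fun i => ((J i % K ^ s : ℕ) : ℝ) / (K : ℝ) ^ s).prod := by
    intro α e
    by_cases hα : α ∈ exponents d s
    · obtain ⟨w, h1, h2⟩ := exists_avail_piece hd hn hL hnN hkL hη
        (fun J => quantize (K ^ s) (max (sg e * cf α J) 0)) (fun J => quantize_lt hQ _)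
        (exponentList α) (by
          rw [length_exponentList]; exact (Finset.mem_filter.1 hα).2.le) hW
      exact ⟨w, fun _ => ⟨h1, h2⟩⟩
    · exact ⟨0, fun h => absurd h hα⟩
  choose w hw using hpiece
  refine ⟨fun x => ∑ α ∈ exponents d s, Λ / (K : ℝ) ^ (∑ i, α i) * (w α true x - w α false x),
    ?_, ?_⟩
  · have h1 := Avail.biUnion (exponents d s ×ˢ (Finset.univ : Finset Bool))
      (S := fun p => {w p.1 p.2}) (W := W) (D := coreDepth k s L)
      fun p hp => (hw p.1 p.2 (Finset.mem_product.1 hp).1).1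
    have hcard : (exponents d s ×ˢ (Finset.univ : Finset Bool)).card * W ≤ 2 * s ^ d * W := by
      gcongr
      rw [Finset.card_product, mul_comm]
      exact Nat.mul_le_mul (by simp) (card_exponents_le d s)
    refine (h1.mono_width hcard).of_affSpan (Set.singleton_subset_iff.2 ?_)
    refine sum_mem_affSpan _ fun α hα => mul_mem_affSpan _ (sub_mem_affSpan ?_ ?_)
    · exact mem_affSpan (Set.mem_biUnion (x := (α, true)) (by simp [hα]) rfl)
    · exact mem_affSpan (Set.mem_biUnion (x := (α, false)) (by simp [hα]) rfl)
  · intro x hx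
    choose J t hJ using hx
    -- the corner of the cell of `x`, and the position of `x` relative to it
    set x0 : Fin d → ℝ := fun i => ((J i / K ^ s : ℕ) : ℝ) / K with hx0
    set y : Fin d → ℝ := fun i => ((J i % K ^ s : ℕ) + t i) / (K : ℝ) ^ s with hy
    set yb : Fin d → ℝ := fun i => ((J i % K ^ s : ℕ) : ℝ) / (K : ℝ) ^ s with hyb
    have hpos : ∀ i, 0 ≤ y i ∧ y i ≤ 1 ∧ x i = x0 i + y i / K ∧ x0 i ∈ Set.Icc (0 : ℝ) 1 ∧
        x i ∈ Set.Icc (0 : ℝ) 1 ∧ 0 ≤ yb i ∧ yb i ≤ 1 ∧ |yb i - y i| ≤ 1 / (K : ℝ) ^ s := by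
      intro i
      obtain ⟨g1, g2⟩ := (hJ i).split
      obtain ⟨a1, a2, a3, a4, -⟩ := g1
      obtain ⟨b1, b2, b3, b4, -⟩ := g2
      push_cast at a2 a3 a4
      have hlt : (((J i / K ^ s : ℕ) : ℝ)) + 1 ≤ K := by exact_mod_cast a1
      have e : y i - yb i = t i / (K : ℝ) ^ s := by simp only [y, yb]; ring
      refine ⟨a3, a4, ?_, ⟨by positivity, ?_⟩, ⟨?_, ?_⟩, by positivity, ?_, ?_⟩
      · rw [a2]; simp only [x0, y]; ring
      · rw [div_le_one (by linarith)]; linarith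
      · rw [a2]; exact div_nonneg (add_nonneg (by positivity) a3) (by linarith)
      · rw [a2, div_le_one (by linarith)]; linarith
      · rw [div_le_one hQR]; exact_mod_cast b1.le
      · rw [abs_sub_comm, e, abs_of_nonneg (by positivity)]; gcongr
    have hx0I : x0 ∈ Set.Icc (0 : Fin d → ℝ) 1 :=
      ⟨fun i => (hpos i).2.2.2.1.1, fun i => (hpos i).2.2.2.1.2⟩
    have hxI : x0 + (fun i => y i / K) ∈ Set.Icc (0 : Fin d → ℝ) 1 := by
      have : x0 + (fun i => y i / K) = x := by ext i; exact (hpos i).2.2.1.symm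
      rw [this]
      exact ⟨fun i => (hpos i).2.2.2.2.1.1, fun i => (hpos i).2.2.2.2.1.2⟩
    have hT := taylor_remainder_le hs hU hUI hg hΛ hx0I hxI (ρ := 1 / K) (by
      intro i
      obtain ⟨a1, a2, -⟩ := hpos i
      rw [abs_of_nonneg (by positivity)]; gcongr)
    rw [show x0 + (fun i => y i / K) = x from by ext i; exact (hpos i).2.2.1.symm] at hT
    have hc1 : ∀ α, |cf α (fun i => J i / K ^ s)| ≤ 1 := by
      intro α
      rw [abs_div, abs_of_pos hΛ0, div_le_one hΛ0]
      exact abs_taylorCoeff_le hΛ0.le (fun k hk ι => hΛ k hk.le ι _ hx0I) α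
    have hterm : ∀ α ∈ exponents d s, |Λ / (K : ℝ) ^ (∑ i, α i) * (w α true x - w α false x) -
        taylorCoeff g s x0 α * ∏ i, (y i / K) ^ α i| ≤ 3 * (Λ / (K : ℝ) ^ s) := by
      intro α hα
      set c := cf α (fun i => J i / K ^ s) with hc
      set a := ∑ i, α i
      have e1 : taylorCoeff g s x0 α * ∏ i, (y i / K) ^ α i =
          Λ / (K : ℝ) ^ a * (c * ∏ i, y i ^ α i) := by
        simp only [div_pow, Finset.prod_div_distrib, Finset.prod_pow_eq_pow_sum]
        simp only [hc, cf, x0]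
        field_simp
        rfl
      rw [(hw α true hα).2 x J t hJ, (hw α false hα).2 x J t hJ, e1, ← sub_mul, ← mul_sub,
        abs_mul, abs_of_pos (by positivity)]
      obtain ⟨p1, p2, p3, p4, p5⟩ := abs_prod_sub_prod_le (exponentList α) (f := yb) (f' := y)
        (ε := 1 / (K : ℝ) ^ s) fun i => by
          obtain ⟨a1, a2, -, -, -, a3, a4, a5⟩ := hpos i
          exact ⟨a3, a4, a1, a2, a5⟩
      rw [length_exponentList] at p5
      rw [← prod_exponentList]
      set P := ((exponentList α).map yb).prod
      set P' := ((exponentList α).map y).prod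
      have q1 := abs_quantize_sub_le hQ (v := max (sg true * c) 0) (le_max_right _ _)
        (max_le (by simpa [sg] using (abs_le.1 (hc1 α)).2) zero_le_one)
      have q2 := abs_quantize_sub_le hQ (v := max (sg false * c) 0) (le_max_right _ _)
        (max_le (by simpa [sg] using neg_le.1 (abs_le.1 (hc1 α)).1) zero_le_one)
      have q3 : max (sg true * c) 0 - max (sg false * c) 0 = c := by
        simp only [sg, if_true, Bool.false_eq_true, if_false, one_mul, neg_one_mul]
        rcases le_total 0 c with h | h
        · rw [max_eq_left h, max_eq_right (by linarith)]; ring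
        · rw [max_eq_right h, max_eq_left (by linarith)]; ring
      push_cast at q1 q2
      set u1 := (quantize (K ^ s) (max (sg true * c) 0) : ℝ) / (K : ℝ) ^ s
      set u2 := (quantize (K ^ s) (max (sg false * c) 0) : ℝ) / (K : ℝ) ^ s
      have hu : |u1 - u2 - c| ≤ 2 / (K : ℝ) ^ s := by
        calc |u1 - u2 - c| = |(u1 - max (sg true * c) 0) - (u2 - max (sg false * c) 0)| := by
              congr 1; linarith
          _ ≤ 1 / (K : ℝ) ^ s + 1 / (K : ℝ) ^ s := (abs_sub _ _).trans (add_le_add q1 q2)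
          _ = 2 / (K : ℝ) ^ s := by ring
      have hmain : |(u1 - u2) * P - c * P'| ≤ (2 + a) / (K : ℝ) ^ s := by
        calc |(u1 - u2) * P - c * P'| = |(u1 - u2 - c) * P + c * (P - P')| := by congr 1; ring
          _ ≤ 2 / (K : ℝ) ^ s * 1 + 1 * (a * (1 / (K : ℝ) ^ s)) := by
              refine (abs_add_le _ _).trans ?_
              rw [abs_mul, abs_mul, abs_of_nonneg p1]
              refine add_le_add (mul_le_mul hu p2 p1 (by positivity))
                (mul_le_mul (hc1 α) ?_ (abs_nonneg _) zero_le_one)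
              exact_mod_cast p5
          _ = (2 + a) / (K : ℝ) ^ s := by ring
      -- the factor `K⁻ᵃ` of the monomial absorbs the error `a / K ^ s` of its `a` factors
      have hKa : (2 + a) / (K : ℝ) ^ a ≤ 3 := by
        rw [div_le_iff₀ (by positivity)]
        have h1 : (1 : ℝ) ≤ (K : ℝ) ^ a := one_le_pow₀ (by linarith)
        have h2 : (a : ℝ) ≤ (K : ℝ) ^ a := by
          have : (a : ℝ) ≤ 2 ^ a := by exact_mod_cast Nat.lt_two_pow_self.le
          exact this.trans (pow_le_pow_left₀ (by norm_num) hKR a)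
        linarith
      calc Λ / (K : ℝ) ^ a * |(u1 - u2) * P - c * P'|
          ≤ Λ / (K : ℝ) ^ a * ((2 + a) / (K : ℝ) ^ s) := by gcongr
        _ = (2 + a) / (K : ℝ) ^ a * (Λ / (K : ℝ) ^ s) := by ring
        _ ≤ 3 * (Λ / (K : ℝ) ^ s) := by gcongr
    have hsum : |(∑ α ∈ exponents d s, Λ / (K : ℝ) ^ (∑ i, α i) * (w α true x - w α false x)) -
        ∑ α ∈ exponents d s, taylorCoeff g s x0 α * ∏ i, (y i / K) ^ α i| ≤
        ((s : ℝ) + 1) ^ d * (3 * (Λ / (K : ℝ) ^ s)) := by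
      rw [← Finset.sum_sub_distrib]
      refine (Finset.abs_sum_le_sum_abs _ _).trans
        ((Finset.sum_le_card_nsmul _ _ _ hterm).trans ?_)
      rw [nsmul_eq_mul]
      gcongr
      calc ((exponents d s).card : ℝ) ≤ (s : ℝ) ^ d := by exact_mod_cast card_exponents_le d s
        _ ≤ ((s : ℝ) + 1) ^ d := by gcongr; linarith
    have hT' : d ^ s / s ! * (1 / (K : ℝ)) ^ s * Λ ≤ ((s : ℝ) + 1) ^ d * (Λ / (K : ℝ) ^ s) := by
      calc d ^ s / s ! * (1 / (K : ℝ)) ^ s * Λ = d ^ s / s ! * (Λ / (K : ℝ) ^ s) := by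
            rw [div_pow, one_pow]; ring
        _ ≤ _ := by gcongr; exact pow_div_factorial_le d hs
    have hfin := abs_sub_le (∑ α ∈ exponents d s, Λ / (K : ℝ) ^ (∑ i, α i) *
      (w α true x - w α false x))
      (∑ α ∈ exponents d s, taylorCoeff g s x0 α * ∏ i, (y i / K) ^ α i) (g x)
    rw [abs_sub_comm (g x)] at hT
    refine hfin.trans ((add_le_add hsum (hT.trans hT')).trans (le_of_eq ?_))
    ring

end GoodApprox

/-! ### Medians of shifted networks -/

section Median

variable {d : ℕ}

/-- The median of `a`, `b`, `c`: clamp `c` to the interval with endpoints `a`, `b`. -/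
noncomputable def median (a b c : ℝ) : ℝ :=
  c - max (c - (b + max (a - b) 0)) 0 + max (a - max (a - b) 0 - c) 0

lemma abs_median_sub_le {a b c v ε : ℝ} (h : (|a - v| ≤ ε ∧ |b - v| ≤ ε) ∨
    (|a - v| ≤ ε ∧ |c - v| ≤ ε) ∨ (|b - v| ≤ ε ∧ |c - v| ≤ ε)) : |median a b c - v| ≤ ε := by
  simp only [abs_le] at h ⊢
  rw [median]
  rcases le_total (a - b) 0 with h1 | h1 <;> simp only [h1, max_eq_left, max_eq_right] <;>
  rcases le_total 0 (c - (b + 0)) with h2 | h2 <;>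
  rcases le_total 0 (c - (b + (a - b))) with h3 | h3 <;>
  rcases le_total 0 (a - 0 - c) with h4 | h4 <;>
  rcases le_total 0 (a - (a - b) - c) with h5 | h5 <;>
  simp only [h2, h3, h4, h5, max_eq_left, max_eq_right] <;>
  rcases h with ⟨h, h'⟩ | ⟨h, h'⟩ | ⟨h, h'⟩ <;> constructor <;> linarith [h.1, h.2, h'.1, h'.2]

/-- The median of three available functions costs two layers. -/
lemma Avail.median {W D : ℕ} {S : Set ((Fin d → ℝ) → ℝ)} (hW : 7 ≤ W) {a b c : (Fin d → ℝ) → ℝ}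
    (h : Avail W D S) (ha : a ∈ S) (hb : b ∈ S) (hc : c ∈ S) :
    Avail W (D + 2) {fun x => median (a x) (b x) (c x)} := by
  have h1 := h.step (T := {fun x => a x - b x}) (C := {a, b, c})
    (Set.singleton_subset_iff.2 (sub_mem_affSpan (mem_affSpan ha) (mem_affSpan hb)))
    (by
      rintro f (rfl | rfl | rfl)
      exacts [mem_affSpan ha, mem_affSpan hb, mem_affSpan hc])
    (width_le (m := 1) (n := 3) (by simp)
      (encard_insert_le' _ (encard_insert_le' _ (by simp))) hW)
  set S1 := relu '' {fun x => a x - b x} ∪ {a, b, c}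
  have hr : (fun x => max (a x - b x) 0) ∈ affSpan S1 := mem_affSpan (Or.inl ⟨_, rfl, rfl⟩)
  have ha1 : a ∈ affSpan S1 := mem_affSpan (Or.inr (Or.inl rfl))
  have hb1 : b ∈ affSpan S1 := mem_affSpan (Or.inr (Or.inr (Or.inl rfl)))
  have hc1 : c ∈ affSpan S1 := mem_affSpan (Or.inr (Or.inr (Or.inr rfl)))
  have h2 := h1.step (T := {fun x => c x - (b x + max (a x - b x) 0),
    fun x => a x - max (a x - b x) 0 - c x}) (C := {c})
    (by
      rintro f (rfl | rfl)
      · exact sub_mem_affSpan hc1 (add_mem_affSpan hb1 hr)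
      · exact sub_mem_affSpan (sub_mem_affSpan ha1 hr) hc1)
    (Set.singleton_subset_iff.2 hc1)
    (width_le (m := 2) (n := 1) (encard_insert_le' _ (by simp)) (by simp) (by omega))
  refine h2.of_affSpan (Set.singleton_subset_iff.2 ?_)
  exact add_mem_affSpan (sub_mem_affSpan (mem_affSpan (Or.inr rfl))
    (mem_affSpan (Or.inl ⟨_, Or.inl rfl, rfl⟩))) (mem_affSpan (Or.inl ⟨_, Or.inr rfl, rfl⟩))

lemma IsGood.mem_Icc {η x : ℝ} {M : ℕ} (h : IsGood η M x) : x ∈ Set.Icc (0 : ℝ) 1 := by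
  obtain ⟨J, t, hJ, rfl, h0, h1, -⟩ := h
  have hM : (0 : ℝ) < M := by exact_mod_cast (Nat.zero_le J).trans_lt hJ
  have : (J : ℝ) + 1 ≤ M := by exact_mod_cast hJ
  refine ⟨by positivity, ?_⟩
  rw [div_le_one hM]; linarith

/-- Of the three points `x - η/M`, `x`, `x + η/M` at least two are good. -/
lemma isGood_two_of_three {η x : ℝ} {M : ℕ} (hM : 0 < M) (hη : 0 < η) (hη3 : 3 * η ≤ 1)
    (hx : x ∈ Set.Icc (0 : ℝ) 1) :
    (IsGood η M (x - η / M) ∧ IsGood η M x) ∨ (IsGood η M (x - η / M) ∧ IsGood η M (x + η / M)) ∨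
      (IsGood η M x ∧ IsGood η M (x + η / M)) := by
  have hMR : (0 : ℝ) < M := by exact_mod_cast hM
  obtain ⟨J, t, hJ, hxt, h0, h1, h2⟩ : ∃ (J : ℕ) (t : ℝ), J < M ∧ x = (J + t) / M ∧ 0 ≤ t ∧ t ≤ 1 ∧
      (t < 1 ∨ J + 1 = M) := by
    rcases hx.2.eq_or_lt with rfl | hlt
    · refine ⟨M - 1, 1, by omega, ?_, zero_le_one, le_rfl, Or.inr (by omega)⟩
      rw [Nat.cast_sub hM]; field_simp; simp
    · have hMx : 0 ≤ M * x := mul_nonneg hMR.le hx.1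
      refine ⟨⌊M * x⌋₊, M * x - ⌊M * x⌋₊, ?_, by field_simp; ring, ?_, ?_, Or.inl ?_⟩
      · rw [Nat.floor_lt hMx]; nlinarith
      · linarith [Nat.floor_le hMx]
      · linarith [Nat.lt_floor_add_one (M * x)]
      · linarith [Nat.lt_floor_add_one (M * x)]
  have hm : x - η / M = (J + (t - η)) / M := by rw [hxt]; ring
  have hp : x + η / M = (J + (t + η)) / M := by rw [hxt]; ring
  have hp' : x + η / M = ((J + 1 : ℕ) + (t + η - 1)) / M := by rw [hxt]; push_cast; ring
  rcases h2 with h2 | h2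
  · by_cases c1 : t + η ≤ 1 - η
    · exact Or.inr (Or.inr ⟨⟨J, t, hJ, hxt, h0, h1, Or.inl (by linarith)⟩,
        ⟨J, t + η, hJ, hp, by linarith, by linarith, Or.inl c1⟩⟩)
    · have hgm : IsGood η M (x - η / M) := ⟨J, t - η, hJ, hm, by linarith, by linarith,
        Or.inl (by linarith)⟩
      by_cases c2 : t ≤ 1 - η
      · exact Or.inl ⟨hgm, ⟨J, t, hJ, hxt, h0, h1, Or.inl c2⟩⟩
      · by_cases c3 : J + 1 = M
        · exact Or.inl ⟨hgm, ⟨J, t, hJ, hxt, h0, h1, Or.inr c3⟩⟩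
        · exact Or.inr (Or.inl ⟨hgm, ⟨J + 1, t + η - 1, by omega, hp', by linarith, by linarith,
            Or.inl (by linarith)⟩⟩)
  · have hgx : IsGood η M x := ⟨J, t, hJ, hxt, h0, h1, Or.inr h2⟩
    by_cases c1 : t + η ≤ 1
    · exact Or.inr (Or.inr ⟨hgx, ⟨J, t + η, hJ, hp, by linarith, c1, Or.inr h2⟩⟩)
    · exact Or.inl ⟨⟨J, t - η, hJ, hm, by linarith, by linarith, Or.inr h2⟩, hgx⟩

/-- A function available with good accuracy away from the cell boundaries can be replaced by one
that is accurate everywhere on the unit cube: for one coordinate direction after the other take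
the median of three shifted copies. -/
lemma exists_avail_median {W D M : ℕ} (hW : 3 ≤ W) (hM : 0 < M) {η ε ω : ℝ} (hη : 0 < η)
    (hη3 : 3 * η ≤ 1) {g F : (Fin d → ℝ) → ℝ} (hF : Avail W D {F})
    (hg : ∀ x ∈ Set.Icc (0 : Fin d → ℝ) 1, ∀ x' ∈ Set.Icc (0 : Fin d → ℝ) 1,
      (∀ i, |x i - x' i| ≤ η / M) → |g x - g x'| ≤ ω)
    (hFg : ∀ x : Fin d → ℝ, (∀ i, IsGood η M (x i)) → |F x - g x| ≤ ε) :
    ∃ F' : (Fin d → ℝ) → ℝ, Avail (3 ^ d * W) (D + 2 * d) {F'} ∧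
      ∀ x ∈ Set.Icc (0 : Fin d → ℝ) 1, |F' x - g x| ≤ ε + d * ω := by
  have key : ∀ e ≤ d, ∃ F' : (Fin d → ℝ) → ℝ, Avail (3 ^ e * W) (D + 2 * e) {F'} ∧
      ∀ x ∈ Set.Icc (0 : Fin d → ℝ) 1, (∀ i : Fin d, e ≤ i → IsGood η M (x i)) →
        |F' x - g x| ≤ ε + e * ω := by
    intro e he
    induction e with
    | zero =>
      exact ⟨F, by simpa using hF, fun x _ hx => by simpa using hFg x fun i => hx i (Nat.zero_le _)⟩
    | succ e ih =>
      obtain ⟨F', h1, h2⟩ := ih (by omega)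
      let i₀ : Fin d := ⟨e, by omega⟩
      let τ : ℝ → (Fin d → ℝ) → Fin d → ℝ := fun c x => Function.update x i₀ (x i₀ + c)
      have hτ : ∀ c i, (fun x => τ c x i) ∈ affSpan (coords d) := by
        intro c i
        by_cases hi : i = i₀
        · subst hi
          simp only [τ, Function.update_self]
          exact add_mem_affSpan (mem_affSpan ⟨_, rfl⟩) (const_mem_affSpan c)
        · simp only [τ, Function.update_of_ne hi]
          exact mem_affSpan ⟨_, rfl⟩
      have h3 := ((h1.comp (τ (-(η / M))) (hτ _)).union (h1.comp (τ 0) (hτ _))).union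
        (h1.comp (τ (η / M)) (hτ _))
      have hpow : 3 ^ e * W + 3 ^ e * W + 3 ^ e * W = 3 ^ (e + 1) * W := by ring
      have h3e : 1 ≤ 3 ^ e := Nat.one_le_pow _ _ (by norm_num)
      rw [hpow] at h3
      refine ⟨fun x => median (F' (τ (-(η / M)) x)) (F' (τ 0 x)) (F' (τ (η / M) x)),
        h3.median (by rw [← hpow]; nlinarith) (Or.inl (Or.inl ⟨F', rfl, rfl⟩))
          (Or.inl (Or.inr ⟨F', rfl, rfl⟩)) (Or.inr ⟨F', rfl, rfl⟩), fun x hx hgood => ?_⟩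
      have hMR : (0 : ℝ) < M := by exact_mod_cast hM
      have hstep : ∀ c : ℝ, |c| ≤ η / M → IsGood η M (x i₀ + c) →
          |F' (τ c x) - g x| ≤ ε + (e + 1 : ℕ) * ω := by
        intro c hc hgc
        have hmem : τ c x ∈ Set.Icc (0 : Fin d → ℝ) 1 := by
          have : ∀ i, τ c x i ∈ Set.Icc (0 : ℝ) 1 := by
            intro i
            by_cases hi : i = i₀
            · subst hi; simpa [τ] using hgc.mem_Icc
            · simp only [τ, Function.update_of_ne hi]; exact ⟨hx.1 i, hx.2 i⟩
          exact ⟨fun i => (this i).1, fun i => (this i).2⟩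
        have h4 := h2 _ hmem fun i hi => by
          by_cases hii : i = i₀
          · subst hii; simpa [τ] using hgc
          · simp only [τ, Function.update_of_ne hii]
            refine hgood i ?_
            have : (i : ℕ) ≠ e := fun h => hii (Fin.ext h)
            omega
        have h5 := hg _ hmem x hx fun i => by
          by_cases hii : i = i₀
          · subst hii; simpa [τ] using hc
          · simp only [τ, Function.update_of_ne hii, sub_self, abs_zero]; positivity
        have := abs_sub_le (F' (τ c x)) (g (τ c x)) (g x)
        push_cast
        linarith
      have a0 : |(0 : ℝ)| ≤ η / M := by rw [abs_zero]; positivity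
      have ap : |η / M| ≤ η / M := (abs_of_pos (by positivity)).le
      have am : |-(η / M)| ≤ η / M := by rw [abs_neg]; exact ap
      apply abs_median_sub_le
      rcases isGood_two_of_three hM hη hη3 ⟨hx.1 i₀, hx.2 i₀⟩ with ⟨b1, b2⟩ | ⟨b1, b2⟩ | ⟨b1, b2⟩
      · exact Or.inl ⟨hstep _ am (by rwa [← sub_eq_add_neg]), hstep _ a0 (by rwa [add_zero])⟩
      · exact Or.inr (Or.inl ⟨hstep _ am (by rwa [← sub_eq_add_neg]), hstep _ ap b2⟩)
      · exact Or.inr (Or.inr ⟨hstep _ a0 (by rwa [add_zero]), hstep _ ap b2⟩)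
  obtain ⟨F', h1, h2⟩ := key d le_rfl
  exact ⟨F', h1, fun x hx => h2 x hx fun i hi => absurd i.2 (by omega)⟩

end Median

/-! ### Approximation of smooth functions by networks of given width and depth -/

section Approx

variable {d : ℕ}

lemma avail_zero (W D : ℕ) : Avail W D {(0 : (Fin d → ℝ) → ℝ)} :=
  Avail.empty.of_affSpan (Set.singleton_subset_iff.2 (Submodule.zero_mem _))

/-- Approximation of a `C^s` function on the unit cube, in terms of the grid parameters. -/
lemma exists_avail_approx {n k s N L W : ℕ} (hd : 1 ≤ d) (hs : 1 ≤ s) (hn : 1 ≤ n)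
    (hL : 1 ≤ L) (hnN : n ^ d ≤ N) (hkL : (2 ^ k) ^ d ≤ L * L)
    (hW : 4 * N + 24 + 2 * d * (n + 2) ≤ W)
    {g : (Fin d → ℝ) → ℝ} {U : Set (Fin d → ℝ)}
    (hU : IsOpen U) (hUI : Set.Icc 0 1 ⊆ U) (hg : ContDiffOn ℝ s g U) {Λ : ℝ}
    (hΛ : ∀ k ≤ s, ∀ ι : Fin k → Fin d, ∀ x ∈ Set.Icc (0 : Fin d → ℝ) 1,
      |partialDeriv g x ι| ≤ Λ) :
    ∃ F : (Fin d → ℝ) → ℝ, Avail (3 ^ d * (2 * s ^ d * W)) (coreDepth k s L + 2 * d) {F} ∧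
      ∀ x ∈ Set.Icc (0 : Fin d → ℝ) 1,
        |F x - g x| ≤ 5 * ((s : ℝ) + 1) ^ d * Λ / ((n * (n * 2 ^ k) : ℕ) : ℝ) ^ s := by
  set K := n * (n * 2 ^ k) with hKdef
  have hK1 : 1 ≤ K := Nat.mul_pos hn (Nat.mul_pos hn (by positivity))
  have hg0 : ∀ x ∈ Set.Icc (0 : Fin d → ℝ) 1, |g x| ≤ Λ := fun x hx => by
    simpa [partialDeriv] using hΛ 0 (Nat.zero_le _) Fin.elim0 x hx
  have hΛ0 : 0 ≤ Λ := (abs_nonneg _).trans (hg0 0 ⟨le_rfl, zero_le_one⟩)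
  have hsd : (1 : ℝ) ≤ ((s : ℝ) + 1) ^ d := one_le_pow₀ (by linarith [s.cast_nonneg (α := ℝ)])
  -- if `Λ = 0` or there is only one cell, the zero function is accurate enough
  by_cases hK : 2 ≤ K ∧ 0 < Λ
  · obtain ⟨hK, hΛ0⟩ := hK
    have hKs : 0 < K * K ^ s := by positivity
    have hMR : (1 : ℝ) ≤ (K * K ^ s : ℕ) := by exact_mod_cast hKs
    have hKR : (0 : ℝ) < (K : ℝ) ^ s := by positivity
    have hdR : (0 : ℝ) < d := by exact_mod_cast hd
    -- the shifts are so small that they change `g` by at most `Λ / (d K ^ s)`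
    have huc : UniformContinuousOn g (Set.Icc 0 1) :=
      isCompact_Icc.uniformContinuousOn_of_continuous (hg.continuousOn.mono hUI)
    obtain ⟨δ, hδ, hδg⟩ := Metric.uniformContinuousOn_iff.1 huc (Λ / (K : ℝ) ^ s / d) (by positivity)
    have hη : 0 < min (δ / 2) (1 / 3) := by positivity
    obtain ⟨F, h1, h2⟩ := exists_avail_approx_good hd hs hn hL hnN hkL hK hη hW hU hUI hg hΛ0 hΛ
    have hsW : 3 ≤ 2 * s ^ d * W := by
      have : 1 ≤ s ^ d := Nat.one_le_pow _ _ hs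
      nlinarith
    obtain ⟨F', h3, h4⟩ := exists_avail_median (g := g) (ω := Λ / (K : ℝ) ^ s / d) hsW hKs hη
      (by linarith [min_le_right (δ / 2) (1 / 3)]) h1 (fun x hx x' hx' hxx => by
        refine (hδg x hx x' hx' ((dist_pi_le_iff (by positivity)).2 hxx |>.trans_lt ?_)).le
        calc min (δ / 2) (1 / 3) / (K * K ^ s : ℕ) ≤ min (δ / 2) (1 / 3) := div_le_self hη.le hMR
          _ ≤ δ / 2 := min_le_left _ _
          _ < δ := by linarith) h2
    refine ⟨F', h3, fun x hx => (h4 x hx).trans ?_⟩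
    rw [mul_div_cancel₀ _ hdR.ne', ← add_div]
    gcongr
    nlinarith
  · refine ⟨0, avail_zero _ _, fun x hx => ?_⟩
    have h1 := hg0 x hx
    rw [Pi.zero_apply, zero_sub, abs_neg]
    rcases hΛ0.eq_or_lt with h | h
    · rw [← h] at h1 ⊢; simpa using h1
    · have : K = 1 := by
        have : ¬ 2 ≤ K := fun h' => hK ⟨h', h⟩
        omega
      rw [this]
      simp only [Nat.cast_one, one_pow, div_one]
      nlinarith

/-- Grid parameters adapted to the width parameter `N` and the depth parameter `L`. -/
lemma exists_grid {N L : ℕ} (hd : 1 ≤ d) (hN : 1 ≤ N) (hL : 1 ≤ L) :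
    ∃ n k : ℕ, 1 ≤ n ∧ n ≤ N ∧ n ^ d ≤ N ∧ (2 ^ k) ^ d ≤ L * L ∧ (k : ℝ) ≤ 2 * Real.logb 2 L ∧
      ∀ s : ℕ, 1 / ((n * (n * 2 ^ k) : ℕ) : ℝ) ^ s ≤
        8 ^ s * ((N : ℝ) ^ (-(2 * s : ℝ) / d) * (L : ℝ) ^ (-(2 * s : ℝ) / d)) := by
  have hdR : (1 : ℝ) ≤ d := by exact_mod_cast hd
  have hd0 : (d : ℝ) ≠ 0 := by positivity
  have hNR : (1 : ℝ) ≤ N := by exact_mod_cast hN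
  have hLR : (1 : ℝ) ≤ L := by exact_mod_cast hL
  have hN1 : (1 : ℝ) ≤ (N : ℝ) ^ (1 / d : ℝ) := Real.one_le_rpow hNR (by positivity)
  have hL1 : (1 : ℝ) ≤ (L : ℝ) ^ (2 / d : ℝ) := Real.one_le_rpow hLR (by positivity)
  -- `n = ⌊N^(1/d)⌋` and `2 ^ k ≤ L^(2/d) < 2 ^ (k + 1)`, so that `n² 2^k ≥ N^(2/d) L^(2/d) / 8`
  set n := ⌊(N : ℝ) ^ (1 / d : ℝ)⌋₊ with hn
  have hn1 : 1 ≤ n := Nat.le_floor (by simpa using hN1)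
  have hnle : (n : ℝ) ≤ (N : ℝ) ^ (1 / d : ℝ) := Nat.floor_le (by positivity)
  have hngt : (N : ℝ) ^ (1 / d : ℝ) < n + 1 := Nat.lt_floor_add_one _
  obtain ⟨k, hk1, hk2⟩ := exists_nat_pow_near hL1 (one_lt_two)
  have hnd : n ^ d ≤ N := by
    have : (n : ℝ) ^ d ≤ N := by
      calc (n : ℝ) ^ d ≤ ((N : ℝ) ^ (1 / d : ℝ)) ^ d := by gcongr
        _ = N := by
          rw [← Real.rpow_natCast, ← Real.rpow_mul (by positivity), one_div_mul_cancel hd0,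
            Real.rpow_one]
    exact_mod_cast this
  have hkd : (2 ^ k) ^ d ≤ L * L := by
    have : ((2 : ℝ) ^ k) ^ d ≤ L * L := by
      calc ((2 : ℝ) ^ k) ^ d ≤ ((L : ℝ) ^ (2 / d : ℝ)) ^ d := by gcongr
        _ = L * L := by
          rw [← Real.rpow_natCast, ← Real.rpow_mul (by positivity), div_mul_cancel₀ _ hd0]
          norm_num [sq]
    exact_mod_cast this
  refine ⟨n, k, hn1, (Nat.le_self_pow (by omega) n).trans hnd, hnd, hkd, ?_, fun s => ?_⟩
  · have h1 : Real.logb 2 ((2 : ℝ) ^ k) ≤ Real.logb 2 ((L : ℝ) ^ (2 / d : ℝ)) :=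
      Real.logb_le_logb_of_le one_lt_two (by positivity) hk1
    rw [← Real.rpow_natCast, Real.logb_rpow (by norm_num) (by norm_num),
      Real.logb_rpow_eq_mul_logb_of_pos (by positivity)] at h1
    refine h1.trans ?_
    have : 0 ≤ Real.logb 2 L := Real.logb_nonneg one_lt_two hLR
    gcongr
    exact div_le_self (by norm_num) hdR
  · have hK : (N : ℝ) ^ (2 / d : ℝ) * (L : ℝ) ^ (2 / d : ℝ) / 8 ≤ ((n * (n * 2 ^ k) : ℕ) : ℝ) := by
      have h2 : (N : ℝ) ^ (1 / d : ℝ) ≤ 2 * n := by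
        have : (1 : ℝ) ≤ n := by exact_mod_cast hn1
        linarith
      have h3 : (N : ℝ) ^ (2 / d : ℝ) = (N : ℝ) ^ (1 / d : ℝ) * (N : ℝ) ^ (1 / d : ℝ) := by
        rw [← Real.rpow_add (by positivity)]; congr 1; ring
      push_cast
      rw [h3]
      rw [pow_succ] at hk2
      calc (N : ℝ) ^ (1 / d : ℝ) * (N : ℝ) ^ (1 / d : ℝ) * (L : ℝ) ^ (2 / d : ℝ) / 8
          ≤ 2 * n * (2 * n) * (2 ^ k * 2) / 8 := by gcongr
        _ = n * (n * 2 ^ k) := by ring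
    have hpos : 0 < (N : ℝ) ^ (2 / d : ℝ) * (L : ℝ) ^ (2 / d : ℝ) / 8 := by positivity
    calc 1 / ((n * (n * 2 ^ k) : ℕ) : ℝ) ^ s
        ≤ 1 / ((N : ℝ) ^ (2 / d : ℝ) * (L : ℝ) ^ (2 / d : ℝ) / 8) ^ s := by gcongr
      _ = 8 ^ s * (((N : ℝ) ^ (2 / d : ℝ)) ^ s)⁻¹ * (((L : ℝ) ^ (2 / d : ℝ)) ^ s)⁻¹ := by
        rw [div_pow, mul_pow]; field_simp
      _ = 8 ^ s * ((N : ℝ) ^ (-(2 * s : ℝ) / d) * (L : ℝ) ^ (-(2 * s : ℝ) / d)) := by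
        have : ∀ x : ℝ, 0 < x → ((x ^ (2 / d : ℝ)) ^ s)⁻¹ = x ^ (-(2 * s : ℝ) / d) := by
          intro x hx
          rw [← Real.rpow_natCast, ← Real.rpow_mul hx.le, ← Real.rpow_neg hx.le]
          congr 1; ring
        rw [this _ (by positivity), this _ (by positivity)]; ring

/-- Simultaneous approximation of `m` smooth functions on the unit cube. -/
theorem exists_net_approx {s N L m : ℕ} (hd : 1 ≤ d) (hs : 1 ≤ s) (hN : 1 ≤ N) (hL : 1 ≤ L)
    {Λ : ℝ} {g : Fin m → (Fin d → ℝ) → ℝ}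
    (hg : ∀ j, ∃ U, IsOpen U ∧ Set.Icc 0 1 ⊆ U ∧ ContDiffOn ℝ s (g j) U)
    (hΛ : ∀ j, ∀ k ≤ s, ∀ ι : Fin k → Fin d, ∀ x ∈ Set.Icc (0 : Fin d → ℝ) 1,
      |partialDeriv (g j) x ι| ≤ Λ) :
    ∃ a : ReLUNet d m,
      (a.width : ℝ) ≤ m * (17 * (s : ℝ) ^ (d + 1) * 3 ^ d * d * (N + 2) * Real.logb 2 (8 * N)) ∧
      (a.depth : ℝ) ≤ 18 * (s : ℝ) ^ 2 * (L + 2) * Real.logb 2 (4 * L) + 2 * d ∧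
      ∀ j, ∀ x ∈ Set.Icc (0 : Fin d → ℝ) 1, |a.eval x j - g j x| ≤
        85 * (((s : ℝ) + 1) ^ d * 8 ^ s * Λ *
          ((N : ℝ) ^ (-(2 * s : ℝ) / d) * (L : ℝ) ^ (-(2 * s : ℝ) / d))) := by
  obtain ⟨n, k, hn1, hnN', hnN, hkL, hk, hrate⟩ := exists_grid hd hN hL
  choose U hU hUI hgU using hg
  choose F hF1 hF2 using fun j => exists_avail_approx hd hs hn1 hL hnN hkL le_rfl (hU j) (hUI j)
    (hgU j) (hΛ j)
  have h1 := Avail.biUnion Finset.univ fun j (_ : j ∈ Finset.univ) => hF1 j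
  obtain ⟨a, hw, hdep, ha⟩ := h1.exists_net F fun j => Set.mem_biUnion (Finset.mem_univ j) rfl
  have hdR : (1 : ℝ) ≤ d := by exact_mod_cast hd
  have hsR : (1 : ℝ) ≤ s := by exact_mod_cast hs
  have hNR : (1 : ℝ) ≤ N := by exact_mod_cast hN
  have hLR : (1 : ℝ) ≤ L := by exact_mod_cast hL
  refine ⟨a, ?_, ?_, fun j x hx => ?_⟩
  · have hlog : 3 ≤ Real.logb 2 (8 * N) := by
      rw [Real.le_logb_iff_rpow_le one_lt_two (by positivity)]
      norm_num
      exact hN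
    have hnR : (n : ℝ) ≤ N := by exact_mod_cast hnN'
    have hwR : (a.width : ℝ) ≤
        m * (3 ^ d * (2 * s ^ d * (4 * N + 24 + 2 * d * (n + 2)))) := by
      have : a.width ≤ m * (3 ^ d * (2 * s ^ d * (4 * N + 24 + 2 * d * (n + 2)))) := by
        simpa using hw
      exact_mod_cast this
    refine hwR.trans ?_
    gcongr (m : ℝ) * ?_
    have e1 : 2 * (4 * N + 24 + 2 * d * (n + 2) : ℝ) ≤ 17 * s * d * (N + 2) * 3 := by
      have h2 : (4 * N + 24 + 2 * d * (n + 2) : ℝ) ≤ d * (6 * N + 28) := by nlinarith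
      have h3 : 17 * 1 * d * (N + 2) * 3 ≤ 17 * s * d * (N + 2) * (3 : ℝ) := by gcongr
      nlinarith
    calc (3 : ℝ) ^ d * (2 * s ^ d * (4 * N + 24 + 2 * d * (n + 2)))
        = 3 ^ d * s ^ d * (2 * (4 * N + 24 + 2 * d * (n + 2))) := by ring
      _ ≤ 3 ^ d * s ^ d * (17 * s * d * (N + 2) * 3) := by gcongr
      _ = 17 * (s : ℝ) ^ (d + 1) * 3 ^ d * d * (N + 2) * 3 := by ring
      _ ≤ _ := by gcongr
  · have hlog : Real.logb 2 (4 * L) = 2 + Real.logb 2 L := by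
      rw [Real.logb_mul (by norm_num) (by positivity)]
      congr 1
      rw [show (4 : ℝ) = 2 ^ (2 : ℝ) by norm_num, Real.logb_rpow (by norm_num) (by norm_num)]
    have hl0 : 0 ≤ Real.logb 2 L := Real.logb_nonneg one_lt_two hLR
    set l := Real.logb 2 L
    rw [hdep, hlog, coreDepth]
    push_cast
    have hk2 : (k : ℝ) + 2 ≤ 2 * (1 + l) := by linarith
    have hs2 : (s : ℝ) ≤ s ^ 2 := by nlinarith
    have hs1 : (1 : ℝ) ≤ s ^ 2 := hsR.trans hs2
    have e1 : (L : ℝ) * (s * (k + 2) + 2) ≤ s ^ 2 * (L * (2 * (1 + l) + 2)) := by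
      have : (s : ℝ) * (k + 2) + 2 ≤ s ^ 2 * (2 * (1 + l) + 2) := by
        have h2 : (s : ℝ) * (k + 2) ≤ s ^ 2 * (2 * (1 + l)) := by gcongr
        nlinarith
      nlinarith
    have e2 : 2 * ((s : ℝ) * (k + 2)) * s ≤ s ^ 2 * (4 * (1 + l)) := by nlinarith
    have e3 : (k : ℝ) + 2 + 2 * L ≤ s ^ 2 * (2 * (1 + l) + 2 * L) :=
      (by linarith : (k : ℝ) + 2 + 2 * L ≤ 2 * (1 + l) + 2 * L).trans
        (le_mul_of_one_le_left (by positivity) hs1)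
    have e4 : (s : ℝ) ^ 2 * (2 * (1 + l) + 2 * L) + s ^ 2 * (L * (2 * (1 + l) + 2)) +
        s ^ 2 * (4 * (1 + l)) ≤ 18 * (s : ℝ) ^ 2 * (L + 2) * (2 + l) := by
      have : (2 * (1 + l) + 2 * L) + (L * (2 * (1 + l) + 2)) + (4 * (1 + l)) ≤
          18 * (L + 2) * (2 + l) := by nlinarith
      nlinarith [mul_le_mul_of_nonneg_left this (sq_nonneg (s : ℝ))]
    linarith
  · rw [ha]
    refine (hF2 j x hx).trans ?_
    have hΛ0 : 0 ≤ Λ := (abs_nonneg _).trans (hΛ j 0 (Nat.zero_le _) Fin.elim0 x hx)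
    calc 5 * ((s : ℝ) + 1) ^ d * Λ / ((n * (n * 2 ^ k) : ℕ) : ℝ) ^ s
        = 5 * (((s : ℝ) + 1) ^ d * Λ) * (1 / ((n * (n * 2 ^ k) : ℕ) : ℝ) ^ s) := by ring
      _ ≤ 85 * (((s : ℝ) + 1) ^ d * Λ) *
          (8 ^ s * ((N : ℝ) ^ (-(2 * s : ℝ) / d) * (L : ℝ) ^ (-(2 * s : ℝ) / d))) := by
        gcongr
        · norm_num
        · exact hrate s
      _ = _ := by ring

end Approx

/-- A finite supremum of `C^s` norms bounds all partial derivatives of order at most `s`. -/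
lemma abs_partialDeriv_le_lamMax {d m s : ℕ} {lo : Fin d → ℝ} {len : ℝ}
    {Lam : Fin m → (Fin d → ℝ) → ℝ} (hfin : lamMax s lo len Lam ≠ ∞) (j : Fin m) {k : ℕ}
    (hk : k ≤ s) (ι : Fin k → Fin d) {x : Fin d → ℝ} (hx : x ∈ Set.Icc (0 : Fin d → ℝ) 1) :
    |partialDeriv (fun u => Lam j (lo + len • u)) x ι| ≤ (lamMax s lo len Lam).toReal := by
  rw [← Real.norm_eq_abs, ← toReal_enorm]
  refine ENNReal.toReal_mono hfin (le_trans ?_ (le_iSup _ j))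
  exact le_iSup_of_le k <| le_iSup_of_le hk <| le_iSup_of_le ι <|
    le_iSup₂_of_le x hx le_rfl

/-- Networks of the prescribed size that approximate the log-odds on `K`. -/
theorem exists_accurate_net {D d : ℕ} {r : ℝ} {P : PartitionData D r}
    {f : (Fin d → ℝ) → Vec D → ℝ} {K : Set (Fin d → ℝ)} {s : ℕ} {lo : Fin d → ℝ} {len : ℝ}
    {Lam : (n : ℕ) → Fin (P.size n) → (Fin d → ℝ) → ℝ} (hd : 1 ≤ d) (hs : 1 ≤ s)
    (h : SmoothLogOdds P f K s lo len Lam) (n : ℕ) {N L : ℕ} (hN : 1 ≤ N) (hL : 1 ≤ L) :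
    ∃ a : ReLUNet d (P.size n),
      (a.width : ℝ) ≤ P.size n * (17 * (s : ℝ) ^ (d + 1) * 3 ^ d * d *
        (N + 2) * Real.logb 2 (8 * N)) ∧
      (a.depth : ℝ) ≤ 18 * (s : ℝ) ^ 2 * (L + 2) * Real.logb 2 (4 * L) + 2 * d ∧
      logitError P f K n a ≤ 85 * logitRate s d N L (lamMax s lo len (Lam n)) := by
  have hNR : (1 : ℝ) ≤ N := by exact_mod_cast hN
  have hLR : (1 : ℝ) ≤ L := by exact_mod_cast hL
  -- an infinite `C^s` norm makes the accuracy condition void: any network of the right size does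
  by_cases hfin : lamMax s lo len (Lam n) = ∞
  · obtain ⟨a, h1, h2, -⟩ := exists_net_approx (m := P.size n) hd hs hN hL (Λ := 0) (g := 0)
      (fun j => ⟨Set.univ, isOpen_univ, Set.subset_univ _, contDiffOn_const⟩)
      (fun j k _ ι x _ => by
        have : iteratedFDeriv ℝ k (0 : (Fin d → ℝ) → ℝ) = 0 := iteratedFDeriv_fun_zero
        simp [partialDeriv, this])
    refine ⟨a, h1, h2, le_of_le_of_eq le_top ?_⟩
    have e1 : ENNReal.ofReal ((s + 1 : ℝ) ^ d * 8 ^ s) ≠ 0 := by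
      rw [Ne, ENNReal.ofReal_eq_zero, not_le]; positivity
    have e2 : ENNReal.ofReal ((N : ℝ) ^ (-(2 * s : ℝ) / d) * (L : ℝ) ^ (-(2 * s : ℝ) / d)) ≠ 0 := by
      rw [Ne, ENNReal.ofReal_eq_zero, not_le]; positivity
    rw [logitRate, hfin, ENNReal.mul_top e1, ENNReal.top_mul e2, ENNReal.mul_top (by norm_num)]
  have hlen := h.len_pos
  have hmaps : ∀ u ∈ Set.Icc (0 : Fin d → ℝ) 1, lo + len • u ∈ featureCube lo len := by
    rintro u ⟨hu0, hu1⟩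
    refine ⟨fun i => ?_, fun i => ?_⟩
    · have := mul_nonneg hlen.le (hu0 i); simpa using this
    · have := mul_le_mul_of_nonneg_left (hu1 i) hlen.le; simpa using this
  obtain ⟨a, h1, h2, h3⟩ := exists_net_approx (m := P.size n) hd hs hN hL
    (g := fun j u => Lam n j (lo + len • u)) (Λ := (lamMax s lo len (Lam n)).toReal)
    (fun j => by
      obtain ⟨U, hU, hcU, hsm⟩ := h.smooth n j
      have hc : ContDiff ℝ s fun u : Fin d → ℝ => lo + len • u := by fun_prop
      exact ⟨(fun u => lo + len • u) ⁻¹' U, hU.preimage hc.continuous,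
        fun u hu => hcU (hmaps u hu), hsm.comp hc.contDiffOn fun u hu => hu⟩)
    (fun j k hk ι x hx => abs_partialDeriv_le_lamMax hfin j hk ι hx)
  obtain ⟨a', w, dep, ev⟩ := a.exists_precomp (len⁻¹ • (1 : Matrix (Fin d) (Fin d) ℝ))
    (-(len⁻¹ • lo))
  refine ⟨a', w ▸ h1, dep ▸ h2, iSup_le fun j => iSup₂_le fun z hz => ?_⟩
  have hzc := h.subset_cube hz
  set u : Fin d → ℝ := len⁻¹ • (z - lo) with hu
  have hzu : lo + len • u = z := by rw [hu, smul_inv_smul₀ hlen.ne']; abel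
  have hu01 : u ∈ Set.Icc (0 : Fin d → ℝ) 1 := by
    refine ⟨fun i => ?_, fun i => ?_⟩
    · have := hzc.1 i
      simp only [hu, Pi.smul_apply, Pi.sub_apply, smul_eq_mul, Pi.zero_apply]
      exact mul_nonneg (by positivity) (by linarith)
    · have := hzc.2 i
      simp only [hu, Pi.smul_apply, Pi.sub_apply, smul_eq_mul, Pi.one_apply]
      rw [inv_mul_le_iff₀ hlen]; linarith
  have hev : a'.eval z = a.eval u := by
    rw [ev]; congr 1; ext i
    simp [hu, Matrix.smul_mulVec]; ring
  rw [hev, ← h.eqOn n j hz]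
  have := h3 j u hu01
  rw [hzu] at this
  rw [← ofReal_norm, Real.norm_eq_abs]
  refine (ENNReal.ofReal_le_ofReal this).trans (le_of_eq ?_)
  rw [logitRate, ENNReal.ofReal_mul (by norm_num), ENNReal.ofReal_mul (by positivity),
    ENNReal.ofReal_mul (by positivity), ENNReal.ofReal_toReal hfin]
  simp

/-! ### Kullback-Leibler divergences of kernels and of densities -/

/-- The averaged divergence between two kernels is the divergence of the joint laws. -/
lemma lintegral_klDiv_eq {A B : Type*} [MeasurableSpace A] [MeasurableSpace B]
    [MeasurableSpace.CountablyGenerated B] (P : Measure A) [IsFiniteMeasure P]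
    (κ η : Kernel A B) [IsFiniteKernel κ] [IsFiniteKernel η] :
    ∫⁻ c, klDiv (κ c) (η c) ∂P = klDiv (P ⊗ₘ κ) (P ⊗ₘ η) := by
  by_cases hac : ∀ᵐ c ∂P, κ c ≪ η c
  · have hac' : P ⊗ₘ κ ≪ P ⊗ₘ η := Measure.AbsolutelyContinuous.compProd_right hac
    have hm : Measurable (Function.uncurry (κ.rnDeriv η)) := Kernel.measurable_rnDeriv κ η
    have hκ : P ⊗ₘ κ = (P ⊗ₘ η).withDensity fun p => κ.rnDeriv η p.1 p.2 := by
      rw [← Measure.compProd_withDensity hm]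
      refine Measure.compProd_congr ?_
      filter_upwards [hac] with c hc using (Kernel.withDensity_rnDeriv_eq hc).symm
    have hrn : (P ⊗ₘ κ).rnDeriv (P ⊗ₘ η) =ᵐ[P ⊗ₘ η] fun p => κ.rnDeriv η p.1 p.2 := by
      conv_lhs => rw [hκ]
      exact Measure.rnDeriv_withDensity _ hm
    rw [klDiv_eq_lintegral_klFun_of_ac hac',
      lintegral_congr_ae (hrn.mono fun p hp => by rw [hp]),
      Measure.lintegral_compProd (by fun_prop)]
    refine lintegral_congr_ae ?_
    filter_upwards [hac] with c hc
    rw [klDiv_eq_lintegral_klFun_of_ac hc]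
    refine lintegral_congr_ae ?_
    filter_upwards [Kernel.rnDeriv_eq_rnDeriv_measure (κ := κ) (η := η) (a := c)] with y hy
    rw [hy]
  · rw [klDiv_of_not_ac fun h => hac h.kernel_of_compProd]
    have hms := Kernel.measurableSet_absolutelyContinuous κ η
    replace hac : P {c | κ c ≪ η c}ᶜ ≠ 0 := by rwa [ae_iff] at hac
    rw [eq_top_iff]
    calc ∞ = ∫⁻ c in {c | κ c ≪ η c}ᶜ, ∞ ∂P := by
          rw [setLIntegral_const, ENNReal.top_mul hac]
      _ = ∫⁻ c in {c | κ c ≪ η c}ᶜ, klDiv (κ c) (η c) ∂P :=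
          setLIntegral_congr_fun hms.compl fun c hc => (klDiv_of_not_ac hc).symm
      _ ≤ _ := setLIntegral_le_lintegral _ _

/-- The divergence of probability laws is at most the integral of the positive part of the
log-likelihood ratio. -/
lemma klDiv_withDensity_le {A : Type*} [MeasurableSpace A] (ν : Measure A)
    [IsProbabilityMeasure ν] {g : A → ℝ} (hg : Measurable g) (hg0 : ∀ x, 0 ≤ g x)
    [IsProbabilityMeasure (ν.withDensity fun x => ENNReal.ofReal (g x))] :
    klDiv (ν.withDensity fun x => ENNReal.ofReal (g x)) ν ≤
      ∫⁻ x, ENNReal.ofReal (Real.log (g x)) ∂(ν.withDensity fun x => ENNReal.ofReal (g x)) := by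
  have hint : ∫⁻ x, ENNReal.ofReal (g x) ∂ν = 1 := by
    rw [← setLIntegral_univ, ← withDensity_apply _ MeasurableSet.univ]
    exact measure_univ
  rw [klDiv_eq_lintegral_klFun_of_ac (withDensity_absolutelyContinuous _ _),
    lintegral_withDensity_eq_lintegral_mul _ (by fun_prop) (by fun_prop),
    lintegral_congr_ae (g := fun x => ENNReal.ofReal (klFun (g x)))]
  · rw [← ENNReal.add_le_add_iff_right (a := 1) (by simp)]
    calc ∫⁻ x, ENNReal.ofReal (klFun (g x)) ∂ν + 1
        = ∫⁻ x, (ENNReal.ofReal (klFun (g x)) + ENNReal.ofReal (g x)) ∂ν := by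
          rw [lintegral_add_right _ (by fun_prop), hint]
      _ ≤ ∫⁻ x, (ENNReal.ofReal (g x) * ENNReal.ofReal (Real.log (g x)) + 1) ∂ν := by
          refine lintegral_mono fun x => ?_
          rw [← ENNReal.ofReal_add (klFun_nonneg (hg0 x)) (hg0 x), ← ENNReal.ofReal_mul (hg0 x),
            klFun_apply]
          refine (ENNReal.ofReal_le_ofReal (by linarith)).trans
            (ENNReal.ofReal_add_le (p := g x * Real.log (g x)) (q := 1) |>.trans (by simp))
      _ = _ := by rw [lintegral_add_right _ (by fun_prop)]; simp
  · filter_upwards [Measure.rnDeriv_withDensity ν (f := fun x => ENNReal.ofReal (g x))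
      (by fun_prop)] with x hx
    rw [hx, ENNReal.toReal_ofReal (hg0 x)]

/-- `klDiv_withDensity_le` for two densities with respect to a common measure. -/
lemma klDiv_withDensity_withDensity_le {A : Type*} [MeasurableSpace A] (μ : Measure A)
    {f p : A → ℝ} (hf : Measurable f) (hf0 : ∀ x, 0 ≤ f x) (hp : Measurable p)
    (hp0 : ∀ x, 0 < p x)
    [IsProbabilityMeasure (μ.withDensity fun x => ENNReal.ofReal (f x))]
    [IsProbabilityMeasure (μ.withDensity fun x => ENNReal.ofReal (p x))] :
    klDiv (μ.withDensity fun x => ENNReal.ofReal (f x))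
        (μ.withDensity fun x => ENNReal.ofReal (p x)) ≤
      ∫⁻ x, ENNReal.ofReal (Real.log (f x / p x))
        ∂(μ.withDensity fun x => ENNReal.ofReal (f x)) := by
  have h : μ.withDensity (fun x => ENNReal.ofReal (f x)) =
      (μ.withDensity fun x => ENNReal.ofReal (p x)).withDensity
        fun x => ENNReal.ofReal (f x / p x) := by
    rw [← withDensity_mul _ (by fun_prop) (by fun_prop)]
    congr 1; ext x
    rw [Pi.mul_apply, ← ENNReal.ofReal_mul (hp0 x).le, mul_div_cancel₀ _ (hp0 x).ne']
  have : IsProbabilityMeasure ((μ.withDensity fun x => ENNReal.ofReal (p x)).withDensity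
        fun x => ENNReal.ofReal (f x / p x)) := h ▸ inferInstance
  rw [h]
  exact klDiv_withDensity_le _ (by fun_prop) fun x => div_nonneg (hf0 x) (hp0 x).le

/-! ### Markov paths -/

section Path

variable {A S : Type*} [MeasurableSpace A] [MeasurableSpace S] {init : Kernel A S}

lemma measurable_snoc (n : ℕ) :
    Measurable fun p : (Fin (n + 1) → S) × S => (Fin.snoc p.1 p.2 : Fin (n + 2) → S) := by
  refine measurable_pi_lambda _ fun i => ?_
  induction i using Fin.lastCases with
  | last => simpa using measurable_snd
  | cast i => simp only [Fin.snoc_castSucc]; fun_prop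

lemma isMarkovKernel_pathKernel [IsMarkovKernel init] :
    ∀ (n : ℕ) (step : Fin n → Kernel (A × S) S), (∀ i, IsMarkovKernel (step i)) →
      IsMarkovKernel (pathKernel init n step)
  | 0, _, _ => Kernel.IsMarkovKernel.map _ (measurable_pi_lambda _ fun _ => measurable_id)
  | n + 1, step, h => by
    have := isMarkovKernel_pathKernel n (fun i => step i.castSucc) fun i => h _
    have := h (Fin.last n)
    exact Kernel.IsMarkovKernel.map _ (measurable_snoc n)

/-- The first `n` steps of a path form a path. -/
lemma pathKernel_map_castSucc [IsMarkovKernel init] {n : ℕ}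
    (step : Fin (n + 1) → Kernel (A × S) S) (h : ∀ i, IsMarkovKernel (step i)) :
    (pathKernel init (n + 1) step).map (fun x i => x i.castSucc) =
      pathKernel init n fun i => step i.castSucc := by
  have := isMarkovKernel_pathKernel (init := init) n (fun i => step i.castSucc) fun i => h _
  have := h (Fin.last n)
  rw [pathKernel, ← Kernel.map_comp_right _ (measurable_snoc n)
    (measurable_pi_lambda _ fun _ => measurable_pi_apply _)]
  have : ((fun (x : Fin (n + 2) → S) (i : Fin (n + 1)) => x i.castSucc) ∘
      fun p : (Fin (n + 1) → S) × S => (Fin.snoc p.1 p.2 : Fin (n + 2) → S)) = Prod.fst := by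
    ext p i; simp
  rw [this, ← Kernel.fst_eq, Kernel.fst_compProd]

/-- Joint law of the last two states of a path. -/
lemma pathKernel_map_last_pair [IsMarkovKernel init] {n : ℕ}
    (step : Fin (n + 1) → Kernel (A × S) S) (h : ∀ i, IsMarkovKernel (step i)) :
    (pathKernel init (n + 1) step).map (fun x => (x (Fin.last n).castSucc, x (Fin.last (n + 1)))) =
      (pathKernel init n fun i => step i.castSucc).map (fun x => x (Fin.last n)) ⊗ₖ
        step (Fin.last n) := by
  have := isMarkovKernel_pathKernel (init := init) n (fun i => step i.castSucc) fun i => h _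
  have := h (Fin.last n)
  rw [pathKernel, ← Kernel.map_comp_right _ (measurable_snoc n) (by fun_prop)]
  have e : ((fun x : Fin (n + 2) → S => (x (Fin.last n).castSucc, x (Fin.last (n + 1)))) ∘
      fun p : (Fin (n + 1) → S) × S => (Fin.snoc p.1 p.2 : Fin (n + 2) → S)) =
      fun p => (p.1 (Fin.last n), p.2) := by
    ext p <;> simp
  rw [e]
  ext a s hs
  have hm : Measurable fun p : (Fin (n + 1) → S) × S => (p.1 (Fin.last n), p.2) := by fun_prop
  rw [Kernel.map_apply' _ hm _ hs, Kernel.compProd_apply (hm hs), Kernel.compProd_apply hs,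
    Kernel.lintegral_map _ (by fun_prop)]
  · rfl
  · exact (Kernel.measurable_kernel_prodMk_left' hs a)

/-- Joint law of two consecutive states of a path. -/
lemma pathKernel_map_pair [IsMarkovKernel init] : ∀ {n : ℕ}
    (step : Fin n → Kernel (A × S) S) (_ : ∀ i, IsMarkovKernel (step i)) (i : Fin n),
    (pathKernel init n step).map (fun x => (x i.castSucc, x i.succ)) =
      (pathKernel init n step).map (fun x => x i.castSucc) ⊗ₖ step i
  | 0, _, _, i => i.elim0
  | n + 1, step, h, i => by
    have hm : Measurable fun (x : Fin (n + 2) → S) (i : Fin (n + 1)) => x i.castSucc :=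
      measurable_pi_lambda _ fun _ => measurable_pi_apply _
    induction i using Fin.lastCases with
    | last =>
      rw [Fin.succ_last, pathKernel_map_last_pair step h, ← pathKernel_map_castSucc step h,
        ← Kernel.map_comp_right _ hm (by fun_prop)]
      rfl
    | cast i =>
      have ih := pathKernel_map_pair (fun i => step i.castSucc) (fun i => h _) i
      rw [← pathKernel_map_castSucc step h, ← Kernel.map_comp_right _ hm (by fun_prop),
        ← Kernel.map_comp_right _ hm (by fun_prop)] at ih
      exact ih

/-- Law of the last state of a path. -/
lemma pathKernel_map_last [IsMarkovKernel init] {n : ℕ}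
    (step : Fin (n + 1) → Kernel (A × S) S) (h : ∀ i, IsMarkovKernel (step i)) :
    (pathKernel init (n + 1) step).map (fun x => x (Fin.last (n + 1))) =
      ((pathKernel init n fun i => step i.castSucc).map (fun x => x (Fin.last n)) ⊗ₖ
        step (Fin.last n)).map Prod.snd := by
  rw [← pathKernel_map_last_pair step h, ← Kernel.map_comp_right _ (by fun_prop) measurable_snd]
  rfl

/-- Law of the initial state of a path. -/
lemma pathKernel_map_zero [IsMarkovKernel init] : ∀ {n : ℕ}
    (step : Fin n → Kernel (A × S) S) (_ : ∀ i, IsMarkovKernel (step i)),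
    (pathKernel init n step).map (fun x => x 0) = init
  | 0, _, _ => by
    rw [pathKernel, ← Kernel.map_comp_right _
      (measurable_pi_lambda (fun (x : S) (_ : Fin 1) => x) fun _ => measurable_id) (by fun_prop)]
    exact Kernel.map_id _
  | n + 1, step, h => by
    have ih := pathKernel_map_zero (fun i => step i.castSucc) (fun i => h _)
    rw [← pathKernel_map_castSucc step h, ← Kernel.map_comp_right _
      (measurable_pi_lambda _ fun _ => measurable_pi_apply _) (by fun_prop)] at ih
    exact ih

end Path

/-! ### Comparison of the forward and the reverse chain -/

namespace DiffusionProblem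

variable {𝒞 : Type*} [MeasurableSpace 𝒞] {D T : ℕ} (X : DiffusionProblem 𝒞 D T)

lemma isMarkovKernel_forwardPath : IsMarkovKernel X.forwardPath := by
  have := X.isMarkovKernel_target
  have := X.isMarkovKernel_forward
  exact isMarkovKernel_pathKernel _ _ fun _ => inferInstance

lemma isMarkovKernel_marginal (j : Fin (T + 1)) : IsMarkovKernel (X.marginal j) := by
  have := X.isMarkovKernel_forwardPath
  exact Kernel.IsMarkovKernel.map _ (measurable_pi_apply _)

lemma marginal_zero : X.marginal 0 = X.target := by
  have := X.isMarkovKernel_target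
  have := X.isMarkovKernel_forward
  exact pathKernel_map_zero _ fun _ => inferInstance

lemma isProbabilityMeasure_jointLaw (s : Fin T) : IsProbabilityMeasure (X.jointLaw s) := by
  have := X.isProbabilityMeasure_context
  have := X.isMarkovKernel_forwardPath
  exact Measure.isProbabilityMeasure_map (by fun_prop)

lemma jointLaw_map (s : Fin T) :
    (X.jointLaw s).map (fun w => (w.1.1, w.2)) = X.context ⊗ₘ X.marginal s.castSucc := by
  have := X.isProbabilityMeasure_context
  have := X.isMarkovKernel_forwardPath
  rw [jointLaw, Measure.map_map (by fun_prop) (by fun_prop), marginal,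
    Measure.compProd_map (by fun_prop)]
  rfl

lemma fst_jointLaw (s : Fin T) : (X.jointLaw s).fst = X.context ⊗ₘ X.marginal s.succ := by
  have := X.isProbabilityMeasure_context
  have := X.isMarkovKernel_forwardPath
  rw [Measure.fst, jointLaw, Measure.map_map (by fun_prop) (by fun_prop), marginal,
    Measure.compProd_map (by fun_prop)]
  rfl

/-- The joint law of `((C, X_{s+1}), X_s)` in terms of the forward kernel. -/
lemma jointLaw_eq (s : Fin T) : X.jointLaw s =
    ((X.context ⊗ₘ X.marginal s.castSucc) ⊗ₘ (X.forward s).comap Prod.snd measurable_snd).map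
      fun q => ((q.1.1, q.2), q.1.2) := by
  have := X.isProbabilityMeasure_context
  have := X.isMarkovKernel_target
  have := X.isMarkovKernel_forward
  have := X.isMarkovKernel_forwardPath
  have := X.isMarkovKernel_marginal
  have h := pathKernel_map_pair (init := X.target)
    (fun s => (X.forward s).comap Prod.snd measurable_snd) (fun _ => inferInstance) s
  change X.forwardPath.map _ = X.marginal s.castSucc ⊗ₖ _ at h
  have h2 : (X.context ⊗ₘ X.forwardPath).map
      (Prod.map id fun x : Fin (T + 1) → Vec D => (x s.castSucc, x s.succ)) =
      X.context ⊗ₘ (X.marginal s.castSucc ⊗ₖ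
        (X.forward s).comap Prod.snd measurable_snd) := by
    rw [← Measure.compProd_map (by fun_prop), h]
  rw [← Measure.compProd_assoc'] at h2
  have h3 := congrArg (fun μ : Measure (𝒞 × (Vec D × Vec D)) =>
    μ.map fun q => ((q.1, q.2.2), q.2.1)) h2
  simp only at h3
  rw [Measure.map_map (by fun_prop) (by fun_prop),
    Measure.map_map (by fun_prop) (by fun_prop)] at h3
  exact h3

/-- Law of the state of the reverse chain after `n` steps. -/
noncomputable def reverseMarginal (p : Fin T → Kernel (𝒞 × Vec D) (Vec D)) (n : ℕ) (hn : n ≤ T) :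
    Kernel 𝒞 (Vec D) :=
  (pathKernel (Kernel.const 𝒞 X.reference) n fun k => p (Fin.castLE hn k).rev).map
    fun x => x (Fin.last n)

variable (p : Fin T → Kernel (𝒞 × Vec D) (Vec D))

lemma isMarkovKernel_reverseMarginal [∀ t, IsMarkovKernel (p t)] (n : ℕ) (hn : n ≤ T) :
    IsMarkovKernel (X.reverseMarginal p n hn) := by
  have := X.isProbabilityMeasure_reference
  have := isMarkovKernel_pathKernel (init := Kernel.const 𝒞 X.reference) n
    (fun k => p (Fin.castLE hn k).rev) fun _ => inferInstance
  exact Kernel.IsMarkovKernel.map _ (measurable_pi_apply _)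

lemma reverseMarginal_succ [∀ t, IsMarkovKernel (p t)] (n : ℕ) (hn : n + 1 ≤ T) :
    X.context ⊗ₘ X.reverseMarginal p (n + 1) hn =
      ((X.context ⊗ₘ X.reverseMarginal p n (Nat.le_of_succ_le hn)) ⊗ₘ
        p (Fin.castLE hn (Fin.last n)).rev).map fun q => (q.1.1, q.2) := by
  have := X.isProbabilityMeasure_context
  have := X.isProbabilityMeasure_reference
  have := X.isMarkovKernel_reverseMarginal p n (Nat.le_of_succ_le hn)
  have h := pathKernel_map_last (init := Kernel.const 𝒞 X.reference)
    (fun k => p (Fin.castLE hn k).rev) fun _ => inferInstance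
  change X.reverseMarginal p (n + 1) hn = (X.reverseMarginal p n (Nat.le_of_succ_le hn) ⊗ₖ
    p (Fin.castLE hn (Fin.last n)).rev).map Prod.snd at h
  rw [h, Measure.compProd_map measurable_snd, ← Measure.compProd_assoc,
    Measure.map_map (by fun_prop) (by fun_prop)]
  rfl

/-- Undoing the reverse steps one at a time: the chain rule and the data processing inequality
add the conditional divergence of each step. -/
lemma klDiv_reverseMarginal_le [∀ t, IsMarkovKernel (p t)] : ∀ (n : ℕ) (hn : n ≤ T),
    klDiv (X.context ⊗ₘ X.marginal ⟨T - n, by omega⟩)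
        (X.context ⊗ₘ X.reverseMarginal p n hn) ≤
      X.terminalMismatch + ∑ k : Fin n, ∫⁻ w,
        klDiv (X.reverseKernel (Fin.castLE hn k).rev w) (p (Fin.castLE hn k).rev w)
          ∂(X.jointLaw (Fin.castLE hn k).rev).fst
  | 0, hn => by
    have := X.isProbabilityMeasure_context
    have := X.isProbabilityMeasure_reference
    have := X.isMarkovKernel_marginal
    have h : X.reverseMarginal p 0 hn = Kernel.const 𝒞 X.reference :=
      pathKernel_map_zero _ fun _ => inferInstance
    rw [h, ← lintegral_klDiv_eq]
    simp [terminalMismatch, Fin.last]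
  | n + 1, hn => by
    have := X.isProbabilityMeasure_context
    have := X.isMarkovKernel_marginal
    have := X.isMarkovKernel_reverseMarginal p n (Nat.le_of_succ_le hn)
    have ih := klDiv_reverseMarginal_le n (Nat.le_of_succ_le hn)
    set t : Fin T := (Fin.castLE hn (Fin.last n)).rev with ht
    have htv : (t : ℕ) = T - (n + 1) := by simp [ht, Fin.rev]
    have e1 : (⟨T - (n + 1), by omega⟩ : Fin (T + 1)) = t.castSucc := Fin.ext htv.symm
    have e2 : (⟨T - n, by omega⟩ : Fin (T + 1)) = t.succ := by
      ext; simp only [Fin.val_succ, htv]; omega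
    rw [e2] at ih
    rw [e1, ← jointLaw_map, reverseMarginal_succ, Fin.sum_univ_castSucc, ← add_assoc]
    refine (klDiv_map_le _ _ (by fun_prop)).trans ?_
    have hdis : X.jointLaw t = (X.context ⊗ₘ X.marginal t.succ) ⊗ₘ X.reverseKernel t := by
      rw [← fst_jointLaw]; exact ((X.jointLaw t).disintegrate (X.jointLaw t).condKernel).symm
    have : IsMarkovKernel (X.reverseKernel t) := by unfold reverseKernel; infer_instance
    rw [lintegral_klDiv_eq (X.jointLaw t).fst, fst_jointLaw]
    conv_lhs => rw [hdis]
    rw [klDiv_compProd_eq_add]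
    gcongr
    exact ih

/-- The output error is at most the terminal mismatch plus the averaged conditional
divergences of the reverse steps. -/
theorem outputKL_predictor_le [∀ t, IsMarkovKernel (p t)] :
    X.outputKL (X.predictor p) ≤ X.terminalMismatch +
      ∑ t, ∫⁻ w, klDiv (X.reverseKernel t w) (p t w) ∂(X.jointLaw t).fst := by
  have := X.isProbabilityMeasure_context
  have := X.isMarkovKernel_target
  have := X.isMarkovKernel_reverseMarginal p T le_rfl
  have h := X.klDiv_reverseMarginal_le p T le_rfl
  have e : (⟨T - T, by omega⟩ : Fin (T + 1)) = 0 := by ext; simp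
  rw [e, marginal_zero, ← lintegral_klDiv_eq] at h
  refine h.trans (le_of_eq ?_)
  congr 1
  exact Equiv.sum_comp Fin.revPerm fun t =>
    ∫⁻ w, klDiv (X.reverseKernel t w) (p t w) ∂(X.jointLaw t).fst

end DiffusionProblem

/-! ### Gaussian mixtures and the divergence of one reverse step -/

section Gaussian

variable {D : ℕ}

lemma gaussianDensity_pos (μ : Vec D) {σ : ℝ} (hσ : 0 < σ) (y : Vec D) :
    0 < gaussianDensity μ σ y := by
  unfold gaussianDensity; positivity

@[fun_prop]
lemma continuous_gaussianDensity (μ : Vec D) (σ : ℝ) : Continuous (gaussianDensity μ σ) := by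
  unfold gaussianDensity; fun_prop

lemma integral_gaussianDensity (μ : Vec D) {σ : ℝ} (hσ : 0 < σ) :
    ∫ y, gaussianDensity μ σ y = 1 := by
  have h := GaussianFourier.integral_rexp_neg_mul_sq_norm (V := Vec D)
    (b := 1 / (2 * σ ^ 2)) (by positivity)
  rw [← integral_sub_right_eq_self (fun v : Vec D => Real.exp (-(1 / (2 * σ ^ 2)) * ‖v‖ ^ 2)) μ]
    at h
  unfold gaussianDensity
  rw [integral_div]
  have e : ∀ y : Vec D, -‖y - μ‖ ^ 2 / (2 * σ ^ 2) = -(1 / (2 * σ ^ 2)) * ‖y - μ‖ ^ 2 :=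
    fun y => by ring
  simp only [e, h, finrank_euclideanSpace, Fintype.card_fin]
  rw [show Real.pi / (1 / (2 * σ ^ 2)) = 2 * Real.pi * σ ^ 2 by field_simp]
  exact div_self (by positivity)

lemma integrable_gaussianDensity (μ : Vec D) {σ : ℝ} (hσ : 0 < σ) :
    Integrable (gaussianDensity μ σ) :=
  Integrable.of_integral_ne_zero (by rw [integral_gaussianDensity μ hσ]; exact one_ne_zero)

variable {r : ℝ} (P : PartitionData D r) (n : ℕ)

lemma mixtureDensity_pos (u : Fin (P.size n) → ℝ) (y : Vec D) : 0 < mixtureDensity P n u y := by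
  have h0 := gaussianDensity_pos (0 : Vec D) P.sigmaZero_pos y
  have h1 := fun j => gaussianDensity_pos (P.center n j) (P.sigma_pos n) y
  have hs : 0 ≤ ∑ k, Real.exp (u k) := Finset.sum_nonneg fun k _ => (Real.exp_pos _).le
  unfold mixtureDensity
  refine add_pos_of_nonneg_of_pos (Finset.sum_nonneg fun j _ => ?_) (by positivity)
  exact mul_nonneg (by positivity) (h1 j).le

lemma integrable_mixtureDensity (u : Fin (P.size n) → ℝ) : Integrable (mixtureDensity P n u) :=
  (integrable_finsetSum _ fun _ _ =>
    (integrable_gaussianDensity _ (P.sigma_pos n)).const_mul _).add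
    ((integrable_gaussianDensity _ P.sigmaZero_pos).const_mul _)

lemma integral_mixtureDensity (u : Fin (P.size n) → ℝ) : ∫ y, mixtureDensity P n u y = 1 := by
  have hs : 0 ≤ ∑ k, Real.exp (u k) := Finset.sum_nonneg fun k _ => (Real.exp_pos _).le
  unfold mixtureDensity
  have hi := fun j => integrable_gaussianDensity (P.center n j) (P.sigma_pos n)
  rw [integral_add (integrable_finsetSum _ fun j _ => (hi j).const_mul _)
    ((integrable_gaussianDensity _ P.sigmaZero_pos).const_mul _),
    integral_finsetSum _ fun j _ => (hi j).const_mul _]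
  simp only [integral_const_mul, integral_gaussianDensity _ (P.sigma_pos n),
    integral_gaussianDensity _ P.sigmaZero_pos, mul_one]
  rw [← Finset.sum_div, ← add_div, add_comm, div_self (by positivity)]

lemma ReLUNet.continuous_eval : ∀ {i o : ℕ} (a : ReLUNet i o), Continuous a.eval
  | _, _, output A b => by
    change Continuous fun x => A.mulVec x + b
    fun_prop
  | _, _, hidden A b rest => by
    refine rest.continuous_eval.comp (continuous_pi fun l => ?_)
    have : Continuous fun x => A.mulVec x + b := by fun_prop
    exact ((continuous_apply l).comp this).max continuous_const

lemma measurable_mixtureDensity {A : Type*} [MeasurableSpace A] {u : A → Fin (P.size n) → ℝ}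
    {y : A → Vec D} (hu : Measurable u) (hy : Measurable y) :
    Measurable fun w => mixtureDensity P n (u w) (y w) := by
  unfold mixtureDensity
  have hu' : ∀ j, Measurable fun w => u w j := fun j => (measurable_pi_apply j).comp hu
  have hg : ∀ (μ : Vec D) σ, Measurable fun w => gaussianDensity μ σ (y w) := fun μ σ =>
    (continuous_gaussianDensity μ σ).measurable.comp hy
  fun_prop

variable {𝒞 : Type*} [MeasurableSpace 𝒞] {d : ℕ} {φ : 𝒞 × Vec D → Fin d → ℝ}

lemma neuralKernel_apply (hφ : Measurable φ) (a : ReLUNet d (P.size n)) (w : 𝒞 × Vec D) :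
    neuralKernel φ P n a w =
      volume.withDensity fun y => ENNReal.ofReal (mixtureDensity P n (a.eval (φ w)) y) := by
  rw [neuralKernel, Kernel.withDensity_apply, Kernel.const_apply]
  exact (measurable_mixtureDensity P n (a.continuous_eval.measurable.comp (hφ.comp measurable_fst))
    measurable_snd).ennreal_ofReal

lemma isProbabilityMeasure_mixture (u : Fin (P.size n) → ℝ) : IsProbabilityMeasure
    (volume.withDensity fun y => ENNReal.ofReal (mixtureDensity P n u y)) := by
  refine ⟨?_⟩
  rw [withDensity_apply _ MeasurableSet.univ, setLIntegral_univ,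
    ← ofReal_integral_eq_lintegral_ofReal (integrable_mixtureDensity P n u)
      (ae_of_all _ fun y => (mixtureDensity_pos P n u y).le), integral_mixtureDensity,
    ENNReal.ofReal_one]

lemma isMarkovKernel_neuralKernel (hφ : Measurable φ) (a : ReLUNet d (P.size n)) :
    IsMarkovKernel (neuralKernel φ P n a) :=
  ⟨fun w => by rw [neuralKernel_apply P n hφ]; exact isProbabilityMeasure_mixture P n _⟩

end Gaussian

/-- The averaged divergence of a reverse step is at most the integral of the positive part of
the log-likelihood ratio against the joint law of state and feature. -/
lemma lintegral_klDiv_neuralKernel_le {𝒞 : Type*} [MeasurableSpace 𝒞] {D T d : ℕ}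
    {X : DiffusionProblem 𝒞 D T} {s : Fin T} {φ : 𝒞 × Vec D → Fin d → ℝ}
    {K : Set (Fin d → ℝ)} {f : (Fin d → ℝ) → Vec D → ℝ} (h : FeatureAssumption X s φ K f)
    {r : ℝ} (P : PartitionData D r) (n : ℕ) (a : ReLUNet d (P.size n)) :
    ∫⁻ w, klDiv (X.reverseKernel s w) (neuralKernel φ P n a w) ∂(X.jointLaw s).fst ≤
      ∫⁻ p, ENNReal.ofReal (Real.log (f p.2 p.1 / mixtureDensity P n (a.eval p.2) p.1))
        ∂X.featureLaw s φ := by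
  have hφ := h.measurable_feature
  have hf := h.measurable_density
  have hmk : IsMarkovKernel (X.reverseKernel s) := by
    unfold DiffusionProblem.reverseKernel; infer_instance
  have hdis : X.jointLaw s = (X.jointLaw s).fst ⊗ₘ X.reverseKernel s :=
    ((X.jointLaw s).disintegrate (X.jointLaw s).condKernel).symm
  have hm : Measurable fun p : Vec D × (Fin d → ℝ) =>
      ENNReal.ofReal (Real.log (f p.2 p.1 / mixtureDensity P n (a.eval p.2) p.1)) := by
    have h1 : Measurable fun p : Vec D × (Fin d → ℝ) => f p.2 p.1 := hf.comp measurable_swap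
    have h2 := measurable_mixtureDensity P n (A := Vec D × (Fin d → ℝ))
      (a.continuous_eval.measurable.comp measurable_snd) measurable_fst
    exact (h1.div h2).log.ennreal_ofReal
  rw [DiffusionProblem.featureLaw, lintegral_map hm (by fun_prop)]
  conv_rhs => rw [hdis]
  have hm' : Measurable fun w : (𝒞 × Vec D) × Vec D => ENNReal.ofReal (Real.log
      (f (φ w.1) w.2 / mixtureDensity P n (a.eval (φ w.1)) w.2)) :=
    hm.comp (by fun_prop : Measurable fun w : (𝒞 × Vec D) × Vec D => (w.2, φ w.1))
  rw [Measure.lintegral_compProd hm']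
  refine lintegral_mono_ae ?_
  filter_upwards [h.sufficiency] with w hw
  rw [neuralKernel_apply P n hφ, hw]
  have := isProbabilityMeasure_mixture P n (a.eval (φ w))
  have : IsProbabilityMeasure (volume.withDensity fun y => ENNReal.ofReal (f (φ w) y)) :=
    hw ▸ inferInstance
  exact klDiv_withDensity_withDensity_le volume (hf.comp measurable_prodMk_left)
    (h.density_nonneg _) (measurable_mixtureDensity P n measurable_const measurable_id)
    (mixtureDensity_pos P n _)

/-! ### Positivity of the conditional cell probabilities -/

section Positivity

variable {𝒞 : Type*} [MeasurableSpace 𝒞] {D T : ℕ} {X : DiffusionProblem 𝒞 D T}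

lemma DiffusionProblem.volume_eq_zero_of_forward (s : Fin T) (x : Vec D) {S : Set (Vec D)}
    (h : X.forward s x S = 0) : volume S = 0 := by
  have hm : Measurable (X.forwardDensity s x) :=
    (X.measurable_forwardDensity s).comp measurable_prodMk_left
  rw [X.forward_eq, withDensity_apply_eq_zero (by fun_prop)] at h
  refine measure_mono_null ?_ h
  refine fun y hy => ⟨?_, hy⟩
  simpa using X.forwardDensity_pos s x y

lemma DiffusionProblem.marginal_succ (s : Fin T) (c : 𝒞) {S : Set (Vec D)}
    (hS : MeasurableSet S) :
    X.marginal s.succ c S = ∫⁻ x, X.forward s x S ∂X.marginal s.castSucc c := by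
  have := X.isMarkovKernel_target
  have := X.isMarkovKernel_forward
  have := X.isMarkovKernel_marginal
  have h := pathKernel_map_pair (init := X.target)
    (fun s => (X.forward s).comap Prod.snd measurable_snd) (fun _ => inferInstance) s
  change X.forwardPath.map _ = X.marginal s.castSucc ⊗ₖ _ at h
  have h2 : X.marginal s.succ = (X.forwardPath.map
      fun x => (x s.castSucc, x s.succ)).map Prod.snd := by
    rw [← Kernel.map_comp_right _ (by fun_prop) measurable_snd]; rfl
  rw [h2, h, Kernel.map_apply' _ measurable_snd _ hS,
    Kernel.compProd_apply (measurable_snd hS)]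
  rfl

/-- The law of every state of the forward chain charges all sets of positive volume. -/
lemma DiffusionProblem.ae_marginal_ne_zero {r : Fin T → ℝ} (h : RegularityAssumption X r)
    (s : Fin (T + 1)) {S : Set (Vec D)} (hS : MeasurableSet S) (hS0 : volume S ≠ 0) :
    ∀ᵐ c ∂X.context, X.marginal s c S ≠ 0 := by
  induction s using Fin.cases with
  | zero =>
    filter_upwards [h.targetDensity_pos, X.target_eq] with c hc hc'
    rw [X.marginal_zero, hc']
    have hm : Measurable (X.targetDensity c) :=
      X.measurable_targetDensity.comp measurable_prodMk_left
    rw [Ne, withDensity_apply_eq_zero (by fun_prop)]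
    refine fun h0 => hS0 (measure_mono_null ?_ h0)
    refine fun y hy => ⟨?_, hy⟩
    simpa using hc y
  | succ s =>
    have := X.isMarkovKernel_marginal
    refine ae_of_all _ fun c => ?_
    rw [X.marginal_succ s c hS, Ne,
      lintegral_eq_zero_iff (Kernel.measurable_coe _ hS)]
    intro h0
    obtain ⟨x, hx⟩ := h0.exists
    exact hS0 (X.volume_eq_zero_of_forward s x hx)

/-- The true reverse kernel charges a set of positive volume, since the forward densities are
positive. -/
lemma DiffusionProblem.ae_reverseKernel_ne_zero {r : Fin T → ℝ} (h : RegularityAssumption X r)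
    (s : Fin T) {S : Set (Vec D)} (hS : MeasurableSet S) (hS0 : volume S ≠ 0) :
    ∀ᵐ w ∂(X.jointLaw s).fst, X.reverseKernel s w S ≠ 0 := by
  have := X.isProbabilityMeasure_context
  have := X.isMarkovKernel_forward
  have := X.isMarkovKernel_marginal
  have : IsMarkovKernel (X.reverseKernel s) := by
    unfold DiffusionProblem.reverseKernel; infer_instance
  have hdis : X.jointLaw s = (X.jointLaw s).fst ⊗ₘ X.reverseKernel s :=
    ((X.jointLaw s).disintegrate (X.jointLaw s).condKernel).symm
  set W := {w | X.reverseKernel s w S = 0} with hW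
  have hWm : MeasurableSet W := (Kernel.measurable_coe _ hS) (measurableSet_singleton 0)
  -- `W ×ˢ S` is a null set; in terms of the forward kernel this forces the sections of `W` to be
  -- null, as the law of `X_s` charges `S` and the forward densities are positive
  have h0 : X.jointLaw s (W ×ˢ S) = 0 := by
    rw [hdis, Measure.compProd_apply_prod hWm hS]
    exact (setLIntegral_congr_fun hWm fun w hw => hw).trans (by simp)
  have hsec : ∀ c, MeasurableSet (Prod.mk c ⁻¹' W) := fun c => measurable_prodMk_left hWm
  rw [X.jointLaw_eq s, Measure.map_apply (by fun_prop) (hWm.prod hS),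
    Measure.compProd_apply ((hWm.prod hS).preimage (by fun_prop)), lintegral_eq_zero_iff
      (Kernel.measurable_kernel_prodMk_left ((hWm.prod hS).preimage (by fun_prop)))] at h0
  have h1 : ∀ᵐ q ∂(X.context ⊗ₘ X.marginal s.castSucc),
      q.2 ∈ S → volume (Prod.mk q.1 ⁻¹' W) = 0 := by
    filter_upwards [h0] with q hq hqS
    refine X.volume_eq_zero_of_forward s q.2 ?_
    simpa [Kernel.comap_apply, Set.preimage, hqS] using hq
  have h2 := Measure.ae_ae_of_ae_compProd h1
  have h3 : ∀ᵐ c ∂X.context, volume (Prod.mk c ⁻¹' W) = 0 := by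
    filter_upwards [h2, DiffusionProblem.ae_marginal_ne_zero h s.castSucc hS hS0] with c hc hc'
    by_contra hv
    refine hc' (measure_mono_null (fun x hx => ?_) (ae_iff.mp hc))
    simp only [Set.mem_ofPred_eq, Classical.not_imp]
    exact ⟨hx, hv⟩
  change (X.jointLaw s).fst Wᶜᶜ = 0
  rw [compl_compl, X.fst_jointLaw, Measure.compProd_apply hWm, lintegral_eq_zero_iff
    (Kernel.measurable_kernel_prodMk_left hWm)]
  filter_upwards [h3] with c hc
  rw [Pi.zero_apply, X.marginal_succ s c (hsec c), lintegral_eq_zero_iff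
    (Kernel.measurable_coe _ (hsec c))]
  refine ae_of_all _ fun x => ?_
  change X.forward s x _ = 0
  rw [X.forward_eq]
  exact withDensity_absolutelyContinuous _ _ hc

variable {s : Fin T} {d : ℕ} {φ : 𝒞 × Vec D → Fin d → ℝ} {K : Set (Fin d → ℝ)}
  {f : (Fin d → ℝ) → Vec D → ℝ}

lemma FeatureAssumption.snd_featureLaw (h : FeatureAssumption X s φ K f) :
    (X.featureLaw s φ).snd = (X.jointLaw s).fst.map φ := by
  have := h.measurable_feature
  rw [DiffusionProblem.featureLaw, Measure.snd, Measure.fst,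
    Measure.map_map (by fun_prop) (by fun_prop), Measure.map_map (by fun_prop) (by fun_prop)]
  rfl

lemma FeatureAssumption.isProbabilityMeasure_featureLaw (h : FeatureAssumption X s φ K f) :
    IsProbabilityMeasure (X.featureLaw s φ) := by
  have := h.measurable_feature
  have := X.isProbabilityMeasure_jointLaw s
  exact Measure.isProbabilityMeasure_map (by fun_prop)

/-- The conditional densities given the feature charge a set of positive volume. -/
lemma FeatureAssumption.ae_setLIntegral_ne_zero (h : FeatureAssumption X s φ K f)
    {r : Fin T → ℝ} (hreg : RegularityAssumption X r) {S : Set (Vec D)} (hS : MeasurableSet S)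
    (hS0 : volume S ≠ 0) :
    ∀ᵐ z ∂(X.featureLaw s φ).snd, ∫⁻ y in S, ENNReal.ofReal (f z y) ≠ 0 := by
  have hf := h.measurable_density
  have hm : Measurable fun z => ∫⁻ y in S, ENNReal.ofReal (f z y) :=
    hf.ennreal_ofReal.lintegral_prod_right'
  rw [h.snd_featureLaw, ae_map_iff h.measurable_feature.aemeasurable
    (show MeasurableSet {z | ∫⁻ y in S, ENNReal.ofReal (f z y) ≠ 0} from
      (hm (measurableSet_singleton 0)).compl)]
  filter_upwards [h.sufficiency, DiffusionProblem.ae_reverseKernel_ne_zero hreg s hS hS0]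
    with w hw hw'
  rwa [hw, withDensity_apply _ hS] at hw'

lemma FeatureAssumption.ae_lintegral_eq_one (h : FeatureAssumption X s φ K f) :
    ∀ᵐ z ∂(X.featureLaw s φ).snd, ∫⁻ y, ENNReal.ofReal (f z y) = 1 := by
  have hf := h.measurable_density
  have hm : Measurable fun z => ∫⁻ y, ENNReal.ofReal (f z y) :=
    hf.ennreal_ofReal.lintegral_prod_right'
  have : IsMarkovKernel (X.reverseKernel s) := by
    unfold DiffusionProblem.reverseKernel; infer_instance
  rw [h.snd_featureLaw, ae_map_iff h.measurable_feature.aemeasurable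
    (show MeasurableSet {z | ∫⁻ y, ENNReal.ofReal (f z y) = 1} from
      hm (measurableSet_singleton 1))]
  filter_upwards [h.sufficiency] with w hw
  rw [← setLIntegral_univ, ← withDensity_apply _ MeasurableSet.univ, ← hw]
  exact measure_univ

end Positivity

/-! ### The centred Gaussian law and its mass on cubes -/

section GaussianMass

variable {D : ℕ}

/-- The centred normal law `N(0, σ² I_D)`. -/
noncomputable def centredGaussian (D : ℕ) (σ : ℝ) : Measure (Vec D) :=
  volume.withDensity fun v => ENNReal.ofReal (gaussianDensity 0 σ v)

lemma isProbabilityMeasure_centredGaussian {σ : ℝ} (hσ : 0 < σ) :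
    IsProbabilityMeasure (centredGaussian D σ) := by
  refine ⟨?_⟩
  rw [centredGaussian, withDensity_apply _ MeasurableSet.univ, setLIntegral_univ,
    ← ofReal_integral_eq_lintegral_ofReal (integrable_gaussianDensity 0 hσ)
      (ae_of_all _ fun y => (gaussianDensity_pos 0 hσ y).le), integral_gaussianDensity 0 hσ,
    ENNReal.ofReal_one]

lemma gaussianDensity_eq_sub (u : Vec D) (σ : ℝ) (y : Vec D) :
    gaussianDensity u σ y = gaussianDensity 0 σ (u - y) := by
  simp [gaussianDensity, norm_sub_rev y u]

/-- Mass of the normal law with centre `y`, as a function of the integration variable. -/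
lemma setIntegral_gaussianDensity {σ : ℝ} (hσ : 0 < σ) (y : Vec D) {S : Set (Vec D)}
    (hS : MeasurableSet S) :
    ∫ u in S, gaussianDensity u σ y = (centredGaussian D σ).real ((fun v => v + y) ⁻¹' S) := by
  have hS' : MeasurableSet ((fun v => v + y) ⁻¹' S) := hS.preimage (by fun_prop)
  rw [Measure.real, centredGaussian, withDensity_apply _ hS',
    ← ofReal_integral_eq_lintegral_ofReal (integrable_gaussianDensity 0 hσ).integrableOn
      (ae_of_all _ fun y => (gaussianDensity_pos 0 hσ y).le),
    ENNReal.toReal_ofReal (setIntegral_nonneg hS' fun v _ => (gaussianDensity_pos 0 hσ v).le),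
    ← integral_indicator hS, ← integral_indicator hS',
    ← integral_add_right_eq_self _ y]
  congr 1; ext v
  by_cases hv : v + y ∈ S
  · rw [Set.indicator_of_mem hv, Set.indicator_of_mem (show v ∈ (fun v => v + y) ⁻¹' S from hv),
      gaussianDensity_eq_sub, add_sub_cancel_right]
  · rw [Set.indicator_of_notMem hv, Set.indicator_of_notMem (show v ∉ (fun v => v + y) ⁻¹' S from hv)]

lemma gaussianDensity_smul {σ : ℝ} (hσ : 0 < σ) (v : Vec D) :
    gaussianDensity 0 1 v = σ ^ D * gaussianDensity 0 σ (σ • v) := by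
  have h : (2 * Real.pi * σ ^ 2) ^ ((D : ℝ) / 2) = (2 * Real.pi) ^ ((D : ℝ) / 2) * σ ^ D := by
    rw [Real.mul_rpow (by positivity) (by positivity), ← Real.rpow_natCast σ 2, ← Real.rpow_mul hσ.le,
      ← Real.rpow_natCast σ D]
    congr 2
    push_cast; ring
  unfold gaussianDensity
  rw [h, sub_zero, sub_zero, norm_smul, Real.norm_eq_abs, abs_of_pos hσ]
  rw [show -(σ * ‖v‖) ^ 2 / (2 * σ ^ 2) = -‖v‖ ^ 2 / (2 * 1 ^ 2) by field_simp]
  simp only [one_pow, mul_one]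
  field_simp

lemma centredGaussian_apply_smul {σ : ℝ} (hσ : 0 < σ) {S : Set (Vec D)} (hS : MeasurableSet S) :
    centredGaussian D σ S = centredGaussian D 1 ((fun v => σ • v) ⁻¹' S) := by
  have hS' : MeasurableSet ((fun v : Vec D => σ • v) ⁻¹' S) := hS.preimage (by fun_prop)
  have hm : Measurable fun v : Vec D => ENNReal.ofReal (σ ^ D * gaussianDensity 0 σ v) := by fun_prop
  have h := Measure.map_addHaar_smul (volume : Measure (Vec D)) hσ.ne'
  rw [centredGaussian, centredGaussian, withDensity_apply _ hS, withDensity_apply _ hS']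
  simp_rw [gaussianDensity_smul hσ]
  rw [← setLIntegral_map hS hm (by fun_prop), h, Measure.restrict_smul, lintegral_smul_measure]
  simp_rw [ENNReal.ofReal_mul (pow_nonneg hσ.le D)]
  rw [lintegral_const_mul _ (by fun_prop), finrank_euclideanSpace, Fintype.card_fin, smul_eq_mul,
    ← mul_assoc, ← ENNReal.ofReal_mul (abs_nonneg _), abs_of_pos (by positivity),
    inv_mul_cancel₀ (by positivity), ENNReal.ofReal_one, one_mul]

/-- A half-space with unit normal `e` at distance `a`, after a shift by `a • e`. -/
lemma centredGaussian_halfspace (e : Vec D) (he : ‖e‖ = 1) (a : ℝ) :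
    centredGaussian D 1 {v | a < inner ℝ v e} = ENNReal.ofReal (Real.exp (-a ^ 2 / 2)) *
      ∫⁻ v in {v | 0 < inner ℝ v e}, ENNReal.ofReal (Real.exp (-a * inner ℝ v e))
        ∂centredGaussian D 1 := by
  have hm0 : MeasurableSet {v : Vec D | 0 < inner ℝ v e} :=
    measurableSet_lt measurable_const (by fun_prop)
  have hm : MeasurableSet {v : Vec D | a < inner ℝ v e} :=
    measurableSet_lt measurable_const (by fun_prop)
  rw [centredGaussian, withDensity_apply _ hm, restrict_withDensity hm0,
    lintegral_withDensity_eq_lintegral_mul _ (by fun_prop) (by fun_prop),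
    ← lintegral_const_mul _ (by fun_prop), ← lintegral_indicator hm, ← lintegral_indicator hm0,
    ← lintegral_add_right_eq_self _ (a • e)]
  congr 1; ext v
  have h1 : inner ℝ (v + a • e) e = inner ℝ v e + a := by
    rw [inner_add_left, inner_smul_left, real_inner_self_eq_norm_sq, he]; simp
  have h2 : ‖v + a • e‖ ^ 2 = ‖v‖ ^ 2 + 2 * a * inner ℝ v e + a ^ 2 := by
    rw [norm_add_sq_real, inner_smul_right, norm_smul, he, Real.norm_eq_abs, mul_one, sq_abs]; ring
  by_cases hv : 0 < inner ℝ v e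
  · rw [Set.indicator_of_mem (show v + a • e ∈ {v : Vec D | a < inner ℝ v e} by
      simpa [h1] using hv), Set.indicator_of_mem (show v ∈ {v : Vec D | 0 < inner ℝ v e} from hv), Pi.mul_apply,
      ← ENNReal.ofReal_mul (gaussianDensity_pos _ one_pos _).le,
      ← ENNReal.ofReal_mul (Real.exp_pos _).le]
    congr 1
    unfold gaussianDensity
    rw [div_mul_eq_mul_div, mul_div_assoc', ← Real.exp_add, ← Real.exp_add, sub_zero, sub_zero, h2]
    congr 2; ring
  · rw [Set.indicator_of_notMem (show v + a • e ∉ {v : Vec D | a < inner ℝ v e} by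
      simpa [h1] using hv), Set.indicator_of_notMem (show v ∉ {v : Vec D | 0 < inner ℝ v e} from hv)]

/-- The factor by which the mass of a half-space falls short of `exp (-a² / 2)` tends to zero; this
makes the union bound over the `2 D` faces of a cube free of a constant. -/
lemma tendsto_halfspace_weight (e : Vec D) :
    Tendsto (fun a : ℝ => ∫⁻ v in {v : Vec D | 0 < inner ℝ v e},
      ENNReal.ofReal (Real.exp (-a * inner ℝ v e)) ∂centredGaussian D 1) atTop (𝓝 0) := by
  have := isProbabilityMeasure_centredGaussian (D := D) one_pos
  have hm0 : MeasurableSet {v : Vec D | 0 < inner ℝ v e} :=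
    measurableSet_lt measurable_const (by fun_prop)
  have h := tendsto_lintegral_filter_of_dominated_convergence (l := atTop)
    (μ := (centredGaussian D 1).restrict {v : Vec D | 0 < inner ℝ v e})
    (F := fun (a : ℝ) v => ENNReal.ofReal (Real.exp (-a * inner ℝ v e))) (f := fun _ => 0)
    (fun _ => 1) (Eventually.of_forall fun a => by fun_prop) ?_ (by simp) ?_
  · simpa using h
  · filter_upwards [eventually_ge_atTop 0] with a ha
    filter_upwards [ae_restrict_mem hm0] with v hv
    rw [← ENNReal.ofReal_one]
    refine ENNReal.ofReal_le_ofReal (Real.exp_le_one_iff.mpr ?_)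
    have : 0 < inner ℝ v e := hv
    nlinarith
  · filter_upwards [ae_restrict_mem hm0] with v hv
    rw [← ENNReal.ofReal_zero]
    refine ENNReal.tendsto_ofReal (Real.tendsto_exp_atBot.comp ?_)
    have : 0 < inner ℝ v e := hv
    simpa only [neg_mul, Function.comp_def, id] using
      tendsto_neg_atTop_atBot.comp (tendsto_id.atTop_mul_const this)

/-- The standard normal law puts at most `exp (-s² / 8)` outside a large cube of side `s`. -/
lemma eventually_centredGaussian_tail_le (D : ℕ) :
    ∀ᶠ s : ℝ in atTop, centredGaussian D 1 {v | ∃ i, s / 2 < |v i|} ≤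
      ENNReal.ofReal (Real.exp (-s ^ 2 / 8)) := by
  rcases Nat.eq_zero_or_pos D with rfl | hD
  · exact Eventually.of_forall fun s => by simp
  have hD' : (0 : ℝ≥0∞) < ((2 * D : ℕ) : ℝ≥0∞)⁻¹ :=
    ENNReal.inv_pos.mpr (ENNReal.natCast_ne_top _)
  let e : Fin D → Bool → Vec D := fun i b =>
    if b then EuclideanSpace.single i 1 else -EuclideanSpace.single i 1
  have he : ∀ i b, ‖e i b‖ = 1 := fun i b => by cases b <;> simp [e]
  have hev : ∀ᶠ s : ℝ in atTop, ∀ i b, ∫⁻ v in {v : Vec D | 0 < inner ℝ v (e i b)},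
      ENNReal.ofReal (Real.exp (-(s / 2) * inner ℝ v (e i b))) ∂centredGaussian D 1 ≤
        ((2 * D : ℕ) : ℝ≥0∞)⁻¹ := by
    simp only [eventually_all]
    intro i b
    exact ((tendsto_halfspace_weight (e i b)).comp
      (tendsto_id.atTop_div_const two_pos)).eventually_le_const hD'
  filter_upwards [hev] with s hs
  have hsub : {v : Vec D | ∃ i, s / 2 < |v i|} ⊆
      ⋃ i, ⋃ b, {v | s / 2 < inner ℝ v (e i b)} := by
    rintro v ⟨i, hi⟩
    rw [Set.mem_iUnion]
    refine ⟨i, Set.mem_iUnion.mpr ?_⟩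
    rcases lt_abs.mp hi with h | h
    · exact ⟨true, by simpa [e, PiLp.inner_apply] using h⟩
    · exact ⟨false, by simpa [e, PiLp.inner_apply] using h⟩
  calc _ ≤ centredGaussian D 1 (⋃ i, ⋃ b, {v | s / 2 < inner ℝ v (e i b)}) := measure_mono hsub
    _ ≤ ∑ i, ∑ b, centredGaussian D 1 {v | s / 2 < inner ℝ v (e i b)} :=
        (measure_iUnion_fintype_le _ _).trans
          (Finset.sum_le_sum fun i _ => measure_iUnion_fintype_le _ _)
    _ ≤ ∑ _i : Fin D, ∑ _b : Bool, ENNReal.ofReal (Real.exp (-(s / 2) ^ 2 / 2)) *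
          ((2 * D : ℕ) : ℝ≥0∞)⁻¹ := by
        refine Finset.sum_le_sum fun i _ => Finset.sum_le_sum fun b _ => ?_
        rw [centredGaussian_halfspace _ (he i b)]
        gcongr
        exact hs i b
    _ = ENNReal.ofReal (Real.exp (-s ^ 2 / 8)) * (((2 * D : ℕ) : ℝ≥0∞) *
          ((2 * D : ℕ) : ℝ≥0∞)⁻¹) := by
        rw [show -(s / 2) ^ 2 / 2 = -s ^ 2 / 8 by ring]
        simp only [Finset.sum_const, Finset.card_univ, Fintype.card_bool, Fintype.card_fin,
          nsmul_eq_mul]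
        push_cast
        ring
    _ = _ := by rw [ENNReal.mul_inv_cancel (by simp; omega) (ENNReal.natCast_ne_top _), mul_one]

lemma measurableSet_box (s : ℝ) : MeasurableSet {v : Vec D | ∀ i, |v i| ≤ s} := by
  have : {v : Vec D | ∀ i, |v i| ≤ s} = ⋂ i, {v | |v i| ≤ s} := by ext; simp
  rw [this]
  exact MeasurableSet.iInter fun i => measurableSet_le (by fun_prop) measurable_const

lemma centredGaussian_real_box {σ : ℝ} (hσ : 0 < σ) (s : ℝ) :
    (centredGaussian D σ).real {v | ∀ i, |v i| ≤ s} =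
      1 - (centredGaussian D 1).real {v | ∃ i, s / σ < |v i|} := by
  have := isProbabilityMeasure_centredGaussian (D := D) one_pos
  have h : {v : Vec D | ∃ i, s / σ < |v i|} = {v : Vec D | ∀ i, |v i| ≤ s / σ}ᶜ := by
    ext v; simp
  rw [h, probReal_compl_eq_one_sub (measurableSet_box _), sub_sub_cancel, Measure.real,
    centredGaussian_apply_smul hσ (measurableSet_box s), Measure.real]
  congr 2
  ext v
  simp only [Set.mem_preimage, Set.mem_ofPred_eq, PiLp.smul_apply, smul_eq_mul, abs_mul,
    abs_of_pos hσ, le_div_iff₀' hσ]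

/-- By symmetry, one orthant carries at least the fraction `2⁻ᴰ` of the mass of a cube. -/
lemma centredGaussian_corner_ge {σ : ℝ} (hσ : 0 < σ) (ε : Fin D → ℝ)
    (hε : ∀ i, ε i = 1 ∨ ε i = -1) (s : ℝ) :
    (centredGaussian D σ).real {v | ∀ i, |v i| ≤ s} ≤
      2 ^ D * (centredGaussian D σ).real {v | ∀ i, 0 ≤ ε i * v i ∧ ε i * v i ≤ s} := by
  have := isProbabilityMeasure_centredGaussian (D := D) hσ
  let R : (Fin D → Bool) → (Vec D ≃ₗᵢ[ℝ] Vec D) := fun b =>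
    LinearIsometryEquiv.piLpCongrRight 2 fun i =>
      if b i then LinearIsometryEquiv.refl ℝ ℝ else LinearIsometryEquiv.neg ℝ
  have hR : ∀ b v i, (R b v) i = if b i then v i else -v i := by
    intro b v i
    by_cases hb : b i <;> simp [R, LinearIsometryEquiv.piLpCongrRight_apply, hb]
  set Q := {v : Vec D | ∀ i, 0 ≤ ε i * v i ∧ ε i * v i ≤ s} with hQ
  have hQm : MeasurableSet Q := by
    have : Q = ⋂ i, {v | 0 ≤ ε i * v i ∧ ε i * v i ≤ s} := by ext; simp [hQ]
    rw [this]
    refine MeasurableSet.iInter fun i => ?_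
    have hm : Measurable fun v : Vec D => ε i * v i := by fun_prop
    exact (measurableSet_le measurable_const hm).inter (measurableSet_le hm measurable_const)
  have hinv : ∀ b, centredGaussian D σ (R b ⁻¹' Q) = centredGaussian D σ Q := by
    intro b
    have hmp := (R b).measurePreserving
    rw [centredGaussian, withDensity_apply _ (hmp.measurable hQm), withDensity_apply _ hQm,
      ← hmp.setLIntegral_comp_preimage hQm (by fun_prop)]
    refine lintegral_congr fun v => ?_
    simp [gaussianDensity]
  have hcov : {v : Vec D | ∀ i, |v i| ≤ s} ⊆ ⋃ b, R b ⁻¹' Q := by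
    intro v hv
    refine Set.mem_iUnion.mpr ⟨fun i => decide (0 ≤ ε i * v i), fun i => ?_⟩
    have hvi := abs_le.mp (hv i)
    rw [hR]
    by_cases h : 0 ≤ ε i * v i
    · simp only [h, decide_true, if_true, true_and]
      rcases hε i with h' | h' <;> rw [h'] <;> linarith
    · simp only [h, decide_false, Bool.false_eq_true, if_false]
      push Not at h
      rcases hε i with h' | h' <;> rw [h'] at h ⊢ <;> constructor <;> linarith
  calc (centredGaussian D σ).real {v | ∀ i, |v i| ≤ s}
      ≤ (centredGaussian D σ).real (⋃ b, R b ⁻¹' Q) := measureReal_mono hcov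
    _ ≤ ∑ b, (centredGaussian D σ).real (R b ⁻¹' Q) := measureReal_iUnion_fintype_le _
    _ = 2 ^ D * (centredGaussian D σ).real Q := by
      simp [Measure.real, hinv]

end GaussianMass

/-! ### Riemann sums of the Gaussian density over the cells -/

section Riemann

variable {D : ℕ}

lemma norm_le_sqrt_mul {v : Vec D} {a : ℝ} (ha : 0 ≤ a) (hv : ∀ i, |v i| ≤ a) :
    ‖v‖ ≤ √D * a := by
  rw [EuclideanSpace.norm_eq]
  calc √(∑ i, ‖v i‖ ^ 2) ≤ √(∑ _i : Fin D, a ^ 2) := by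
        refine Real.sqrt_le_sqrt (Finset.sum_le_sum fun i _ => ?_)
        rw [Real.norm_eq_abs]
        exact pow_le_pow_left₀ (abs_nonneg _) (hv i) 2
    _ = √D * a := by
        rw [Finset.sum_const, Finset.card_univ, Fintype.card_fin, nsmul_eq_mul,
          Real.sqrt_mul (by positivity), Real.sqrt_sq ha]

lemma norm_sub_le_of_mem_cell {h : ℝ} {μ u : Vec D} (hu : u ∈ cell h μ) :
    ‖u - μ‖ ≤ √D * (h / 2) := by
  rcases Nat.eq_zero_or_pos D with rfl | hD
  · simp [EuclideanSpace.norm_eq]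
  have h0 : 0 ≤ h / 2 := by have := hu ⟨0, hD⟩; linarith
  refine norm_le_sqrt_mul h0 fun i => ?_
  have := hu i
  rw [PiLp.sub_apply, abs_le]
  constructor <;> linarith

lemma measurableSet_cell (h : ℝ) (μ : Vec D) : MeasurableSet (cell h μ) := by
  have : cell h μ = ⋂ i, {y : Vec D | μ i - h / 2 ≤ y i ∧ y i < μ i + h / 2} := by
    ext; simp [cell]
  rw [this]
  refine MeasurableSet.iInter fun i => ?_
  have hm : Measurable fun v : Vec D => v i := by fun_prop
  exact (measurableSet_le measurable_const hm).inter (measurableSet_lt hm measurable_const)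

/-- Bound for the first absolute moment of the standard normal law; it comes from
`t ≤ √2 exp (t² / 8)`. -/
noncomputable def gaussianMoment (D : ℕ) : ℝ := √2 * (4 / 3 : ℝ) ^ ((D : ℝ) / 2)

/-- Error of a Riemann sum of the Gaussian density over cells whose radius is `ε` times the
bandwidth. -/
noncomputable def riemannError (D : ℕ) (ε : ℝ) : ℝ := ε * gaussianMoment D + ε ^ 2 / 2

lemma le_sqrt_two_mul_exp (t : ℝ) : t ≤ √2 * Real.exp (t ^ 2 / 8) := by
  refine le_of_sq_le_sq ?_ (by positivity)
  rw [mul_pow, Real.sq_sqrt zero_le_two, ← Real.exp_nat_mul]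
  have h := Real.add_one_le_exp (t ^ 2 / 8)
  have h1 : Real.exp ((2 : ℕ) * (t ^ 2 / 8)) = Real.exp (t ^ 2 / 8) ^ 2 := by
    rw [← Real.exp_nat_mul]
  rw [h1]
  nlinarith [sq_nonneg (t ^ 2 / 8 - 1)]

lemma gaussian_moment_aux {σ : ℝ} (hσ : 0 < σ) (y u : Vec D) :
    gaussianDensity u σ y * (‖u - y‖ / σ) ≤ √2 / (2 * Real.pi * σ ^ 2) ^ ((D : ℝ) / 2) *
      Real.exp (-(3 / (8 * σ ^ 2)) * ‖u - y‖ ^ 2) := by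
  have h := le_sqrt_two_mul_exp (‖u - y‖ / σ)
  have hg := gaussianDensity_pos u hσ y
  calc gaussianDensity u σ y * (‖u - y‖ / σ)
      ≤ gaussianDensity u σ y * (√2 * Real.exp ((‖u - y‖ / σ) ^ 2 / 8)) := by gcongr
    _ = √2 / (2 * Real.pi * σ ^ 2) ^ ((D : ℝ) / 2) *
          (Real.exp (-‖u - y‖ ^ 2 / (2 * σ ^ 2)) * Real.exp ((‖u - y‖ / σ) ^ 2 / 8)) := by
        rw [gaussianDensity, norm_sub_rev y u]; ring
    _ = _ := by
        rw [← Real.exp_add]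
        congr 2
        field_simp
        ring

lemma integrable_gaussian_moment_aux {σ : ℝ} (hσ : 0 < σ) (y : Vec D) :
    Integrable (fun u => Real.exp (-(3 / (8 * σ ^ 2)) * ‖u - y‖ ^ 2)) ∧
    ∫ u : Vec D, Real.exp (-(3 / (8 * σ ^ 2)) * ‖u - y‖ ^ 2) =
      (Real.pi / (3 / (8 * σ ^ 2))) ^ ((D : ℝ) / 2) := by
  have h := GaussianFourier.integral_rexp_neg_mul_sq_norm (V := Vec D)
    (b := 3 / (8 * σ ^ 2)) (by positivity)
  rw [← integral_sub_right_eq_self (fun v : Vec D => Real.exp (-(3 / (8 * σ ^ 2)) * ‖v‖ ^ 2)) y,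
    finrank_euclideanSpace, Fintype.card_fin] at h
  exact ⟨Integrable.of_integral_ne_zero (by rw [h]; positivity), h⟩

/-- Mean distance from the centre, in units of the bandwidth. -/
lemma gaussian_moment {σ : ℝ} (hσ : 0 < σ) (y : Vec D) :
    Integrable (fun u => gaussianDensity u σ y * (‖u - y‖ / σ)) ∧
    ∫ u, gaussianDensity u σ y * (‖u - y‖ / σ) ≤ gaussianMoment D := by
  obtain ⟨h1, h2⟩ := integrable_gaussian_moment_aux hσ y
  have h1' := h1.const_mul (√2 / (2 * Real.pi * σ ^ 2) ^ ((D : ℝ) / 2))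
  have hc : Continuous fun u => gaussianDensity u σ y * (‖u - y‖ / σ) := by
    unfold gaussianDensity; fun_prop
  have hint : Integrable (fun u => gaussianDensity u σ y * (‖u - y‖ / σ)) := by
    refine h1'.mono' hc.aestronglyMeasurable (ae_of_all _ fun u => ?_)
    rw [Real.norm_of_nonneg (mul_nonneg (gaussianDensity_pos u hσ y).le (by positivity))]
    exact gaussian_moment_aux hσ y u
  refine ⟨hint, (integral_mono hint h1' fun u => gaussian_moment_aux hσ y u).trans (le_of_eq ?_)⟩
  rw [integral_const_mul, h2, gaussianMoment, div_mul_eq_mul_div, mul_div_assoc,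
    ← Real.div_rpow (by positivity) (by positivity)]
  congr 2
  field_simp
  norm_num

lemma integrable_gaussianDensity_left {σ : ℝ} (hσ : 0 < σ) (y : Vec D) :
    Integrable (fun u => gaussianDensity u σ y) ∧ ∫ u, gaussianDensity u σ y = 1 := by
  have e : (fun u => gaussianDensity u σ y) = gaussianDensity y σ := by
    ext u; simp [gaussianDensity, norm_sub_rev]
  rw [e]
  exact ⟨integrable_gaussianDensity y hσ, integral_gaussianDensity y hσ⟩

/-- Moving the centre within a cell. -/
lemma gaussianDensity_ge_of_mem_cell {h σ : ℝ} (hσ : 0 < σ) {μ u : Vec D}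
    (hu : u ∈ cell h μ) (y : Vec D) :
    gaussianDensity u σ y - (√D * (h / 2) / σ * (gaussianDensity u σ y * (‖u - y‖ / σ)) +
      (√D * (h / 2) / σ) ^ 2 / 2 * gaussianDensity u σ y) ≤ gaussianDensity μ σ y := by
  set η := √D * (h / 2)
  have hη : ‖u - μ‖ ≤ η := norm_sub_le_of_mem_cell hu
  have hη0 : 0 ≤ η := (norm_nonneg _).trans hη
  have htri : ‖y - μ‖ ≤ ‖u - y‖ + η := by
    calc ‖y - μ‖ = ‖(u - μ) - (u - y)‖ := by congr 1; abel
      _ ≤ ‖u - μ‖ + ‖u - y‖ := norm_sub_le _ _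
      _ ≤ _ := by linarith
  have hsq : ‖y - μ‖ ^ 2 ≤ (‖u - y‖ + η) ^ 2 := pow_le_pow_left₀ (norm_nonneg _) htri 2
  have hexp : Real.exp (-‖u - y‖ ^ 2 / (2 * σ ^ 2)) *
      (1 - (η / σ * (‖u - y‖ / σ) + (η / σ) ^ 2 / 2)) ≤ Real.exp (-‖y - μ‖ ^ 2 / (2 * σ ^ 2)) := by
    have h1 := Real.add_one_le_exp (-(η / σ * (‖u - y‖ / σ) + (η / σ) ^ 2 / 2))
    calc _ ≤ Real.exp (-‖u - y‖ ^ 2 / (2 * σ ^ 2)) *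
          Real.exp (-(η / σ * (‖u - y‖ / σ) + (η / σ) ^ 2 / 2)) := by gcongr; linarith
      _ = Real.exp (-(‖u - y‖ + η) ^ 2 / (2 * σ ^ 2)) := by
          rw [← Real.exp_add]; congr 1; field_simp; ring
      _ ≤ _ := by gcongr
  have hZ : 0 < (2 * Real.pi * σ ^ 2) ^ ((D : ℝ) / 2) := by positivity
  calc _ = Real.exp (-‖u - y‖ ^ 2 / (2 * σ ^ 2)) *
      (1 - (η / σ * (‖u - y‖ / σ) + (η / σ) ^ 2 / 2)) / (2 * Real.pi * σ ^ 2) ^ ((D : ℝ) / 2) := by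
        rw [gaussianDensity, norm_sub_rev y u]; ring
    _ ≤ _ := by unfold gaussianDensity; gcongr

/-- Lower bound for a mixture over disjoint cells, at a point `y` close to a set `S` covered by
the cells on which the mixed density is at least `b`. -/
lemma mixture_ge {m : ℕ} {c : Fin m → Vec D} {h σ : ℝ} (hσ : 0 < σ) (hh : 0 < h)
    (hdisj : Pairwise fun j k => Disjoint (cell h (c j)) (cell h (c k)))
    {S : Set (Vec D)} (hS : MeasurableSet S) (hSc : S ⊆ ⋃ j, cell h (c j))
    {f : Vec D → ℝ} (hf : Integrable f) (hf0 : ∀ u, 0 ≤ f u) {b : ℝ} (hb : 0 ≤ b)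
    (hfb : ∀ u ∈ S, b ≤ f u) (y : Vec D) :
    b * ((∫ u in S, gaussianDensity u σ y) - riemannError D (√D * (h / 2) / σ)) ≤
      ∑ j, (∫ u in cell h (c j), f u) * gaussianDensity (c j) σ y := by
  set ε := √D * (h / 2) / σ with hε
  have hε0 : 0 ≤ ε := by positivity
  obtain ⟨i1, i1'⟩ := integrable_gaussianDensity_left hσ y
  obtain ⟨i2, i2'⟩ := gaussian_moment hσ y
  set ψ' : Vec D → ℝ := fun u => ε * (gaussianDensity u σ y * (‖u - y‖ / σ)) +
    ε ^ 2 / 2 * gaussianDensity u σ y with hψ'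
  have iψ' : Integrable ψ' := (i2.const_mul _).add (i1.const_mul _)
  set ψ : Vec D → ℝ := fun u => gaussianDensity u σ y - ψ' u with hψ
  have iψ : Integrable ψ := i1.sub iψ'
  have hAm : ∀ j, MeasurableSet (cell h (c j) ∩ S) := fun j => (measurableSet_cell _ _).inter hS
  -- `ψ` is a lower bound for the kernel at the centre of the cell, integrable over the whole space
  have hterm : ∀ j, ∫ u in cell h (c j) ∩ S, b * ψ u ≤
      (∫ u in cell h (c j), f u) * gaussianDensity (c j) σ y := by
    intro j
    have hg := gaussianDensity_pos (c j) hσ y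
    calc ∫ u in cell h (c j) ∩ S, b * ψ u
        ≤ ∫ u in cell h (c j) ∩ S, f u * gaussianDensity (c j) σ y := by
          refine setIntegral_mono_on (iψ.const_mul b).integrableOn
            (hf.mul_const _).integrableOn (hAm j) fun u hu => ?_
          have h1 := gaussianDensity_ge_of_mem_cell hσ hu.1 y
          exact (mul_le_mul_of_nonneg_left h1 hb).trans
            (mul_le_mul_of_nonneg_right (hfb u hu.2) hg.le)
      _ = (∫ u in cell h (c j) ∩ S, f u) * gaussianDensity (c j) σ y := integral_mul_const _ _
      _ ≤ _ := by
          refine mul_le_mul_of_nonneg_right ?_ hg.le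
          exact setIntegral_mono_set hf.integrableOn (ae_of_all _ hf0)
            (LE.le.eventuallyLE Set.inter_subset_left)
  have hsum : ∫ u in S, b * ψ u = ∑ j, ∫ u in cell h (c j) ∩ S, b * ψ u := by
    rw [← integral_iUnion_fintype hAm
      (fun j k hjk => (hdisj hjk).mono Set.inter_subset_left Set.inter_subset_left)
      fun j => (iψ.const_mul b).integrableOn, ← Set.iUnion_inter, Set.inter_eq_right.mpr hSc]
  refine le_trans ?_ (Finset.sum_le_sum fun j _ => hterm j)
  rw [← hsum, integral_const_mul]
  refine mul_le_mul_of_nonneg_left ?_ hb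
  have h3 : ∫ u in S, ψ' u ≤ riemannError D ε := by
    calc ∫ u in S, ψ' u ≤ ∫ u, ψ' u := by
          refine setIntegral_le_integral iψ' (ae_of_all _ fun u => ?_)
          have := (gaussianDensity_pos u hσ y).le
          simp only [hψ', Pi.zero_apply]
          positivity
      _ = ε * (∫ u, gaussianDensity u σ y * (‖u - y‖ / σ)) + ε ^ 2 / 2 := by
          rw [hψ', integral_add (i2.const_mul _) (i1.const_mul _), integral_const_mul,
            integral_const_mul, i1', mul_one]
      _ ≤ _ := by unfold riemannError; gcongr
  rw [hψ, integral_sub i1.integrableOn iψ'.integrableOn]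
  linarith

end Riemann

/-! ### Local oscillation of a density -/

section Oscillation

variable {D d : ℕ} {f : (Fin d → ℝ) → Vec D → ℝ} {z : Fin d → ℝ}

lemma norm_sub_le_of_mem_cube {ρ : ℝ} (hρ : 0 ≤ ρ) {u y : Vec D} (hu : u ∈ cube ρ y) :
    ‖u - y‖ ≤ ρ * √D / 2 := by
  refine (norm_le_sqrt_mul (a := ρ / 2) (by positivity) fun i => ?_).trans (le_of_eq (by ring))
  exact hu i

/-- A nonnegative `C¹` function whose logarithm has gradient at most `S` on a cube varies at most
by the factor `exp (S ‖u - y‖)`. At its zeros the function has a vanishing derivative, so the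
differential inequality `|g'| ≤ S ‖u - y‖ g` holds along the whole segment. -/
lemma le_exp_mul_of_gradient_le {g : Vec D → ℝ} (hg : ContDiff ℝ 1 g) (hg0 : ∀ u, 0 ≤ g u)
    {ρ S : ℝ} {y u : Vec D} (hu : u ∈ cube ρ y)
    (hS : ∀ v ∈ cube ρ y, ‖gradient (fun v => Real.log (g v)) v‖ ≤ S) :
    g y ≤ Real.exp (S * ‖u - y‖) * g u := by
  have hd : Differentiable ℝ g := hg.differentiable one_ne_zero
  set w := u - y with hw
  have hmem : ∀ t ∈ Set.Icc (0 : ℝ) 1, y + t • w ∈ cube ρ y := by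
    intro t ht i
    have h := hu i
    simp only [hw, PiLp.add_apply, PiLp.smul_apply, PiLp.sub_apply, smul_eq_mul,
      add_sub_cancel_left, abs_mul, abs_of_nonneg ht.1]
    exact (mul_le_of_le_one_left (abs_nonneg _) ht.2).trans h
  have hder : ∀ v ∈ cube ρ y, |fderiv ℝ g v w| ≤ S * ‖w‖ * g v := by
    intro v hv
    rcases (hg0 v).eq_or_lt with h0 | h0
    · have hmin : IsLocalMin g v := Eventually.of_forall fun x => by rw [← h0]; exact hg0 x
      rw [hmin.fderiv_eq_zero, ← h0]
      simp
    · have h1 := hS v hv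
      rw [gradient, LinearIsometryEquiv.norm_map,
        ((hd v).hasFDerivAt.log h0.ne').fderiv, norm_smul, Real.norm_eq_abs, abs_inv,
        abs_of_pos h0, inv_mul_le_iff₀ h0] at h1
      calc |fderiv ℝ g v w| ≤ ‖fderiv ℝ g v‖ * ‖w‖ := (fderiv ℝ g v).le_opNorm w
        _ ≤ g v * S * ‖w‖ := by gcongr
        _ = _ := by ring
  set G : ℝ → ℝ := fun t => Real.exp (S * ‖w‖ * t) * g (y + t • w) with hG
  have hline : ∀ t : ℝ, HasDerivAt (fun t : ℝ => y + t • w) w t := fun t => by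
    simpa using ((hasDerivAt_id t).smul_const w).const_add y
  have hGd : ∀ t, HasDerivAt G (Real.exp (S * ‖w‖ * t) * (S * ‖w‖) * g (y + t • w) +
      Real.exp (S * ‖w‖ * t) * fderiv ℝ g (y + t • w) w) t := fun t => by
    have h1 : HasDerivAt (fun t : ℝ => Real.exp (S * ‖w‖ * t))
        (Real.exp (S * ‖w‖ * t) * (S * ‖w‖)) t := by
      simpa using ((hasDerivAt_id t).const_mul (S * ‖w‖)).exp
    exact h1.mul ((hd _).hasFDerivAt.comp_hasDerivAt t (hline t))
  have hmono : MonotoneOn G (Set.Icc 0 1) := by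
    refine monotoneOn_of_deriv_nonneg (convex_Icc 0 1)
      (fun t _ => (hGd t).continuousAt.continuousWithinAt)
      (fun t _ => (hGd t).differentiableAt.differentiableWithinAt) fun t ht => ?_
    rw [interior_Icc] at ht
    rw [(hGd t).deriv]
    have h1 := (abs_le.mp (hder _ (hmem t ⟨ht.1.le, ht.2.le⟩))).1
    have h2 := Real.exp_pos (S * ‖w‖ * t)
    nlinarith
  have h := hmono ⟨le_rfl, zero_le_one⟩ ⟨zero_le_one, le_rfl⟩ zero_le_one
  simpa [hG, hw] using h

lemma le_exp_mul_of_gradSup (hf0 : ∀ y, 0 ≤ f z y) (hc : ContDiff ℝ 1 (f z)) {ρ : ℝ}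
    (hρ : 0 ≤ ρ) {y : Vec D} (hfin : gradSup f ρ z y ≠ ∞) {u : Vec D} (hu : u ∈ cube ρ y) :
    f z y ≤ Real.exp (ρ * √D / 2 * (gradSup f ρ z y).toReal) * f z u := by
  refine (le_exp_mul_of_gradient_le hc hf0 hu (S := (gradSup f ρ z y).toReal)
    fun v hv => ?_).trans ?_
  · rw [← toReal_enorm]
    exact ENNReal.toReal_mono hfin (le_iSup₂_of_le v hv le_rfl)
  · refine mul_le_mul_of_nonneg_right (Real.exp_le_exp.mpr ?_) (hf0 u)
    rw [mul_comm]
    gcongr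
    exact norm_sub_le_of_mem_cube hρ hu

/-- The defining property of the local oscillation, for both of its forms. -/
lemma le_exp_localOsc_mul (hD : 1 ≤ D) (hf0 : ∀ y, 0 ≤ f z y) {c1 : Bool}
    (hc : c1 = true → ContDiff ℝ 1 (f z)) {ρ : ℝ} (hρ : 0 < ρ) {y : Vec D} (hy : 0 < f z y)
    (hfin : localOsc c1 f ρ z y ≠ ∞) {u : Vec D} (hu : u ∈ cube ρ y) :
    f z y ≤ Real.exp (localOsc c1 f ρ z y).toReal * f z u := by
  cases c1 with
  | true =>
    have hD' : (0 : ℝ) < D := by exact_mod_cast hD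
    have hpos : 0 < ρ * √D / 2 := by positivity
    simp only [localOsc, if_true] at hfin ⊢
    have hfin' : gradSup f ρ z y ≠ ∞ := fun h => hfin (by
      rw [h, ENNReal.mul_top]
      rw [Ne, ENNReal.ofReal_eq_zero, not_le]
      exact hpos)
    rw [ENNReal.toReal_mul, ENNReal.toReal_ofReal hpos.le]
    exact le_exp_mul_of_gradSup hf0 (hc rfl) hρ.le hfin' hu
  | false =>
    simp only [localOsc, Bool.false_eq_true, if_false] at hfin ⊢
    set I := ⨅ u ∈ cube ρ y, ENNReal.ofReal (f z u) with hI
    have hIu : I ≤ ENNReal.ofReal (f z u) := iInf₂_le u hu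
    have hlog : ENNReal.log (ENNReal.ofReal (f z y) / I) ≠ ⊤ := fun h => hfin (by rw [h]; rfl)
    have hdiv : ENNReal.ofReal (f z y) / I ≠ ∞ := fun h => hlog (by rw [h]; rfl)
    have hI0 : I ≠ 0 := fun h => hdiv (by
      rw [h, ENNReal.div_zero]
      rw [Ne, ENNReal.ofReal_eq_zero, not_le]
      exact hy)
    set L := (ENNReal.log (ENNReal.ofReal (f z y) / I)).toENNReal with hL
    have h1 : ENNReal.ofReal (f z y) / I ≤ ENNReal.ofReal (Real.exp L.toReal) := by
      have h2 : ENNReal.log (ENNReal.ofReal (f z y) / I) ≤ (L.toReal : EReal) := by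
        have h3 : ((L.toReal : ℝ) : EReal) = (L : EReal) := by
          conv_rhs => rw [← ENNReal.ofReal_toReal hfin, EReal.coe_ennreal_ofReal,
            max_eq_left ENNReal.toReal_nonneg]
        rw [h3, hL, EReal.coe_toENNReal_eq_max]
        exact le_max_right _ _
      have h3 := EReal.exp_monotone h2
      rwa [ENNReal.exp_log, EReal.exp_coe] at h3
    have h4 : ENNReal.ofReal (f z y) ≤ ENNReal.ofReal (Real.exp L.toReal * f z u) := by
      rw [ENNReal.ofReal_mul (Real.exp_pos _).le]
      have hIt : I ≠ ∞ := (hIu.trans_lt ENNReal.ofReal_lt_top).ne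
      calc ENNReal.ofReal (f z y) = ENNReal.ofReal (f z y) / I * I :=
            (ENNReal.div_mul_cancel hI0 hIt).symm
        _ ≤ _ := by gcongr
    exact (ENNReal.ofReal_le_ofReal_iff (mul_nonneg (Real.exp_pos _).le (hf0 u))).mp h4

end Oscillation

/-! ### Softmax mixtures with exact and with perturbed log-odds -/

section Mixture

variable {D d : ℕ} {r : ℝ} (P : PartitionData D r)

lemma PartitionData.disjoint_cell (n : ℕ) : Pairwise fun j k =>
    Disjoint (cell (P.side n) (P.center n j)) (cell (P.side n) (P.center n k)) := by
  intro j k hjk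
  refine Set.disjoint_left.mpr fun u hj hk => hjk (P.center_injective n ?_)
  obtain ⟨o, ho⟩ := P.grid n
  obtain ⟨a, ha⟩ := ho j
  obtain ⟨b, hb⟩ := ho k
  have hh := P.side_pos n
  ext i
  have h1 := hj i
  have h2 := hk i
  rw [ha i] at h1 ⊢
  rw [hb i] at h2 ⊢
  have h3 : ((a i - b i : ℤ) : ℝ) < 1 := by
    push_cast; by_contra hc; push Not at hc; nlinarith
  have h4 : ((b i - a i : ℤ) : ℝ) < 1 := by
    push_cast; by_contra hc; push Not at hc; nlinarith
  have h3' : a i - b i < 1 := by exact_mod_cast h3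
  have h4' : b i - a i < 1 := by exact_mod_cast h4
  rw [show a i = b i by omega]

lemma PartitionData.measurableSet_remainder (n : ℕ) : MeasurableSet (P.remainder n) :=
  (MeasurableSet.iUnion fun _ => measurableSet_cell _ _).compl

/-- The Gaussian mixture weighted by the exact cell probabilities of the density `g`. -/
noncomputable def exactMixture (n : ℕ) (g : Vec D → ℝ) (y : Vec D) : ℝ :=
  (∑ j, (∫ u in cell (P.side n) (P.center n j), g u) *
      gaussianDensity (P.center n j) (P.sigma n) y) +
    (∫ u in P.remainder n, g u) * gaussianDensity 0 P.sigmaZero y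

/-- `g` is a probability density that charges every set of the `n`-th partition. -/
structure IsChargingDensity (n : ℕ) (g : Vec D → ℝ) : Prop where
  nonneg : ∀ y, 0 ≤ g y
  integrable : Integrable g
  integral_eq_one : ∫ y, g y = 1
  cell_pos : ∀ j, 0 < ∫ y in cell (P.side n) (P.center n j), g y
  remainder_pos : 0 < ∫ y in P.remainder n, g y

variable {P} {n : ℕ} {g : Vec D → ℝ}

lemma IsChargingDensity.sum_eq_one (hg : IsChargingDensity P n g) :
    (∫ u in P.remainder n, g u) + ∑ j, ∫ u in cell (P.side n) (P.center n j), g u = 1 := by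
  rw [← integral_iUnion_fintype (fun j => measurableSet_cell _ _) (P.disjoint_cell n)
    fun j => hg.integrable.integrableOn, ← hg.integral_eq_one, add_comm]
  exact integral_add_compl (MeasurableSet.iUnion fun _ => measurableSet_cell _ _) hg.integrable

lemma exactMixture_pos (hg : IsChargingDensity P n g) (y : Vec D) : 0 < exactMixture P n g y := by
  refine add_pos_of_nonneg_of_pos (Finset.sum_nonneg fun j _ => mul_nonneg (hg.cell_pos j).le
    (gaussianDensity_pos _ (P.sigma_pos n) y).le) (mul_pos hg.remainder_pos
    (gaussianDensity_pos _ P.sigmaZero_pos y))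

/-- The softmax of the exact log-odds gives the exact cell probabilities. -/
lemma mixtureDensity_logOdds {f : (Fin d → ℝ) → Vec D → ℝ} {z : Fin d → ℝ}
    (hg : IsChargingDensity P n (f z)) (y : Vec D) :
    mixtureDensity P n (fun j => P.logOdds f n j z) y = exactMixture P n (f z) y := by
  have h0 := hg.remainder_pos
  have he : ∀ j, Real.exp (P.logOdds f n j z) =
      (∫ u in cell (P.side n) (P.center n j), f z u) / ∫ u in P.remainder n, f z u := fun j =>
    Real.exp_log (div_pos (hg.cell_pos j) h0)
  have hs : 1 + ∑ k, Real.exp (P.logOdds f n k z) = 1 / ∫ u in P.remainder n, f z u := by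
    simp_rw [he]
    rw [← Finset.sum_div, eq_div_iff h0.ne', add_mul, div_mul_cancel₀ _ h0.ne', one_mul,
      hg.sum_eq_one]
  unfold mixtureDensity exactMixture
  rw [hs]
  simp_rw [he]
  congr 1
  · refine Finset.sum_congr rfl fun j _ => ?_
    congr 1
    field_simp
  · rw [one_div_one_div]

/-- Logits that are uniformly `ε`-close give mixtures within a factor `exp (2 ε)`. -/
lemma mixtureDensity_le_exp_mul {u a : Fin (P.size n) → ℝ} {ε : ℝ} (h : ∀ j, |a j - u j| ≤ ε)
    (y : Vec D) : mixtureDensity P n u y ≤ Real.exp (2 * ε) * mixtureDensity P n a y := by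
  have hε : 0 ≤ ε := (abs_nonneg _).trans (h ⟨0, P.size_pos n⟩)
  have hsum0 : ∀ v : Fin (P.size n) → ℝ, 0 < 1 + ∑ k, Real.exp (v k) := fun v =>
    add_pos_of_pos_of_nonneg one_pos (Finset.sum_nonneg fun k _ => (Real.exp_pos _).le)
  have hsum : 1 + ∑ k, Real.exp (a k) ≤ Real.exp ε * (1 + ∑ k, Real.exp (u k)) := by
    rw [mul_add, mul_one, Finset.mul_sum]
    refine add_le_add (Real.one_le_exp hε) (Finset.sum_le_sum fun k _ => ?_)
    rw [← Real.exp_add]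
    exact Real.exp_le_exp.mpr (by linarith [(abs_le.mp (h k)).2])
  have key : ∀ x x' : ℝ, 0 ≤ x → x ≤ Real.exp ε * x' → x / (1 + ∑ k, Real.exp (u k)) ≤
      Real.exp (2 * ε) * (x' / (1 + ∑ k, Real.exp (a k))) := by
    intro x x' hx0 hx
    rw [← mul_div_assoc, div_le_div_iff₀ (hsum0 u) (hsum0 a), two_mul, Real.exp_add]
    have hx1 : 0 ≤ Real.exp ε * x' := hx0.trans hx
    calc x * (1 + ∑ k, Real.exp (a k))
        ≤ (Real.exp ε * x') * (Real.exp ε * (1 + ∑ k, Real.exp (u k))) := by gcongr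
      _ = _ := by ring
  unfold mixtureDensity
  rw [mul_add, Finset.mul_sum]
  refine add_le_add (Finset.sum_le_sum fun j _ => ?_) ?_
  · rw [← mul_assoc]
    refine mul_le_mul_of_nonneg_right (key _ _ (Real.exp_pos _).le ?_)
      (gaussianDensity_pos _ (P.sigma_pos n) y).le
    rw [← Real.exp_add]
    exact Real.exp_le_exp.mpr (by linarith [(abs_le.mp (h j)).1])
  · rw [← mul_assoc]
    refine mul_le_mul_of_nonneg_right (key _ _ zero_le_one ?_)
      (gaussianDensity_pos _ P.sigmaZero_pos y).le
    rw [mul_one]; exact Real.one_le_exp hε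

/-- The log-likelihood ratio of the neural mixture exceeds that of the exact mixture by at most
twice the logit error. -/
lemma ofReal_log_div_mixtureDensity_le {f : (Fin d → ℝ) → Vec D → ℝ} {z : Fin d → ℝ}
    {K : Set (Fin d → ℝ)} (hz : z ∈ K) (hg : IsChargingDensity P n (f z))
    (a : ReLUNet d (P.size n)) (y : Vec D) :
    ENNReal.ofReal (Real.log (f z y / mixtureDensity P n (a.eval z) y)) ≤
      ENNReal.ofReal (Real.log (f z y / exactMixture P n (f z) y)) + 2 * logitError P f K n a := by
  by_cases hfin : logitError P f K n a = ∞
  · simp [hfin]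
  rcases (hg.nonneg y).eq_or_lt with h0 | h0
  · simp [← h0]
  set ε := (logitError P f K n a).toReal with hε
  have hclose : ∀ j, |a.eval z j - P.logOdds f n j z| ≤ ε := fun j => by
    rw [← Real.norm_eq_abs, ← toReal_enorm]
    exact ENNReal.toReal_mono hfin (le_iSup_of_le j (le_iSup₂_of_le z hz le_rfl))
  have h1 := mixtureDensity_le_exp_mul hclose y
  rw [mixtureDensity_logOdds hg] at h1
  have hm := mixtureDensity_pos P n (a.eval z) y
  have hx := exactMixture_pos hg y
  have e : 2 * logitError P f K n a = ENNReal.ofReal (2 * ε) := by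
    rw [ENNReal.ofReal_mul zero_le_two, hε, ENNReal.ofReal_toReal hfin]; simp
  rw [e]
  refine (ENNReal.ofReal_le_ofReal ?_).trans ENNReal.ofReal_add_le
  rw [Real.log_div h0.ne' hm.ne', Real.log_div h0.ne' hx.ne']
  have h2 := Real.log_le_log hx h1
  rw [Real.log_mul (Real.exp_pos _).ne' hm.ne', Real.log_exp] at h2
  linarith

end Mixture

/-! ### Volumes of boxes, cells and remainder sets -/

section Volume

variable {D : ℕ}

lemma volume_setOf_forall_mem (s : Fin D → Set ℝ) :
    volume {u : Vec D | ∀ i, u i ∈ s i} = ∏ i, volume (s i) := by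
  have h := (EuclideanSpace.volume_preserving_symm_measurableEquiv_toLp (Fin D)).symm
  have e : {u : Vec D | ∀ i, u i ∈ s i} =
      (MeasurableEquiv.toLp 2 (Fin D → ℝ)).symm ⁻¹' (Set.univ.pi s) := by
    ext u; simp [Set.mem_pi]
  rw [e, (EuclideanSpace.volume_preserving_symm_measurableEquiv_toLp (Fin D)).measure_preimage_equiv,
    volume_pi_pi]

lemma volume_cube (ρ : ℝ) (y : Vec D) : volume (cube ρ y) = ENNReal.ofReal ρ ^ D := by
  have e : cube ρ y = {u : Vec D | ∀ i, u i ∈ Set.Icc (y i - ρ / 2) (y i + ρ / 2)} := by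
    ext u
    refine forall_congr' fun i => ?_
    rw [Set.mem_Icc, abs_le]
    constructor <;> rintro ⟨h1, h2⟩ <;> constructor <;> linarith
  rw [e, volume_setOf_forall_mem]
  simp

lemma volume_corner {ε : Fin D → ℝ} (hε : ∀ i, ε i = 1 ∨ ε i = -1) (ℓ : ℝ) (y : Vec D) :
    volume {u : Vec D | ∀ i, 0 ≤ ε i * (u i - y i) ∧ ε i * (u i - y i) ≤ ℓ} =
      ENNReal.ofReal ℓ ^ D := by
  have e : {u : Vec D | ∀ i, 0 ≤ ε i * (u i - y i) ∧ ε i * (u i - y i) ≤ ℓ} =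
      {u : Vec D | ∀ i, u i ∈ {t : ℝ | 0 ≤ ε i * (t - y i) ∧ ε i * (t - y i) ≤ ℓ}} := rfl
  have h : ∀ i, volume {t : ℝ | 0 ≤ ε i * (t - y i) ∧ ε i * (t - y i) ≤ ℓ} =
      ENNReal.ofReal ℓ := by
    intro i
    rcases hε i with h | h
    · have : {t : ℝ | 0 ≤ ε i * (t - y i) ∧ ε i * (t - y i) ≤ ℓ} = Set.Icc (y i) (y i + ℓ) := by
        ext t; rw [h]; constructor <;> rintro ⟨h1, h2⟩ <;> constructor <;> linarith
      rw [this, Real.volume_Icc]; congr 1; ring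
    · have : {t : ℝ | 0 ≤ ε i * (t - y i) ∧ ε i * (t - y i) ≤ ℓ} = Set.Icc (y i - ℓ) (y i) := by
        ext t; rw [h]; constructor <;> rintro ⟨h1, h2⟩ <;> constructor <;> linarith
      rw [this, Real.volume_Icc]; congr 1; ring
  rw [e, volume_setOf_forall_mem]
  simp [h]

lemma volume_cell (h : ℝ) (μ : Vec D) : volume (cell h μ) = ENNReal.ofReal h ^ D := by
  have e : cell h μ = {u : Vec D | ∀ i, u i ∈ Set.Ico (μ i - h / 2) (μ i + h / 2)} := rfl
  rw [e, volume_setOf_forall_mem]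
  simp

lemma PartitionData.volume_cell_ne_zero {r : ℝ} (P : PartitionData D r) (n : ℕ)
    (j : Fin (P.size n)) : volume (cell (P.side n) (P.center n j)) ≠ 0 := by
  rw [volume_cell]
  exact pow_ne_zero _ (by simpa using P.side_pos n)

lemma PartitionData.volume_remainder_ne_zero (hD : 1 ≤ D) {r : ℝ} (P : PartitionData D r)
    (n : ℕ) : volume (P.remainder n) ≠ 0 := by
  have : Nonempty (Fin D) := ⟨⟨0, hD⟩⟩
  intro h0
  have hfin : volume (⋃ j, cell (P.side n) (P.center n j)) < ∞ := by
    refine (measure_iUnion_fintype_le _ _).trans_lt (ENNReal.sum_lt_top.mpr fun j _ => ?_)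
    rw [volume_cell]
    exact ENNReal.pow_lt_top ENNReal.ofReal_lt_top
  have huniv : volume (Set.univ : Set (Vec D)) = ∞ := measure_univ_of_isAddLeftInvariant _
  rw [← Set.union_compl_self (⋃ j, cell (P.side n) (P.center n j))] at huniv
  exact ((measure_union_le _ _).trans_lt (ENNReal.add_lt_top.mpr
    ⟨hfin, h0 ▸ ENNReal.zero_lt_top⟩)).ne huniv

lemma measurableSet_cube (ρ : ℝ) (y : Vec D) : MeasurableSet (cube ρ y) := by
  have e : cube ρ y = (fun u => u - y) ⁻¹' {v : Vec D | ∀ i, |v i| ≤ ρ / 2} := rfl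
  rw [e]
  exact (measurableSet_box _).preimage (by fun_prop)

lemma measurableSet_corner (ε : Fin D → ℝ) (ℓ : ℝ) (y : Vec D) :
    MeasurableSet {u : Vec D | ∀ i, 0 ≤ ε i * (u i - y i) ∧ ε i * (u i - y i) ≤ ℓ} := by
  have : {u : Vec D | ∀ i, 0 ≤ ε i * (u i - y i) ∧ ε i * (u i - y i) ≤ ℓ} =
      ⋂ i, {u | 0 ≤ ε i * (u i - y i) ∧ ε i * (u i - y i) ≤ ℓ} := by ext; simp
  rw [this]
  refine MeasurableSet.iInter fun i => ?_
  have hm : Measurable fun v : Vec D => ε i * (v i - y i) := by fun_prop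
  exact (measurableSet_le measurable_const hm).inter (measurableSet_le hm measurable_const)

lemma corner_subset_cube {ε : Fin D → ℝ} (hε : ∀ i, ε i = 1 ∨ ε i = -1) (r : ℝ) (y : Vec D) :
    {u : Vec D | ∀ i, 0 ≤ ε i * (u i - y i) ∧ ε i * (u i - y i) ≤ r / 2} ⊆ cube r y := by
  intro u hu i
  have h := hu i
  rw [abs_le]
  rcases hε i with h' | h' <;> rw [h'] at h <;> constructor <;> linarith [h.1, h.2]

end Volume

/-! ### The exact mixture compared with the density -/

section Limits

variable {D : ℕ} {r : ℝ} (P : PartitionData D r)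

lemma PartitionData.tendsto_delta_div_sigma :
    Tendsto (fun n => P.delta n / P.sigma n) atTop atTop := by
  have h : Tendsto (fun n => P.sigma n / P.delta n) atTop (𝓝[>] 0) :=
    tendsto_nhdsWithin_iff.mpr ⟨P.tendsto_sigma_div_delta,
      Eventually.of_forall fun n => div_pos (P.sigma_pos n) (P.delta_pos n)⟩
  refine h.inv_tendsto_nhdsGT_zero.congr fun n => ?_
  rw [Pi.inv_apply, inv_div]

lemma PartitionData.tendsto_sigma : Tendsto P.sigma atTop (𝓝 0) := by
  have h := P.tendsto_sigma_div_delta.mul P.tendsto_delta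
  rw [mul_zero] at h
  exact h.congr fun n => div_mul_cancel₀ _ (P.delta_pos n).ne'

/-- Consequence of the Riemann condition, as `δ / σ → ∞`. -/
lemma PartitionData.tendsto_side_div_sigma (hD : 1 ≤ D) :
    Tendsto (fun n => P.side n / P.sigma n) atTop (𝓝 0) := by
  have h := P.tendsto_riemann.mul (P.tendsto_sigma_div_delta.pow (D - 1))
  rw [zero_mul] at h
  refine h.congr fun n => ?_
  have h1 := (P.delta_pos n).ne'
  have h2 := (P.sigma_pos n).ne'
  have h3 : P.sigma n ^ D = P.sigma n ^ (D - 1) * P.sigma n := by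
    rw [← pow_succ, Nat.sub_add_cancel hD]
  rw [h3, div_pow]
  field_simp

lemma PartitionData.tendsto_riemannError (hD : 1 ≤ D) :
    Tendsto (fun n => riemannError D (√D * (P.side n / 2) / P.sigma n)) atTop (𝓝 0) := by
  have h := (P.tendsto_side_div_sigma hD).const_mul (√D / 2)
  rw [mul_zero] at h
  have h' : Tendsto (fun n => √D * (P.side n / 2) / P.sigma n) atTop (𝓝 0) :=
    h.congr fun n => by ring
  have := (h'.mul_const (gaussianMoment D)).add ((h'.pow 2).div_const 2)
  simpa [riemannError] using this

/-- The explicit Riemann term dominates twice the error of the Riemann sums. -/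
lemma PartitionData.eventually_riemannError_le (hD : 1 ≤ D) : ∀ᶠ n in atTop,
    2 * riemannError D (√D * (P.side n / 2) / P.sigma n) ≤
      6 * (D : ℝ) ^ (3 / 2 : ℝ) * P.delta n ^ (D - 1) * P.side n /
      ((2 * Real.pi) ^ ((D : ℝ) / 2) * P.sigma n ^ D) := by
  have hD0 : (0 : ℝ) < D := by exact_mod_cast hD
  have hkey : ∀ᶠ n in atTop, √D * gaussianMoment D + D / 4 * (P.side n / P.sigma n) ≤
      6 * (D : ℝ) ^ (3 / 2 : ℝ) / (2 * Real.pi) ^ ((D : ℝ) / 2) *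
        (P.delta n / P.sigma n) ^ (D - 1) := by
    have h0 : Tendsto (fun n => √D * gaussianMoment D + D / 4 * (P.side n / P.sigma n)) atTop
        (𝓝 (√D * gaussianMoment D + D / 4 * 0)) :=
      ((P.tendsto_side_div_sigma hD).const_mul _).const_add _
    rw [mul_zero, add_zero] at h0
    rcases hD.eq_or_lt with rfl | hD2
    · -- in dimension one the constants themselves have to be compared
      have hlt : √((1 : ℕ) : ℝ) * gaussianMoment 1 < 6 / √(2 * Real.pi) := by
        rw [lt_div_iff₀ (by positivity), gaussianMoment, Nat.cast_one, ← Real.sqrt_eq_rpow,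
          Real.sqrt_one, one_mul, ← Real.sqrt_mul zero_le_two, ← Real.sqrt_mul (by norm_num),
          Real.sqrt_lt' (by norm_num)]
        nlinarith [Real.pi_lt_four]
      filter_upwards [h0.eventually_lt_const hlt] with n hn
      have e : (2 * Real.pi) ^ (((1 : ℕ) : ℝ) / 2) = √(2 * Real.pi) := by
        rw [Nat.cast_one, ← Real.sqrt_eq_rpow]
      rw [e]
      simpa using hn.le
    · have hc : 0 < 6 * (D : ℝ) ^ (3 / 2 : ℝ) / (2 * Real.pi) ^ ((D : ℝ) / 2) := by positivity
      have h1 : Tendsto (fun n => 6 * (D : ℝ) ^ (3 / 2 : ℝ) / (2 * Real.pi) ^ ((D : ℝ) / 2) *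
          (P.delta n / P.sigma n) ^ (D - 1)) atTop atTop :=
        (((tendsto_pow_atTop (by omega)).comp P.tendsto_delta_div_sigma)).const_mul_atTop hc
      filter_upwards [h0.eventually_le_const (lt_add_one _), h1.eventually_ge_atTop
        (√D * gaussianMoment D + 1)] with n h2 h3 using h2.trans h3
  filter_upwards [hkey] with n hn
  have hσ := P.sigma_pos n
  have hh := P.side_pos n
  have h3 : P.sigma n ^ D = P.sigma n ^ (D - 1) * P.sigma n := by
    rw [← pow_succ, Nat.sub_add_cancel hD]
  calc 2 * riemannError D (√D * (P.side n / 2) / P.sigma n)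
      = (√D * gaussianMoment D + (√D * √D) / 4 * (P.side n / P.sigma n)) *
          (P.side n / P.sigma n) := by unfold riemannError; ring
    _ = (√D * gaussianMoment D + D / 4 * (P.side n / P.sigma n)) * (P.side n / P.sigma n) := by
        rw [Real.mul_self_sqrt hD0.le]
    _ ≤ 6 * (D : ℝ) ^ (3 / 2 : ℝ) / (2 * Real.pi) ^ ((D : ℝ) / 2) *
        (P.delta n / P.sigma n) ^ (D - 1) * (P.side n / P.sigma n) := by gcongr
    _ = _ := by rw [h3, div_pow]; field_simp

lemma exp_neg_two_mul_le_one_sub {x : ℝ} (hx0 : 0 ≤ x) (hx : x ≤ 1 / 2) :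
    Real.exp (-(2 * x)) ≤ 1 - x := by
  rw [Real.exp_neg, inv_le_comm₀ (Real.exp_pos _) (by linarith), inv_eq_one_div,
    div_le_iff₀ (by linarith)]
  have := Real.add_one_le_exp (2 * x)
  nlinarith

/-- The sum of the two explicit error terms of the Gaussian approximation. -/
noncomputable def PartitionData.gaussianTerms (n : ℕ) : ℝ :=
  6 * (D : ℝ) ^ (3 / 2 : ℝ) * P.delta n ^ (D - 1) * P.side n /
      ((2 * Real.pi) ^ ((D : ℝ) / 2) * P.sigma n ^ D) +
    2 * Real.exp (-(P.delta n / P.sigma n) ^ 2 / 8)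

/-- Mass of the `δ`-cube under the Gaussian of bandwidth `σ`, up to the Riemann error. By
`exp (-2x) ≤ 1 - x` for small `x`, the factor `2` in the Gaussian terms turns the lost mass into a
bound for the logarithm. -/
lemma PartitionData.eventually_box_mass_ge (hD : 1 ≤ D) : ∀ᶠ n in atTop,
    Real.exp (-P.gaussianTerms n) ≤
      (centredGaussian D (P.sigma n)).real {v | ∀ i, |v i| ≤ P.delta n / 2} -
        riemannError D (√D * (P.side n / 2) / P.sigma n) := by
  have ht := P.tendsto_delta_div_sigma.eventually (eventually_centredGaussian_tail_le D)
  have hexp : Tendsto (fun n => Real.exp (-(P.delta n / P.sigma n) ^ 2 / 8)) atTop (𝓝 0) := by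
    refine Real.tendsto_exp_atBot.comp ?_
    have := ((tendsto_pow_atTop two_ne_zero).comp P.tendsto_delta_div_sigma).atTop_div_const
      (show (0 : ℝ) < 8 by norm_num)
    refine (tendsto_neg_atTop_atBot.comp this).congr fun n => ?_
    simp only [Function.comp_apply]; ring
  have h4 : (0 : ℝ) < 1 / 4 := by norm_num
  filter_upwards [ht, hexp.eventually_le_const h4, (P.tendsto_riemannError hD).eventually_le_const h4,
    P.eventually_riemannError_le hD] with n h1 h2 h3 h5
  rw [centredGaussian_real_box (P.sigma_pos n)]
  set R := riemannError D (√D * (P.side n / 2) / P.sigma n)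
  have hR : 0 ≤ R := by
    have := P.side_pos n
    have := P.sigma_pos n
    unfold R riemannError gaussianMoment
    positivity
  set κ := (centredGaussian D 1).real {v | ∃ i, P.delta n / 2 / P.sigma n < |v i|} with hκ
  have hκ1 : κ ≤ Real.exp (-(P.delta n / P.sigma n) ^ 2 / 8) := by
    rw [hκ, Measure.real, div_right_comm]
    exact ENNReal.toReal_le_of_le_ofReal (Real.exp_pos _).le h1
  have hκ0 : 0 ≤ κ := measureReal_nonneg
  calc Real.exp (-P.gaussianTerms n) ≤ Real.exp (-(2 * (κ + R))) := by
        rw [Real.exp_le_exp, PartitionData.gaussianTerms]; linarith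
    _ ≤ 1 - (κ + R) := exp_neg_two_mul_le_one_sub (by positivity) (by linarith)
    _ = _ := by ring

/-- At points whose `δ`-cube is covered by the cells, the exact mixture is not much smaller than
the density. -/
lemma PartitionData.eventually_log_div_le_of_subset (hD : 1 ≤ D) : ∀ᶠ n in atTop,
    ∀ (g : Vec D → ℝ) (y : Vec D) (L : ℝ), IsChargingDensity P n g → 0 < g y →
      cube (P.delta n) y ⊆ ⋃ j, cell (P.side n) (P.center n j) →
      (∀ u ∈ cube (P.delta n) y, g y ≤ Real.exp L * g u) →
      Real.log (g y / exactMixture P n g y) ≤ L + P.gaussianTerms n := by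
  filter_upwards [P.eventually_box_mass_ge hD] with n hn g y L hg hy hsub hL
  have hσ := P.sigma_pos n
  have hm := mixture_ge hσ (P.side_pos n) (P.disjoint_cell n) (measurableSet_cube _ y) hsub
    hg.integrable hg.nonneg (b := Real.exp (-L) * g y) (by positivity) (fun u hu => by
      rw [Real.exp_neg, inv_mul_le_iff₀ (Real.exp_pos _)]; exact hL u hu) y
  have hbox : (fun v => v + y) ⁻¹' cube (P.delta n) y = {v | ∀ i, |v i| ≤ P.delta n / 2} := by
    ext v; simp [cube]
  rw [setIntegral_gaussianDensity hσ y (measurableSet_cube _ y), hbox] at hm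
  have hx := exactMixture_pos hg y
  have h0 : 0 ≤ (∫ u in P.remainder n, g u) * gaussianDensity 0 P.sigmaZero y :=
    mul_nonneg hg.remainder_pos.le (gaussianDensity_pos _ P.sigmaZero_pos y).le
  have hge : Real.exp (-L) * g y * Real.exp (-P.gaussianTerms n) ≤ exactMixture P n g y := by
    refine ((mul_le_mul_of_nonneg_left hn (by positivity)).trans hm).trans ?_
    unfold exactMixture
    linarith
  rw [← Real.log_exp (L + P.gaussianTerms n)]
  refine Real.log_le_log (by positivity) ?_
  rw [div_le_iff₀ hx, Real.exp_add]
  calc g y = Real.exp L * Real.exp (P.gaussianTerms n) *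
        (Real.exp (-L) * g y * Real.exp (-P.gaussianTerms n)) := by
        rw [Real.exp_neg, Real.exp_neg]; field_simp
    _ ≤ _ := by gcongr

/-- Mass of an orthant of the `r`-cube under the Gaussian of bandwidth `σ`, up to the Riemann
error: at least half of the limit `2⁻ᴰ`. -/
lemma PartitionData.eventually_corner_mass_ge (hD : 1 ≤ D) (hr : 0 < r) : ∀ᶠ n in atTop,
    ∀ ε : Fin D → ℝ, (∀ i, ε i = 1 ∨ ε i = -1) → (2 ^ (D + 1) : ℝ)⁻¹ ≤
      (centredGaussian D (P.sigma n)).real {v | ∀ i, 0 ≤ ε i * v i ∧ ε i * v i ≤ r / 2} -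
        riemannError D (√D * (P.side n / 2) / P.sigma n) := by
  have hrσ : Tendsto (fun n => r / P.sigma n) atTop atTop := by
    have h : Tendsto P.sigma atTop (𝓝[>] 0) := tendsto_nhdsWithin_iff.mpr ⟨P.tendsto_sigma,
      Eventually.of_forall fun n => P.sigma_pos n⟩
    exact h.inv_tendsto_nhdsGT_zero.const_mul_atTop hr
  have ht := hrσ.eventually (eventually_centredGaussian_tail_le D)
  have hexp : Tendsto (fun n => Real.exp (-(r / P.sigma n) ^ 2 / 8)) atTop (𝓝 0) := by
    refine Real.tendsto_exp_atBot.comp ?_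
    have := ((tendsto_pow_atTop two_ne_zero).comp hrσ).atTop_div_const
      (show (0 : ℝ) < 8 by norm_num)
    refine (tendsto_neg_atTop_atBot.comp this).congr fun n => ?_
    simp only [Function.comp_apply]; ring
  filter_upwards [ht, hexp.eventually_le_const (show (0 : ℝ) < 1 / 4 by norm_num),
    (P.tendsto_riemannError hD).eventually_le_const
      (show (0 : ℝ) < (2 ^ D)⁻¹ / 4 by positivity)] with n h1 h2 h3 ε hε
  have hc := centredGaussian_corner_ge (P.sigma_pos n) ε hε (r / 2)
  rw [centredGaussian_real_box (P.sigma_pos n), div_right_comm] at hc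
  have hκ : (centredGaussian D 1).real {v | ∃ i, r / P.sigma n / 2 < |v i|} ≤ 1 / 4 :=
    (ENNReal.toReal_le_of_le_ofReal (Real.exp_pos _).le h1).trans h2
  set q := (centredGaussian D (P.sigma n)).real {v | ∀ i, 0 ≤ ε i * v i ∧ ε i * v i ≤ r / 2}
  have hq : (2 ^ D : ℝ)⁻¹ * (3 / 4) ≤ q := by
    rw [inv_mul_le_iff₀ (by positivity)]; linarith
  have : (2 ^ (D + 1) : ℝ)⁻¹ = (2 ^ D : ℝ)⁻¹ / 2 := by rw [pow_succ, mul_inv]; ring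
  rw [this]
  linarith

/-- At every point, the exact mixture is bounded below through the corner cubes. In the cells the
bound is `2^{-(D+1)}`, which the condition on `σ₀` compares with the explicit one; on the remainder
set the corner cube bounds its probability from below. -/
lemma PartitionData.eventually_log_div_le (hD : 1 ≤ D) (hr : 0 < r) : ∀ᶠ n in atTop,
    ∀ (g : Vec D → ℝ) (y : Vec D) (L : ℝ), IsChargingDensity P n g → 0 < g y →
      (∀ u ∈ cube r y, g y ≤ Real.exp L * g u) →
      Real.log (g y / exactMixture P n g y) ≤ L + (‖y‖ ^ 2 / (2 * P.sigmaZero ^ 2)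
        - Real.log ((r / 2) ^ D / (2 * Real.pi * P.sigmaZero ^ 2) ^ ((D : ℝ) / 2))) := by
  filter_upwards [P.eventually_corner, P.eventually_corner_mass_ge hD hr] with n hcor hn g y L hg
    hy hL
  have hσ := P.sigma_pos n
  have hσ0 := P.sigmaZero_pos
  have hx := exactMixture_pos hg y
  set q := (r / 2) ^ D / (2 * Real.pi * P.sigmaZero ^ 2) ^ ((D : ℝ) / 2) with hq
  have hq0 : 0 < q := by positivity
  have hLb : ∀ u ∈ cube r y, Real.exp (-L) * g y ≤ g u := fun u hu => by
    rw [Real.exp_neg, inv_mul_le_iff₀ (Real.exp_pos _)]; exact hL u hu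
  suffices hge : Real.exp (-L) * g y * (q * Real.exp (-(‖y‖ ^ 2 / (2 * P.sigmaZero ^ 2)))) ≤
      exactMixture P n g y by
    have h1 := Real.log_le_log (by positivity) hge
    rw [Real.log_mul (by positivity) (by positivity), Real.log_mul (by positivity) hy.ne',
      Real.log_mul hq0.ne' (by positivity), Real.log_exp, Real.log_exp] at h1
    rw [Real.log_div hy.ne' hx.ne']
    linarith
  by_cases hy0 : y ∈ ⋃ j, cell (P.side n) (P.center n j)
  · obtain ⟨ε, hε, hsub⟩ := hcor.2 y hy0
    set Q := {u : Vec D | ∀ i, 0 ≤ ε i * (u i - y i) ∧ ε i * (u i - y i) ≤ r / 2} with hQ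
    have hm := mixture_ge hσ (P.side_pos n) (P.disjoint_cell n) (measurableSet_corner ε (r / 2) y)
      hsub hg.integrable hg.nonneg (b := Real.exp (-L) * g y) (by positivity)
      (fun u hu => hLb u (corner_subset_cube hε r y hu)) y
    have hbox : (fun v => v + y) ⁻¹' Q = {v | ∀ i, 0 ≤ ε i * v i ∧ ε i * v i ≤ r / 2} := by
      ext v; simp [hQ]
    rw [setIntegral_gaussianDensity hσ y (measurableSet_corner ε (r / 2) y), hbox] at hm
    have h0 : 0 ≤ (∫ u in P.remainder n, g u) * gaussianDensity 0 P.sigmaZero y :=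
      mul_nonneg hg.remainder_pos.le (gaussianDensity_pos _ P.sigmaZero_pos y).le
    have hexp : Real.exp (-(‖y‖ ^ 2 / (2 * P.sigmaZero ^ 2))) ≤ 1 :=
      Real.exp_le_one_iff.mpr (neg_nonpos.mpr (by positivity))
    have hqb := P.sigmaZero_bound
    calc _ ≤ Real.exp (-L) * g y * ((2 ^ (D + 1) : ℝ)⁻¹ * 1) := by gcongr
      _ ≤ _ := by
        rw [mul_one]
        exact mul_le_mul_of_nonneg_left (hn ε hε) (by positivity)
      _ ≤ _ := hm
      _ ≤ _ := by unfold exactMixture; linarith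
  · obtain ⟨ε, hε, hsub⟩ := hcor.1 y hy0
    set Q := {u : Vec D | ∀ i, 0 ≤ ε i * (u i - y i) ∧ ε i * (u i - y i) ≤ r / 2} with hQ
    have hQm : MeasurableSet Q := measurableSet_corner ε (r / 2) y
    have hvol : volume Q = ENNReal.ofReal (r / 2) ^ D := volume_corner hε (r / 2) y
    have hvr : volume.real Q = (r / 2) ^ D := by
      rw [Measure.real, hvol, ENNReal.toReal_pow, ENNReal.toReal_ofReal (by positivity)]
    have hG0 : Real.exp (-L) * g y * (r / 2) ^ D ≤ ∫ u in P.remainder n, g u := by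
      calc Real.exp (-L) * g y * (r / 2) ^ D = ∫ _u in Q, Real.exp (-L) * g y := by
            rw [setIntegral_const, hvr, smul_eq_mul, mul_comm]
        _ ≤ ∫ u in Q, g u := by
            refine setIntegral_mono_on (integrableOn_const (by
              rw [hvol]; exact ENNReal.pow_ne_top ENNReal.ofReal_ne_top)) hg.integrable.integrableOn
              hQm fun u hu => hLb u (corner_subset_cube hε r y hu)
        _ ≤ _ := setIntegral_mono_set hg.integrable.integrableOn (ae_of_all _ hg.nonneg)
            (LE.le.eventuallyLE hsub)
    have hs : 0 ≤ ∑ j, (∫ u in cell (P.side n) (P.center n j), g u) *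
        gaussianDensity (P.center n j) (P.sigma n) y :=
      Finset.sum_nonneg fun j _ => mul_nonneg (hg.cell_pos j).le (gaussianDensity_pos _ hσ y).le
    calc _ = Real.exp (-L) * g y * (r / 2) ^ D * gaussianDensity 0 P.sigmaZero y := by
          rw [gaussianDensity, sub_zero, hq, neg_div]; ring
      _ ≤ (∫ u in P.remainder n, g u) * gaussianDensity 0 P.sigmaZero y :=
          mul_le_mul_of_nonneg_right hG0 (gaussianDensity_pos _ hσ0 y).le
      _ ≤ _ := by unfold exactMixture; linarith

end Limits

/-! ### The explicit mixture bound -/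

section Bound

variable {𝒞 : Type*} [MeasurableSpace 𝒞] {D T : ℕ} {X : DiffusionProblem 𝒞 D T}
  {s : Fin T} {d : ℕ} {φ : 𝒞 × Vec D → Fin d → ℝ} {K : Set (Fin d → ℝ)}
  {f : (Fin d → ℝ) → Vec D → ℝ}

lemma ae_of_ae_snd {A B : Type*} [MeasurableSpace A] [MeasurableSpace B] {F : Measure (A × B)}
    {p : B → Prop} (h : ∀ᵐ z ∂F.snd, p z) : ∀ᵐ w ∂F, p w.2 :=
  ae_of_ae_map measurable_snd.aemeasurable h

/-- Almost all conditional densities charge every set of every partition, so that the exact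
log-odds are logarithms of positive numbers. -/
lemma FeatureAssumption.ae_isChargingDensity (h : FeatureAssumption X s φ K f) (hD : 1 ≤ D)
    {r : Fin T → ℝ} (hreg : RegularityAssumption X r) {r' : ℝ} (P : PartitionData D r') :
    ∀ᵐ z ∂(X.featureLaw s φ).snd, ∀ n, IsChargingDensity P n (f z) := by
  have hcell : ∀ᵐ z ∂(X.featureLaw s φ).snd, ∀ (n : ℕ) (j : Fin (P.size n)),
      ∫⁻ y in cell (P.side n) (P.center n j), ENNReal.ofReal (f z y) ≠ 0 :=
    ae_all_iff.mpr fun n => ae_all_iff.mpr fun j =>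
      h.ae_setLIntegral_ne_zero hreg (measurableSet_cell _ _) (P.volume_cell_ne_zero n j)
  have hrem : ∀ᵐ z ∂(X.featureLaw s φ).snd, ∀ n : ℕ,
      ∫⁻ y in P.remainder n, ENNReal.ofReal (f z y) ≠ 0 :=
    ae_all_iff.mpr fun n => h.ae_setLIntegral_ne_zero hreg (P.measurableSet_remainder n)
      (P.volume_remainder_ne_zero hD n)
  filter_upwards [hcell, hrem, h.ae_lintegral_eq_one] with z h1 h2 h3 n
  have hm : Measurable (f z) := h.measurable_density.comp measurable_prodMk_left
  have h0 := h.density_nonneg z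
  have hint : Integrable (f z) := by
    rw [← lintegral_ofReal_ne_top_iff_integrable hm.aestronglyMeasurable (ae_of_all _ h0), h3]
    exact ENNReal.one_ne_top
  have hpos : ∀ S : Set (Vec D), ∫⁻ y in S, ENNReal.ofReal (f z y) ≠ 0 → 0 < ∫ y in S, f z y := by
    intro S hS
    rw [← ofReal_integral_eq_lintegral_ofReal hint.integrableOn (ae_of_all _ h0), Ne,
      ENNReal.ofReal_eq_zero, not_le] at hS
    exact hS
  refine ⟨h0, hint, ?_, fun j => hpos _ (h1 n j), hpos _ (h2 n)⟩
  rw [← ofReal_integral_eq_lintegral_ofReal hint (ae_of_all _ h0), ENNReal.ofReal_eq_one] at h3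
  exact h3

lemma FeatureAssumption.ae_mem (h : FeatureAssumption X s φ K f) :
    ∀ᵐ z ∂(X.featureLaw s φ).snd, z ∈ K := by
  have := h.isProbabilityMeasure_featureLaw
  exact (prob_compl_eq_zero_iff h.isCompact.measurableSet).mpr h.compact_support

/-- Averaged positive part of the log-likelihood ratio between the conditional density and its
Gaussian mixture with exact weights. -/
noncomputable def exactError {r : ℝ} (P : PartitionData D r) (n : ℕ)
    (f : (Fin d → ℝ) → Vec D → ℝ) (F : Measure (Vec D × (Fin d → ℝ))) : ℝ≥0∞ :=
  ∫⁻ p, ENNReal.ofReal (Real.log (f p.2 p.1 / exactMixture P n (f p.2) p.1)) ∂F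

/-- The divergence of one neural reverse step splits into the error of the mixture with exact
weights and the error of the logits. -/
lemma lintegral_klDiv_le_exactError (h : FeatureAssumption X s φ K f) (hD : 1 ≤ D)
    {r : Fin T → ℝ} (hreg : RegularityAssumption X r) {r' : ℝ} (P : PartitionData D r') (n : ℕ)
    (a : ReLUNet d (P.size n)) :
    ∫⁻ w, klDiv (X.reverseKernel s w) (neuralKernel φ P n a w) ∂(X.jointLaw s).fst ≤
      exactError P n f (X.featureLaw s φ) + 2 * logitError P f K n a := by
  have := h.isProbabilityMeasure_featureLaw
  refine (lintegral_klDiv_neuralKernel_le h P n a).trans ?_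
  calc _ ≤ ∫⁻ p, (ENNReal.ofReal (Real.log (f p.2 p.1 / exactMixture P n (f p.2) p.1)) +
        2 * logitError P f K n a) ∂(X.featureLaw s φ) := by
        refine lintegral_mono_ae ?_
        filter_upwards [ae_of_ae_snd h.ae_mem, ae_of_ae_snd (h.ae_isChargingDensity hD hreg P)]
          with p h1 h2
        exact ofReal_log_div_mixtureDensity_le h1 (h2 n) a p.1
    _ = _ := by rw [lintegral_add_right _ measurable_const]; simp [exactError]

/-- Outside the boundary event, the local oscillation at scale `δ` and the explicit Gaussian
terms bound the log-likelihood ratio. -/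
lemma PartitionData.eventually_off_boundary (hD : 1 ≤ D) {r : ℝ} (P : PartitionData D r) :
    ∀ᶠ n in atTop, ∀ (c1 : Bool) (z : Fin d → ℝ) (y : Vec D), IsChargingDensity P n (f z) →
      (c1 = true → ContDiff ℝ 1 (f z)) → (y, z) ∉ boundaryEvent P n d →
      ENNReal.ofReal (Real.log (f z y / exactMixture P n (f z) y)) ≤
        localOsc c1 f (P.delta n) z y + ENNReal.ofReal (P.gaussianTerms n) := by
  filter_upwards [P.eventually_log_div_le_of_subset hD] with n hn c1 z y hg hc hb
  rcases (hg.nonneg y).eq_or_lt with h0 | h0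
  · simp [← h0]
  by_cases hfin : localOsc c1 f (P.delta n) z y = ∞
  · simp [hfin]
  have hsub : cube (P.delta n) y ⊆ ⋃ j, cell (P.side n) (P.center n j) := by
    intro u hu
    by_contra hcon
    exact hb ⟨u, hu, hcon⟩
  have h1 := hn (f z) y _ hg h0 hsub fun u hu =>
    le_exp_localOsc_mul hD hg.nonneg hc (P.delta_pos n) h0 hfin hu
  refine (ENNReal.ofReal_le_ofReal h1).trans (ENNReal.ofReal_add_le.trans ?_)
  rw [ENNReal.ofReal_toReal hfin]

/-- The bound used on the boundary event, which holds at every point. -/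
lemma PartitionData.eventually_everywhere (hD : 1 ≤ D) {r : ℝ} (hr : 0 < r)
    (P : PartitionData D r) :
    ∀ᶠ n in atTop, ∀ (c1 : Bool) (z : Fin d → ℝ) (y : Vec D), IsChargingDensity P n (f z) →
      (c1 = true → ContDiff ℝ 1 (f z)) →
      ENNReal.ofReal (Real.log (f z y / exactMixture P n (f z) y)) ≤
        localOsc c1 f r z y + ENNReal.ofReal (‖y‖ ^ 2 / (2 * P.sigmaZero ^ 2)
        - Real.log ((r / 2) ^ D / (2 * Real.pi * P.sigmaZero ^ 2) ^ ((D : ℝ) / 2))) := by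
  filter_upwards [P.eventually_log_div_le hD hr] with n hn c1 z y hg hc
  rcases (hg.nonneg y).eq_or_lt with h0 | h0
  · simp [← h0]
  by_cases hfin : localOsc c1 f r z y = ∞
  · simp [hfin]
  have h1 := hn (f z) y _ hg h0 fun u hu => le_exp_localOsc_mul hD hg.nonneg hc hr h0 hfin hu
  refine (ENNReal.ofReal_le_ofReal h1).trans (ENNReal.ofReal_add_le.trans ?_)
  rw [ENNReal.ofReal_toReal hfin]

/-- For fine partitions, the mixture with exact weights satisfies the explicit bound. The
boundary event is replaced by a measurable hull, which carries the same integrals, since the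
bound used on it holds at every point. -/
lemma FeatureAssumption.eventually_exactError_le (h : FeatureAssumption X s φ K f) (hD : 1 ≤ D)
    {r : Fin T → ℝ} (hreg : RegularityAssumption X r) (P : PartitionData D (r s)) :
    ∀ᶠ n in atTop, ∀ c1 : Bool, (c1 = true → IsC1Density f (X.featureLaw s φ)) →
      exactError P n f (X.featureLaw s φ) ≤ noretsBound P n c1 f (X.featureLaw s φ) := by
  filter_upwards [P.eventually_off_boundary (f := f) hD,
    P.eventually_everywhere (f := f) hD (hreg.side_pos s)] with n hoff hev c1 hc1
  have := h.isProbabilityMeasure_featureLaw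
  set F := X.featureLaw s φ with hF
  have hae : ∀ᵐ p ∂F, IsChargingDensity P n (f p.2) ∧ (c1 = true → ContDiff ℝ 1 (f p.2)) := by
    have h1 : ∀ᵐ z ∂F.snd, c1 = true → ContDiff ℝ 1 (f z) := by
      by_cases hc : c1 = true
      · filter_upwards [hc1 hc] with z hz _ using hz
      · exact ae_of_all _ fun z hz => absurd hz hc
    filter_upwards [ae_of_ae_snd (h.ae_isChargingDensity hD hreg P), ae_of_ae_snd h1]
      with p h2 h3 using ⟨h2 n, h3⟩
  set B := toMeasurable F (boundaryEvent P n d) with hB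
  have hBm : MeasurableSet B := measurableSet_toMeasurable _ _
  have hsplit := lintegral_add_compl (μ := F)
    (fun p => ENNReal.ofReal (Real.log (f p.2 p.1 / exactMixture P n (f p.2) p.1))) hBm
  have hin : ∫⁻ p in B, ENNReal.ofReal (Real.log (f p.2 p.1 / exactMixture P n (f p.2) p.1)) ∂F ≤
      (∫⁻ p in boundaryEvent P n d, localOsc c1 f (r s) p.2 p.1 ∂F) +
      ∫⁻ p in boundaryEvent P n d, ENNReal.ofReal (‖p.1‖ ^ 2 / (2 * P.sigmaZero ^ 2)
        - Real.log ((r s / 2) ^ D / (2 * Real.pi * P.sigmaZero ^ 2) ^ ((D : ℝ) / 2))) ∂F := by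
    rw [← lintegral_add_right _ (by fun_prop), hB,
      Measure.restrict_toMeasurable (measure_ne_top _ _)]
    refine lintegral_mono_ae (ae_restrict_of_ae ?_)
    filter_upwards [hae] with p hp using hev c1 p.2 p.1 hp.1 hp.2
  have hout : ∫⁻ p in Bᶜ,
      ENNReal.ofReal (Real.log (f p.2 p.1 / exactMixture P n (f p.2) p.1)) ∂F ≤
      (∫⁻ p, localOsc c1 f (P.delta n) p.2 p.1 ∂F) + ENNReal.ofReal (P.gaussianTerms n) := by
    calc _ ≤ ∫⁻ p in Bᶜ, (localOsc c1 f (P.delta n) p.2 p.1 +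
          ENNReal.ofReal (P.gaussianTerms n)) ∂F := by
          refine lintegral_mono_ae ?_
          filter_upwards [ae_restrict_of_ae hae, ae_restrict_mem hBm.compl] with p hp hpB
          exact hoff c1 p.2 p.1 hp.1 hp.2 fun hb => hpB (subset_toMeasurable _ _ hb)
      _ ≤ ∫⁻ p, (localOsc c1 f (P.delta n) p.2 p.1 + ENNReal.ofReal (P.gaussianTerms n)) ∂F :=
          setLIntegral_le_lintegral _ _
      _ = _ := by rw [lintegral_add_right _ measurable_const]; simp
  have hg : ENNReal.ofReal (P.gaussianTerms n) ≤
      ENNReal.ofReal (6 * (D : ℝ) ^ (3 / 2 : ℝ) * P.delta n ^ (D - 1) * P.side n /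
        ((2 * Real.pi) ^ ((D : ℝ) / 2) * P.sigma n ^ D)) +
      ENNReal.ofReal (2 * Real.exp (-(P.delta n / P.sigma n) ^ 2 / 8)) := ENNReal.ofReal_add_le
  rw [exactError, ← hsplit, noretsBound]
  exact (add_le_add hin (hout.trans (add_le_add le_rfl hg))).trans (le_of_eq (by abel))

end Bound

/-! ### A bound for the exact mixture that holds for every partition -/

section Rough

variable {D d : ℕ} {r : ℝ} (P : PartitionData D r) (n : ℕ)

/-- Reciprocal of the mass that the density `g` gives to the set of the `n`-th partition that
contains `y`. -/
noncomputable def invMass (g : Vec D → ℝ) (y : Vec D) : ℝ≥0∞ :=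
  (∑ j, (cell (P.side n) (P.center n j)).indicator
    (fun _ => (∫⁻ u in cell (P.side n) (P.center n j), ENNReal.ofReal (g u))⁻¹) y) +
  (P.remainder n).indicator (fun _ => (∫⁻ u in P.remainder n, ENNReal.ofReal (g u))⁻¹) y

/-- Lower bound for the Gaussian densities of the cells, each on its own cell, and for the
normalization of the Gaussian density of the remainder set. -/
noncomputable def densityFloor : ℝ :=
  min (Real.exp (-(D * (P.side n / P.sigma n) ^ 2 / 8)) /
      (2 * Real.pi * P.sigma n ^ 2) ^ ((D : ℝ) / 2))
    (1 / (2 * Real.pi * P.sigmaZero ^ 2) ^ ((D : ℝ) / 2))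

lemma densityFloor_pos : 0 < densityFloor P n := by
  have := P.sigma_pos n
  have := P.sigmaZero_pos
  exact lt_min (by positivity) (by positivity)

variable {P n} {g : Vec D → ℝ}

lemma IsChargingDensity.setLIntegral_eq (hg : IsChargingDensity P n g) (S : Set (Vec D)) :
    ∫⁻ u in S, ENNReal.ofReal (g u) = ENNReal.ofReal (∫ u in S, g u) :=
  (ofReal_integral_eq_lintegral_ofReal hg.integrable.integrableOn
    (ae_of_all _ hg.nonneg)).symm

/-- The exact mixture is at least the mass of the set containing `y` times the Gaussian density of
that set at `y`. Finiteness of the reciprocal mass is needed because `∞` has real value `0`. -/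
lemma IsChargingDensity.floor_le (hg : IsChargingDensity P n g) {y : Vec D}
    (hfin : invMass P n g y ≠ ∞) :
    densityFloor P n * Real.exp (-(‖y‖ ^ 2 / (2 * P.sigmaZero ^ 2))) ≤
      exactMixture P n g y * (invMass P n g y).toReal := by
  have hσ := P.sigma_pos n
  have hσ0 := P.sigmaZero_pos
  have hx := exactMixture_pos hg y
  have key : ∀ G b : ℝ, 0 < G → (ENNReal.ofReal G)⁻¹ ≤ invMass P n g y →
      G * b ≤ exactMixture P n g y → b ≤ exactMixture P n g y * (invMass P n g y).toReal := by
    intro G b hG h1 h2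
    have h3 : G⁻¹ ≤ (invMass P n g y).toReal := by
      have := ENNReal.toReal_mono hfin h1
      rwa [ENNReal.toReal_inv, ENNReal.toReal_ofReal hG.le] at this
    calc b = G * b * G⁻¹ := by field_simp
      _ ≤ exactMixture P n g y * G⁻¹ := mul_le_mul_of_nonneg_right h2 (by positivity)
      _ ≤ _ := mul_le_mul_of_nonneg_left h3 hx.le
  have hc0 : ∀ j, 0 ≤ (∫ u in cell (P.side n) (P.center n j), g u) *
      gaussianDensity (P.center n j) (P.sigma n) y := fun j =>
    mul_nonneg (hg.cell_pos j).le (gaussianDensity_pos _ hσ y).le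
  have hr0 : 0 ≤ (∫ u in P.remainder n, g u) * gaussianDensity 0 P.sigmaZero y :=
    mul_nonneg hg.remainder_pos.le (gaussianDensity_pos _ hσ0 y).le
  by_cases hy : y ∈ P.remainder n
  · refine (mul_le_mul_of_nonneg_right (min_le_right _ _) (Real.exp_pos _).le).trans
      (key (∫ u in P.remainder n, g u) _ hg.remainder_pos ?_ ?_)
    · rw [← hg.setLIntegral_eq, invMass, Set.indicator_of_mem hy]
      exact le_add_self
    · have e : gaussianDensity 0 P.sigmaZero y = 1 / (2 * Real.pi * P.sigmaZero ^ 2) ^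
          ((D : ℝ) / 2) * Real.exp (-(‖y‖ ^ 2 / (2 * P.sigmaZero ^ 2))) := by
        rw [gaussianDensity, sub_zero, neg_div]; ring
      rw [← e, exactMixture]
      exact le_add_of_nonneg_left (Finset.sum_nonneg fun j _ => hc0 j)
  · obtain ⟨j, hj⟩ : ∃ j, y ∈ cell (P.side n) (P.center n j) := by
      simpa [PartitionData.remainder] using hy
    have hexp : Real.exp (-(‖y‖ ^ 2 / (2 * P.sigmaZero ^ 2))) ≤ 1 :=
      Real.exp_le_one_iff.mpr (neg_nonpos.mpr (by positivity))
    refine (mul_le_of_le_one_right (densityFloor_pos P n).le hexp).trans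
      ((min_le_left _ _).trans
      (key (∫ u in cell (P.side n) (P.center n j), g u) _ (hg.cell_pos j) ?_ ?_))
    · rw [← hg.setLIntegral_eq, invMass]
      refine le_add_right ?_
      refine le_trans (le_of_eq ?_) (Finset.single_le_sum (f := fun j =>
        (cell (P.side n) (P.center n j)).indicator (fun _ =>
          (∫⁻ u in cell (P.side n) (P.center n j), ENNReal.ofReal (g u))⁻¹) y)
        (fun _ _ => zero_le) (Finset.mem_univ j))
      rw [Set.indicator_of_mem hj]
    · refine le_trans ?_ (le_add_of_nonneg_right hr0)
      refine le_trans ?_ (Finset.single_le_sum (f := fun j =>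
        (∫ u in cell (P.side n) (P.center n j), g u) *
          gaussianDensity (P.center n j) (P.sigma n) y) (fun j _ => hc0 j) (Finset.mem_univ j))
      refine mul_le_mul_of_nonneg_left ?_ (hg.cell_pos j).le
      have hn := norm_sub_le_of_mem_cell hj
      have hn2 : ‖y - P.center n j‖ ^ 2 ≤ D * (P.side n / 2) ^ 2 := by
        calc _ ≤ (√D * (P.side n / 2)) ^ 2 := pow_le_pow_left₀ (norm_nonneg _) hn 2
          _ = _ := by rw [mul_pow, Real.sq_sqrt (Nat.cast_nonneg D)]
      unfold gaussianDensity
      gcongr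
      rw [neg_div, neg_le_neg_iff, div_le_iff₀ (by positivity)]
      calc _ ≤ _ := hn2
        _ = _ := by field_simp; ring

/-- A density with bounded logarithmic gradient near `y` is bounded at `y`, since its integral
is one. -/
lemma IsChargingDensity.log_le {f : (Fin d → ℝ) → Vec D → ℝ} {z : Fin d → ℝ}
    (hg : IsChargingDensity P n (f z)) (hc : ContDiff ℝ 1 (f z)) {ρ : ℝ} (hρ : 0 < ρ)
    (hρr : ρ ≤ r) {y : Vec D} (hy : 0 < f z y) (hfin : gradSup f r z y ≠ ∞) :
    Real.log (f z y) ≤ ρ * √D / 2 * (gradSup f r z y).toReal - D * Real.log ρ := by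
  have hle : gradSup f ρ z y ≤ gradSup f r z y :=
    biSup_mono fun u hu i => (hu i).trans (by linarith)
  have hfinρ : gradSup f ρ z y ≠ ∞ := (hle.trans_lt hfin.lt_top).ne
  set L := ρ * √D / 2 * (gradSup f r z y).toReal with hL
  have hb : ∀ u ∈ cube ρ y, Real.exp (-L) * f z y ≤ f z u := fun u hu => by
    rw [Real.exp_neg, inv_mul_le_iff₀ (Real.exp_pos _)]
    refine (le_exp_mul_of_gradSup hg.nonneg hc hρ.le hfinρ hu).trans ?_
    refine mul_le_mul_of_nonneg_right (Real.exp_le_exp.mpr ?_) (hg.nonneg u)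
    exact mul_le_mul_of_nonneg_left (ENNReal.toReal_mono hfin hle) (by positivity)
  have hvol : volume.real (cube ρ y) = ρ ^ D := by
    rw [Measure.real, volume_cube, ENNReal.toReal_pow, ENNReal.toReal_ofReal hρ.le]
  have h1 : Real.exp (-L) * f z y * ρ ^ D ≤ 1 := by
    calc Real.exp (-L) * f z y * ρ ^ D = ∫ _u in cube ρ y, Real.exp (-L) * f z y := by
          rw [setIntegral_const, hvol, smul_eq_mul, mul_comm]
      _ ≤ ∫ u in cube ρ y, f z u := by
          refine setIntegral_mono_on (integrableOn_const (by
            rw [volume_cube]; exact ENNReal.pow_ne_top ENNReal.ofReal_ne_top))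
            hg.integrable.integrableOn (measurableSet_cube ρ y) hb
      _ ≤ ∫ u, f z u := setIntegral_le_integral hg.integrable (ae_of_all _ hg.nonneg)
      _ = 1 := hg.integral_eq_one
  have h2 := Real.log_le_log (by positivity) h1
  rw [Real.log_mul (by positivity) (by positivity), Real.log_mul (by positivity) hy.ne',
    Real.log_exp, Real.log_pow, Real.log_one] at h2
  linarith

/-- Bound for the log-likelihood ratio that holds at every point and for every partition, with
free parameters `ρ` and `a`. -/
lemma IsChargingDensity.rough_bound {f : (Fin d → ℝ) → Vec D → ℝ} {z : Fin d → ℝ} (hD : 1 ≤ D)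
    (hg : IsChargingDensity P n (f z)) (hc : ContDiff ℝ 1 (f z)) {ρ a : ℝ} (hρ : 0 < ρ)
    (hρr : ρ ≤ r) (ha : 0 < a) (y : Vec D) :
    ENNReal.ofReal (Real.log (f z y / exactMixture P n (f z) y)) ≤
      ENNReal.ofReal (ρ * √D / 2) * gradSup f r z y +
        (ENNReal.ofReal a * invMass P n (f z) y +
          (ENNReal.ofReal (‖y‖ ^ 2 / (2 * P.sigmaZero ^ 2)) +
            ENNReal.ofReal (-D * Real.log ρ - Real.log a - Real.log (densityFloor P n)))) := by
  have hD' : (0 : ℝ) < D := by exact_mod_cast hD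
  have hc1 : 0 < ρ * √D / 2 := by positivity
  rcases (hg.nonneg y).eq_or_lt with h0 | h0
  · simp [← h0]
  by_cases hfin : gradSup f r z y = ∞
  · rw [hfin, ENNReal.mul_top (by simpa using hc1)]; simp
  by_cases hfin2 : invMass P n (f z) y = ∞
  · rw [hfin2, ENNReal.mul_top (by simpa using ha)]; simp
  have h1 := hg.log_le hc hρ hρr h0 hfin
  have h2 := hg.floor_le hfin2
  have hx := exactMixture_pos hg y
  have hq := densityFloor_pos P n
  have hi : 0 < (invMass P n (f z) y).toReal := by
    by_contra hcon
    have : (invMass P n (f z) y).toReal = 0 := le_antisymm (not_lt.mp hcon) ENNReal.toReal_nonneg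
    rw [this, mul_zero] at h2
    exact absurd h2 (not_le.mpr (by positivity))
  have h3 := Real.log_le_log (by positivity) h2
  rw [Real.log_mul hq.ne' (by positivity), Real.log_exp, Real.log_mul hx.ne' hi.ne'] at h3
  -- `log w ≤ a w - log a` for the reciprocal mass `w`, whose mean is known
  have h4 := Real.log_le_sub_one_of_pos (mul_pos ha hi)
  rw [Real.log_mul ha.ne' hi.ne'] at h4
  have h5 : Real.log (f z y / exactMixture P n (f z) y) ≤
      ρ * √D / 2 * (gradSup f r z y).toReal + (a * (invMass P n (f z) y).toReal +
        (‖y‖ ^ 2 / (2 * P.sigmaZero ^ 2) +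
          (-D * Real.log ρ - Real.log a - Real.log (densityFloor P n)))) := by
    rw [Real.log_div h0.ne' hx.ne']; linarith
  refine (ENNReal.ofReal_le_ofReal h5).trans (ENNReal.ofReal_add_le.trans (add_le_add ?_
    (ENNReal.ofReal_add_le.trans (add_le_add ?_ ENNReal.ofReal_add_le))))
  · rw [ENNReal.ofReal_mul hc1.le, ENNReal.ofReal_toReal hfin]
  · rw [ENNReal.ofReal_mul ha.le, ENNReal.ofReal_toReal hfin2]

/-- The reciprocal masses integrate to the number of sets of the partition. -/
lemma IsChargingDensity.lintegral_invMass (hg : IsChargingDensity P n g)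
    (hm : Measurable g) :
    ∫⁻ y, invMass P n g y * ENNReal.ofReal (g y) = P.size n + 1 := by
  have hterm : ∀ S : Set (Vec D), MeasurableSet S → 0 < ∫ u in S, g u →
      ∫⁻ y, S.indicator (fun _ => (∫⁻ u in S, ENNReal.ofReal (g u))⁻¹) y * ENNReal.ofReal (g y)
        = 1 := by
    intro S hS hpos
    have e : ∀ y, S.indicator (fun _ => (∫⁻ u in S, ENNReal.ofReal (g u))⁻¹) y *
        ENNReal.ofReal (g y) = S.indicator (fun y => (∫⁻ u in S, ENNReal.ofReal (g u))⁻¹ *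
          ENNReal.ofReal (g y)) y := fun y => by
      by_cases hy : y ∈ S <;> simp [hy]
    simp_rw [e]
    rw [lintegral_indicator hS, lintegral_const_mul _ (by fun_prop)]
    refine ENNReal.inv_mul_cancel ?_ ?_ <;> rw [hg.setLIntegral_eq]
    · simpa using hpos
    · exact ENNReal.ofReal_ne_top
  have hmeas : ∀ S : Set (Vec D), MeasurableSet S → Measurable fun y =>
      S.indicator (fun _ => (∫⁻ u in S, ENNReal.ofReal (g u))⁻¹) y * ENNReal.ofReal (g y) :=
    fun S hS => (measurable_const.indicator hS).mul (by fun_prop)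
  unfold invMass
  simp_rw [add_mul, Finset.sum_mul]
  rw [lintegral_add_right _ (hmeas _ (P.measurableSet_remainder n)),
    hterm _ (P.measurableSet_remainder n) hg.remainder_pos,
    lintegral_finsetSum _ fun j _ => hmeas _ (measurableSet_cell _ _)]
  simp_rw [hterm _ (measurableSet_cell _ _) (hg.cell_pos _)]
  simp

lemma measurable_invMass {f : (Fin d → ℝ) → Vec D → ℝ} (hf : Measurable (Function.uncurry f)) :
    Measurable fun p : Vec D × (Fin d → ℝ) => invMass P n (f p.2) p.1 := by
  have h : ∀ S : Set (Vec D), MeasurableSet S → Measurable fun p : Vec D × (Fin d → ℝ) =>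
      S.indicator (fun _ => (∫⁻ u in S, ENNReal.ofReal (f p.2 u))⁻¹) p.1 := by
    intro S hS
    have h1 : Measurable fun z => ∫⁻ u in S, ENNReal.ofReal (f z u) :=
      hf.ennreal_ofReal.lintegral_prod_right'
    have h2 : Measurable fun p : Vec D × (Fin d → ℝ) => (∫⁻ u in S, ENNReal.ofReal (f p.2 u))⁻¹ :=
      (h1.comp measurable_snd).inv
    exact h2.indicator (measurable_fst hS)
  exact (Finset.measurable_sum _ fun j _ => h _ (measurableSet_cell _ _)).add
    (h _ (P.measurableSet_remainder n))

end Rough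

section RoughIntegral

variable {𝒞 : Type*} [MeasurableSpace 𝒞] {D T : ℕ} {X : DiffusionProblem 𝒞 D T}
  {s : Fin T} {d : ℕ} {φ : 𝒞 × Vec D → Fin d → ℝ} {K : Set (Fin d → ℝ)}
  {f : (Fin d → ℝ) → Vec D → ℝ}

/-- The mean of the reciprocal mass is the number of sets of the partition. -/
lemma FeatureAssumption.lintegral_invMass (h : FeatureAssumption X s φ K f) (hD : 1 ≤ D)
    {r : Fin T → ℝ} (hreg : RegularityAssumption X r) {r' : ℝ} (P : PartitionData D r') (n : ℕ) :
    ∫⁻ p, invMass P n (f p.2) p.1 ∂X.featureLaw s φ = P.size n + 1 := by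
  have := h.isProbabilityMeasure_featureLaw
  have hf := h.measurable_density
  have hf' : Measurable fun p : Vec D × (Fin d → ℝ) => ENNReal.ofReal (f p.2 p.1) :=
    (hf.comp measurable_swap).ennreal_ofReal
  have hi := measurable_invMass (P := P) (n := n) hf
  have hae := h.ae_isChargingDensity hD hreg P
  conv_lhs => rw [h.disintegration]
  rw [lintegral_withDensity_eq_lintegral_mul _ hf' hi, lintegral_prod_symm' _ (hf'.mul hi)]
  calc _ = ∫⁻ _z, ((P.size n : ℝ≥0∞) + 1) ∂(X.featureLaw s φ).snd := by
        refine lintegral_congr_ae ?_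
        filter_upwards [hae] with z hz
        rw [← (hz n).lintegral_invMass (hf.comp measurable_prodMk_left)]
        simp_rw [Pi.mul_apply, mul_comm]
    _ = _ := by simp

/-- Integrated form of the bound that holds for every partition. -/
lemma FeatureAssumption.setLIntegral_rough_bound (h : FeatureAssumption X s φ K f) (hD : 1 ≤ D)
    {r : Fin T → ℝ} (hreg : RegularityAssumption X r) (P : PartitionData D (r s))
    (hC1 : IsC1Density f (X.featureLaw s φ)) (n : ℕ) {ρ a : ℝ} (hρ : 0 < ρ) (hρr : ρ ≤ r s)
    (ha : 0 < a) (B : Set (Vec D × (Fin d → ℝ))) :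
    ∫⁻ p in B, ENNReal.ofReal (Real.log (f p.2 p.1 / exactMixture P n (f p.2) p.1))
        ∂X.featureLaw s φ ≤
      ENNReal.ofReal (ρ * √D / 2) * ∫⁻ p, gradSup f (r s) p.2 p.1 ∂X.featureLaw s φ +
        (ENNReal.ofReal a * (P.size n + 1) +
          ∫⁻ p in B, (ENNReal.ofReal (‖p.1‖ ^ 2 / (2 * P.sigmaZero ^ 2)) +
            ENNReal.ofReal (-D * Real.log ρ - Real.log a - Real.log (densityFloor P n)))
          ∂X.featureLaw s φ) := by
  have hi := measurable_invMass (P := P) (n := n) h.measurable_density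
  calc _ ≤ ∫⁻ p in B, (ENNReal.ofReal (ρ * √D / 2) * gradSup f (r s) p.2 p.1 +
        (ENNReal.ofReal a * invMass P n (f p.2) p.1 +
          (ENNReal.ofReal (‖p.1‖ ^ 2 / (2 * P.sigmaZero ^ 2)) +
            ENNReal.ofReal (-D * Real.log ρ - Real.log a - Real.log (densityFloor P n)))))
          ∂X.featureLaw s φ := by
        refine lintegral_mono_ae (ae_restrict_of_ae ?_)
        filter_upwards [ae_of_ae_snd (h.ae_isChargingDensity hD hreg P), ae_of_ae_snd hC1]
          with p hp hc
        exact (hp n).rough_bound hD hc hρ hρr ha p.1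
    _ = ENNReal.ofReal (ρ * √D / 2) * ∫⁻ p in B, gradSup f (r s) p.2 p.1 ∂X.featureLaw s φ +
        (ENNReal.ofReal a * ∫⁻ p in B, invMass P n (f p.2) p.1 ∂X.featureLaw s φ +
          ∫⁻ p in B, (ENNReal.ofReal (‖p.1‖ ^ 2 / (2 * P.sigmaZero ^ 2)) +
            ENNReal.ofReal (-D * Real.log ρ - Real.log a - Real.log (densityFloor P n)))
          ∂X.featureLaw s φ) := by
        rw [lintegral_add_right _ (by fun_prop), lintegral_add_right _ (by fun_prop),
          lintegral_const_mul' _ _ ENNReal.ofReal_ne_top, lintegral_const_mul _ hi]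
    _ ≤ _ := by
        rw [← h.lintegral_invMass hD hreg P n]
        gcongr <;> exact Measure.restrict_le_self

end RoughIntegral

/-! ### The power rate -/

section Moments

variable {D : ℕ}

/-- The sum of the absolute `θ`-th powers of the coordinates. -/
noncomputable def powerSum (θ : ℝ) (y : Vec D) : ℝ := ∑ i, |y i| ^ θ

lemma powerSum_nonneg (θ : ℝ) (y : Vec D) : 0 ≤ powerSum θ y :=
  Finset.sum_nonneg fun _ _ => by positivity

lemma rpow_le_powerSum (θ : ℝ) (y : Vec D) (i : Fin D) : |y i| ^ θ ≤ powerSum θ y :=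
  Finset.single_le_sum (f := fun i => |y i| ^ θ) (fun _ _ => by positivity) (Finset.mem_univ i)

lemma measurable_powerSum (θ : ℝ) : Measurable (powerSum θ : Vec D → ℝ) := by
  unfold powerSum
  fun_prop

lemma ofReal_powerSum {θ : ℝ} (hθ : 0 ≤ θ) (y : Vec D) :
    ENNReal.ofReal (powerSum θ y) = ∑ i, ‖y i‖ₑ ^ θ := by
  rw [powerSum, ENNReal.ofReal_sum_of_nonneg fun _ _ => by positivity]
  refine Finset.sum_congr rfl fun i _ => ?_
  rw [← ENNReal.ofReal_rpow_of_nonneg (abs_nonneg _) hθ, ← Real.norm_eq_abs, ofReal_norm]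

lemma exists_norm_sq_le (hD : 1 ≤ D) (y : Vec D) :
    ∃ i, (∀ k, |y k| ≤ |y i|) ∧ ‖y‖ ^ 2 ≤ D * |y i| ^ 2 := by
  have : Nonempty (Fin D) := ⟨⟨0, hD⟩⟩
  obtain ⟨i, hi⟩ := Finite.exists_max fun k => |y k|
  refine ⟨i, hi, ?_⟩
  have h := norm_le_sqrt_mul (abs_nonneg (y i)) hi
  calc ‖y‖ ^ 2 ≤ (√D * |y i|) ^ 2 := pow_le_pow_left₀ (norm_nonneg _) h 2
    _ = _ := by rw [mul_pow, Real.sq_sqrt (Nat.cast_nonneg D)]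

lemma norm_sq_le_powerSum (hD : 1 ≤ D) {θ : ℝ} (hθ : 2 < θ) (y : Vec D) :
    ‖y‖ ^ 2 ≤ D * (1 + powerSum θ y) := by
  obtain ⟨i, -, hi⟩ := exists_norm_sq_le hD y
  refine hi.trans (mul_le_mul_of_nonneg_left ?_ (Nat.cast_nonneg D))
  rcases le_total (|y i|) 1 with h | h
  · have := powerSum_nonneg θ y
    have := pow_le_one₀ (n := 2) (abs_nonneg (y i)) h
    linarith
  · have h1 : |y i| ^ (2 : ℝ) ≤ |y i| ^ θ := Real.rpow_le_rpow_of_exponent_le h hθ.le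
    rw [Real.rpow_two] at h1
    linarith [rpow_le_powerSum θ y i]

/-- Away from a cube, constants and squares are dominated by `θ`-th powers. -/
lemma powerSum_ge_of_lt (hD : 1 ≤ D) {θ : ℝ} (hθ : 2 < θ) {c : ℝ} (hc : 0 < c) {y : Vec D}
    (hy : ∃ i, c < |y i|) :
    1 ≤ c ^ (-θ) * powerSum θ y ∧ ‖y‖ ^ 2 ≤ D * (c ^ (-(θ - 2)) * powerSum θ y) := by
  obtain ⟨k, hk⟩ := hy
  obtain ⟨i, hmax, hi⟩ := exists_norm_sq_le hD y
  have hci : c ≤ |y i| := hk.le.trans (hmax k)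
  have hyi : 0 < |y i| := hc.trans_le hci
  have hp := rpow_le_powerSum θ y i
  constructor
  · calc (1 : ℝ) = c ^ (-θ) * c ^ θ := by rw [← Real.rpow_add hc]; simp
      _ ≤ c ^ (-θ) * powerSum θ y := by
        gcongr
        exact (Real.rpow_le_rpow (z := θ) hc.le hci (by linarith)).trans hp
  · refine hi.trans (mul_le_mul_of_nonneg_left ?_ (Nat.cast_nonneg D))
    calc |y i| ^ 2 = |y i| ^ (-(θ - 2)) * |y i| ^ θ := by
          rw [← Real.rpow_add hyi, ← Real.rpow_two]; congr 1; ring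
      _ ≤ c ^ (-(θ - 2)) * powerSum θ y := by
          exact mul_le_mul (Real.rpow_le_rpow_of_nonpos hc hci (by linarith)) hp (by positivity)
            (by positivity)

end Moments

lemma rateExponent_pos {D : ℕ} (hD : 1 ≤ D) {θ ξ : ℝ} (hθ : 2 < θ) (hξ : 0 < ξ) :
    0 < rateExponent D θ ξ := by
  have : (0 : ℝ) < D := by exact_mod_cast hD
  have : 0 < θ - 2 := by linarith
  unfold rateExponent
  positivity

/-- The Gaussian densities of the cells on their own cells stay bounded away from zero, since
`h / σ → 0` and `σ → 0`. -/
lemma PartitionData.eventually_densityFloor_ge {D : ℕ} (hD : 1 ≤ D) {r : ℝ}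
    (P : PartitionData D r) : ∃ c > 0, ∀ᶠ n in atTop, c ≤ densityFloor P n := by
  have hσ0 := P.sigmaZero_pos
  refine ⟨min (Real.exp (-(D / 8))) (1 / (2 * Real.pi * P.sigmaZero ^ 2) ^ ((D : ℝ) / 2)),
    lt_min (Real.exp_pos _) (by positivity), ?_⟩
  have h1 : Tendsto (fun n => 2 * Real.pi * P.sigma n ^ 2) atTop (𝓝 0) := by
    simpa using (P.tendsto_sigma.pow 2).const_mul (2 * Real.pi)
  filter_upwards [h1.eventually_le_const one_pos,
    (P.tendsto_side_div_sigma hD).eventually_le_const one_pos] with n hn1 hn2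
  refine min_le_min_right _ ?_
  have hσ := P.sigma_pos n
  have hh := P.side_pos n
  have h3 : (2 * Real.pi * P.sigma n ^ 2) ^ ((D : ℝ) / 2) ≤ 1 :=
    Real.rpow_le_one (by positivity) hn1 (by positivity)
  have h4 : (P.side n / P.sigma n) ^ 2 ≤ 1 := pow_le_one₀ (by positivity) hn2
  rw [le_div_iff₀ (by positivity)]
  refine (mul_le_of_le_one_right (Real.exp_pos _).le h3).trans (Real.exp_le_exp.mpr ?_)
  rw [neg_le_neg_iff]
  have := mul_le_mul_of_nonneg_left h4 (Nat.cast_nonneg (α := ℝ) D)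
  linarith

/-- An eventual power bound for finite quantities extends to all indices. -/
lemma exists_bound_of_eventually {E : ℕ → ℝ≥0∞} {b : ℕ → ℝ} (hb : ∀ n, 0 < b n)
    (hE : ∀ n, E n ≠ ∞) {C : ℝ} (h : ∀ᶠ n in atTop, E n ≤ ENNReal.ofReal (C * b n)) :
    ∃ C' : ℝ, ∀ n, E n ≤ ENNReal.ofReal (C' * b n) := by
  obtain ⟨N, hN⟩ := eventually_atTop.mp h
  have hs : ∀ k, 0 ≤ (E k).toReal / b k := fun k => div_nonneg ENNReal.toReal_nonneg (hb k).le
  refine ⟨max C (∑ k ∈ Finset.range N, (E k).toReal / b k), fun n => ?_⟩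
  rcases le_or_gt N n with hn | hn
  · refine (hN n hn).trans (ENNReal.ofReal_le_ofReal ?_)
    exact mul_le_mul_of_nonneg_right (le_max_left _ _) (hb n).le
  · rw [← ENNReal.ofReal_toReal (hE n)]
    refine ENNReal.ofReal_le_ofReal ?_
    calc (E n).toReal = (E n).toReal / b n * b n := (div_mul_cancel₀ _ (hb n).ne').symm
      _ ≤ _ := by
        refine mul_le_mul_of_nonneg_right (le_trans ?_ (le_max_right _ _)) (hb n).le
        exact Finset.single_le_sum (f := fun k => (E k).toReal / b k) (fun k _ => hs k)
          (Finset.mem_range.mpr hn)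

section Rate

variable {𝒞 : Type*} [MeasurableSpace 𝒞] {D T : ℕ} {X : DiffusionProblem 𝒞 D T}
  {s : Fin T} {d : ℕ} {φ : 𝒞 × Vec D → Fin d → ℝ} {K : Set (Fin d → ℝ)}
  {f : (Fin d → ℝ) → Vec D → ℝ} {r : Fin T → ℝ} {θ ξ : ℝ}

lemma PowerRateHyp.lintegral_powerSum_lt_top {r' : ℝ}
    {F : Measure (Vec D × (Fin d → ℝ))} (hθ : PowerRateHyp r' f F θ) :
    ∫⁻ p, ENNReal.ofReal (powerSum θ p.1) ∂F < ∞ := by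
  have h0 : 0 ≤ θ := by linarith [hθ.two_lt]
  simp_rw [ofReal_powerSum h0]
  rw [lintegral_finsetSum _ fun i _ => by fun_prop]
  exact ENNReal.sum_lt_top.mpr fun i _ => hθ.moment i

/-- The mixture with exact weights has finite error for every partition. -/
lemma FeatureAssumption.exactError_lt_top (h : FeatureAssumption X s φ K f) (hD : 1 ≤ D)
    (hreg : RegularityAssumption X r) (P : PartitionData D (r s))
    (hθ : PowerRateHyp (r s) f (X.featureLaw s φ) θ) (n : ℕ) :
    exactError P n f (X.featureLaw s φ) < ∞ := by
  have := h.isProbabilityMeasure_featureLaw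
  have hσ0 := P.sigmaZero_pos
  have hb := h.setLIntegral_rough_bound hD hreg P hθ.isC1 n (hreg.side_pos s) le_rfl one_pos
    Set.univ
  simp only [Measure.restrict_univ] at hb
  refine hb.trans_lt ?_
  have h1 : ∫⁻ p, (ENNReal.ofReal (‖p.1‖ ^ 2 / (2 * P.sigmaZero ^ 2)) +
      ENNReal.ofReal (-D * Real.log (r s) - Real.log 1 - Real.log (densityFloor P n)))
        ∂X.featureLaw s φ < ∞ := by
    rw [lintegral_add_right _ measurable_const, lintegral_const, measure_univ, mul_one]
    refine ENNReal.add_lt_top.mpr ⟨?_, ENNReal.ofReal_lt_top⟩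
    calc _ ≤ ∫⁻ p, (ENNReal.ofReal (D / (2 * P.sigmaZero ^ 2)) *
          (1 + ENNReal.ofReal (powerSum θ p.1))) ∂X.featureLaw s φ := by
          refine lintegral_mono fun p => ?_
          rw [← ENNReal.ofReal_one, ← ENNReal.ofReal_add zero_le_one (powerSum_nonneg _ _),
            ← ENNReal.ofReal_mul (by positivity)]
          refine ENNReal.ofReal_le_ofReal ?_
          rw [div_mul_eq_mul_div]
          exact div_le_div_of_nonneg_right (norm_sq_le_powerSum hD hθ.two_lt p.1) (by positivity)
      _ = ENNReal.ofReal (D / (2 * P.sigmaZero ^ 2)) *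
          (1 + ∫⁻ p, ENNReal.ofReal (powerSum θ p.1) ∂X.featureLaw s φ) := by
          have hm : Measurable fun p : Vec D × (Fin d → ℝ) => ENNReal.ofReal (powerSum θ p.1) :=
            ((measurable_powerSum θ).comp measurable_fst).ennreal_ofReal
          rw [lintegral_const_mul' _ _ ENNReal.ofReal_ne_top, lintegral_add_right _ hm]
          simp
      _ < ∞ := ENNReal.mul_lt_top ENNReal.ofReal_lt_top
          (ENNReal.add_lt_top.mpr ⟨ENNReal.one_lt_top, hθ.lintegral_powerSum_lt_top⟩)
  exact ENNReal.add_lt_top.mpr ⟨ENNReal.mul_lt_top ENNReal.ofReal_lt_top hθ.gradient_integrable,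
    ENNReal.add_lt_top.mpr ⟨ENNReal.mul_lt_top ENNReal.ofReal_lt_top
      (ENNReal.add_lt_top.mpr ⟨ENNReal.natCast_lt_top _, ENNReal.one_lt_top⟩), h1⟩⟩

/-- Constants growing logarithmically in `m`, and squares, are `O(m^{-β})` in mean outside the
cube of half-width `κ m^{β/(θ-2)}`. -/
lemma exists_outer_bound (hD : 1 ≤ D) (hθ : 2 < θ) {β κ σ₀ k₀ k₁ : ℝ} (hβ : 0 < β) (hκ : 0 < κ)
    (hσ₀ : 0 < σ₀) (hk₀ : 0 ≤ k₀) (hk₁ : 0 ≤ k₁) : ∃ C ≥ 0, ∀ m : ℝ, 1 ≤ m → ∀ y : Vec D,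
    (∃ i, κ * m ^ (β / (θ - 2)) < |y i|) →
      ‖y‖ ^ 2 / (2 * σ₀ ^ 2) + (k₀ + k₁ * Real.log m) ≤ C * m ^ (-β) * powerSum θ y := by
  have hθ' : 0 < θ - 2 := by linarith
  set τ := β / (θ - 2) with hτ
  have hτ0 : 0 < τ := by positivity
  have hτβ : τ * (θ - 2) = β := div_mul_cancel₀ _ hθ'.ne'
  refine ⟨D * κ ^ (-(θ - 2)) / (2 * σ₀ ^ 2) + (k₀ + k₁ / (2 * τ)) * κ ^ (-θ), by positivity,
    fun m hm y hy => ?_⟩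
  have hm0 : 0 < m := one_pos.trans_le hm
  obtain ⟨h1, h2⟩ := powerSum_ge_of_lt hD hθ (by positivity) hy
  have hM := powerSum_nonneg θ y
  have e1 : (κ * m ^ τ) ^ (-(θ - 2)) = κ ^ (-(θ - 2)) * m ^ (-β) := by
    rw [Real.mul_rpow hκ.le (by positivity), ← Real.rpow_mul hm0.le]
    congr 2
    linarith
  have e2 : (κ * m ^ τ) ^ (-θ) = κ ^ (-θ) * (m ^ (-β) * m ^ (-(2 * τ))) := by
    rw [Real.mul_rpow hκ.le (by positivity), ← Real.rpow_mul hm0.le, ← Real.rpow_add hm0]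
    congr 2
    linarith
  rw [e1] at h2
  rw [e2] at h1
  have hlog0 : 0 ≤ Real.log m := Real.log_nonneg hm
  have hlog : (k₀ + k₁ * Real.log m) * m ^ (-(2 * τ)) ≤ k₀ + k₁ / (2 * τ) := by
    have h3 := Real.log_le_rpow_div hm0.le (show 0 < 2 * τ by positivity)
    have h4 : Real.log m * m ^ (-(2 * τ)) ≤ 1 / (2 * τ) := by
      calc _ ≤ m ^ (2 * τ) / (2 * τ) * m ^ (-(2 * τ)) := by gcongr
        _ = (m ^ (2 * τ) * m ^ (-(2 * τ))) / (2 * τ) := by ring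
        _ = _ := by rw [← Real.rpow_add hm0, add_neg_cancel, Real.rpow_zero]
    have h5 : m ^ (-(2 * τ)) ≤ 1 := Real.rpow_le_one_of_one_le_of_nonpos hm (by linarith)
    calc _ = k₀ * m ^ (-(2 * τ)) + k₁ * (Real.log m * m ^ (-(2 * τ))) := by ring
      _ ≤ k₀ * 1 + k₁ * (1 / (2 * τ)) := by gcongr
      _ = _ := by ring
  have hA : ‖y‖ ^ 2 / (2 * σ₀ ^ 2) ≤
      D * κ ^ (-(θ - 2)) / (2 * σ₀ ^ 2) * m ^ (-β) * powerSum θ y := by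
    calc _ ≤ D * (κ ^ (-(θ - 2)) * m ^ (-β) * powerSum θ y) / (2 * σ₀ ^ 2) := by gcongr
      _ = _ := by ring
  have hB : k₀ + k₁ * Real.log m ≤
      (k₀ + k₁ / (2 * τ)) * κ ^ (-θ) * m ^ (-β) * powerSum θ y := by
    calc _ ≤ (k₀ + k₁ * Real.log m) *
          (κ ^ (-θ) * (m ^ (-β) * m ^ (-(2 * τ))) * powerSum θ y) :=
          le_mul_of_one_le_right (by positivity) h1
      _ = ((k₀ + k₁ * Real.log m) * m ^ (-(2 * τ))) * (κ ^ (-θ) * m ^ (-β) * powerSum θ y) := by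
          ring
      _ ≤ (k₀ + k₁ / (2 * τ)) * (κ ^ (-θ) * m ^ (-β) * powerSum θ y) := by gcongr
      _ = _ := by ring
  calc _ ≤ _ := add_le_add hA hB
    _ = _ := by ring

/-- The error of the mixture with exact weights for tuned partitions. Off the cube covered by the
cells, the logarithm of the reciprocal cell mass is controlled through the mean of that
reciprocal mass, which is `m + 1`. -/
theorem FeatureAssumption.exists_exactError_le (h : FeatureAssumption X s φ K f)
    (hD : 1 ≤ D) (hreg : RegularityAssumption X r) {P : PartitionData D (r s)}
    (hθ : PowerRateHyp (r s) f (X.featureLaw s φ) θ) (hξ : 0 < ξ) (hcal : P.Calibrated θ ξ) :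
    ∃ C : ℝ, ∀ n, exactError P n f (X.featureLaw s φ) ≤
      ENNReal.ofReal (C * (P.size n : ℝ) ^ (-rateExponent D θ ξ)) := by
  have := h.isProbabilityMeasure_featureLaw
  have hr := hreg.side_pos s
  have hσ0 := P.sigmaZero_pos
  set F := X.featureLaw s φ with hF
  set β := rateExponent D θ ξ with hβ
  have hβ0 : 0 < β := rateExponent_pos hD hθ.two_lt hξ
  have hm1 : ∀ n, (1 : ℝ) ≤ P.size n := fun n => by exact_mod_cast P.size_pos n
  have hb0 : ∀ n, 0 < (P.size n : ℝ) ^ (-β) := fun n =>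
    Real.rpow_pos_of_pos (one_pos.trans_le (hm1 n)) _
  obtain ⟨c, hc0, hc⟩ := P.eventually_densityFloor_ge hD
  obtain ⟨κ, hκ, hcov⟩ := hcal.covers
  obtain ⟨Cδ, hCδ0, hCδ⟩ := hcal.delta_isBigO.exists_nonneg
  obtain ⟨Cr, hCr0, hCr⟩ := hcal.riemann_isBigO.exists_nonneg
  obtain ⟨Ce, hCe0, hCe⟩ := hcal.exp_isBigO.exists_nonneg
  obtain ⟨Co, hCo0, hCo⟩ := exists_outer_bound (D := D) (θ := θ) (β := β) (κ := κ)
    (σ₀ := P.sigmaZero) (k₀ := D * |Real.log (r s)| + |Real.log c|) (k₁ := D * β + (1 + β))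
    hD hθ.two_lt hβ0 hκ hσ0 (by positivity) (by positivity)
  set S := (∫⁻ p, gradSup f (r s) p.2 p.1 ∂F).toReal with hS
  have hSe : ∫⁻ p, gradSup f (r s) p.2 p.1 ∂F = ENNReal.ofReal S :=
    (ENNReal.ofReal_toReal hθ.gradient_integrable.ne).symm
  have hS0 : 0 ≤ S := ENNReal.toReal_nonneg
  set M := (∫⁻ p, ENNReal.ofReal (powerSum θ p.1) ∂F).toReal with hM
  have hMe : ∫⁻ p, ENNReal.ofReal (powerSum θ p.1) ∂F = ENNReal.ofReal M :=
    (ENNReal.ofReal_toReal hθ.lintegral_powerSum_lt_top.ne).symm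
  have hM0 : 0 ≤ M := ENNReal.toReal_nonneg
  set Cg := 6 * (D : ℝ) ^ (3 / 2 : ℝ) / (2 * Real.pi) ^ ((D : ℝ) / 2) with hCg
  have hCg0 : 0 ≤ Cg := by positivity
  refine exists_bound_of_eventually hb0 (fun n => (h.exactError_lt_top hD hreg P hθ n).ne)
    (C := (√D / 2 * S + (2 + Co * M)) + (Cδ * √D / 2 * S + (Cg * Cr + 2 * Ce))) ?_
  filter_upwards [hc, hcov, hCδ.bound, hCr.bound, hCe.bound,
    P.eventually_off_boundary (f := f) hD, P.tendsto_delta.eventually_le_const hr]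
    with n hcn hcovn hδn hrn hen hoff hδr
  have hm := hm1 n
  have hm0 : (0 : ℝ) < P.size n := one_pos.trans_le hm
  set m : ℝ := (P.size n : ℝ) with hmdef
  set b := m ^ (-β) with hb
  have hb' : 0 < b := hb0 n
  have hlog0 : 0 ≤ Real.log m := Real.log_nonneg hm
  have hδ0 := P.delta_pos n
  have hσ := P.sigma_pos n
  have hh := P.side_pos n
  rw [Real.norm_of_nonneg hδ0.le, Real.norm_of_nonneg hb'.le] at hδn
  rw [Real.norm_of_nonneg (by positivity), Real.norm_of_nonneg hb'.le] at hrn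
  rw [Real.norm_of_nonneg (Real.exp_pos _).le, Real.norm_of_nonneg hb'.le] at hen
  set B : Set (Vec D × (Fin d → ℝ)) := {p | ∃ i, κ * m ^ (β / (θ - 2)) < |p.1 i|} with hB
  have hBm : MeasurableSet B := by
    have : B = ⋃ i, {p | κ * m ^ (β / (θ - 2)) < |p.1 i|} := by ext; simp [hB]
    rw [this]
    exact MeasurableSet.iUnion fun i => measurableSet_lt measurable_const (by fun_prop)
  -- On `B`, the bound for arbitrary partitions. With `ρ ≤ b` and `a = m ^ (-(1 + β))` the gradient
  -- term and the reciprocal masses, of mean `m + 1`, are `O(b)`; the rest is logarithmic in `m`.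
  have hin : ∫⁻ p in B, ENNReal.ofReal (Real.log (f p.2 p.1 / exactMixture P n (f p.2) p.1)) ∂F ≤
      ENNReal.ofReal ((√D / 2 * S + (2 + Co * M)) * b) := by
    have hρ : 0 < min (r s) b := lt_min hr hb'
    have ha : 0 < m ^ (-(1 + β)) := by positivity
    refine (h.setLIntegral_rough_bound hD hreg P hθ.isC1 n hρ (min_le_left _ _) ha B).trans ?_
    have t1 : ENNReal.ofReal (min (r s) b * √D / 2) * ∫⁻ p, gradSup f (r s) p.2 p.1 ∂F ≤
        ENNReal.ofReal (√D / 2 * S * b) := by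
      rw [hSe, ← ENNReal.ofReal_mul (by positivity)]
      refine ENNReal.ofReal_le_ofReal ?_
      calc min (r s) b * √D / 2 * S ≤ b * √D / 2 * S := by gcongr; exact min_le_right _ _
        _ = _ := by ring
    have t2 : ENNReal.ofReal (m ^ (-(1 + β))) * ((P.size n : ℝ≥0∞) + 1) ≤
        ENNReal.ofReal (2 * b) := by
      have e : ((P.size n : ℝ≥0∞) + 1) = ENNReal.ofReal (m + 1) := by
        rw [ENNReal.ofReal_add hm0.le zero_le_one, hmdef, ENNReal.ofReal_natCast,
          ENNReal.ofReal_one]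
      rw [e, ← ENNReal.ofReal_mul ha.le]
      refine ENNReal.ofReal_le_ofReal ?_
      have e2 : m ^ (-(1 + β)) * m = b := by
        rw [hb, ← Real.rpow_add_one hm0.ne']; congr 1; ring
      calc m ^ (-(1 + β)) * (m + 1) ≤ m ^ (-(1 + β)) * (2 * m) := by gcongr; linarith
        _ = 2 * b := by rw [← e2]; ring
    have t3 : ∫⁻ p in B, (ENNReal.ofReal (‖p.1‖ ^ 2 / (2 * P.sigmaZero ^ 2)) +
        ENNReal.ofReal (-D * Real.log (min (r s) b) - Real.log (m ^ (-(1 + β))) -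
          Real.log (densityFloor P n))) ∂F ≤ ENNReal.ofReal (Co * M * b) := by
      have hk : -D * Real.log (min (r s) b) - Real.log (m ^ (-(1 + β))) -
          Real.log (densityFloor P n) ≤
          (D * |Real.log (r s)| + |Real.log c|) + (D * β + (1 + β)) * Real.log m := by
        have k1 : -Real.log (min (r s) b) ≤ |Real.log (r s)| + β * Real.log m := by
          rcases min_choice (r s) b with h' | h' <;> rw [h']
          · have := neg_le_abs (Real.log (r s))
            have : 0 ≤ β * Real.log m := by positivity
            linarith
          · rw [hb, Real.log_rpow hm0]
            have := abs_nonneg (Real.log (r s))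
            linarith
        have k2 : -Real.log (densityFloor P n) ≤ |Real.log c| :=
          (neg_le_neg (Real.log_le_log hc0 hcn)).trans (neg_le_abs _)
        rw [Real.log_rpow hm0]
        have k3 := mul_le_mul_of_nonneg_left k1 (Nat.cast_nonneg (α := ℝ) D)
        linarith
      have hmeas : Measurable fun p : Vec D × (Fin d → ℝ) => ENNReal.ofReal (powerSum θ p.1) :=
        ((measurable_powerSum θ).comp measurable_fst).ennreal_ofReal
      calc _ ≤ ∫⁻ p in B, ENNReal.ofReal (Co * b) * ENNReal.ofReal (powerSum θ p.1) ∂F := by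
            refine setLIntegral_mono (measurable_const.mul hmeas) fun p hp => ?_
            have hkk : 0 ≤ (D * |Real.log (r s)| + |Real.log c|) +
              (D * β + (1 + β)) * Real.log m := by positivity
            rw [← ENNReal.ofReal_mul (by positivity)]
            refine (add_le_add le_rfl (ENNReal.ofReal_le_ofReal hk)).trans ?_
            rw [← ENNReal.ofReal_add (by positivity) hkk]
            exact ENNReal.ofReal_le_ofReal (hCo m hm p.1 hp)
        _ ≤ ∫⁻ p, ENNReal.ofReal (Co * b) * ENNReal.ofReal (powerSum θ p.1) ∂F :=
            setLIntegral_le_lintegral _ _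
        _ = _ := by
            rw [lintegral_const_mul _ hmeas, hMe, ← ENNReal.ofReal_mul (by positivity)]
            congr 1; ring
    refine (add_le_add t1 (add_le_add t2 t3)).trans (le_of_eq ?_)
    rw [← ENNReal.ofReal_add (by positivity) (by positivity),
      ← ENNReal.ofReal_add (by positivity) (by positivity)]
    congr 1; ring
  -- outside `B` the `δ`-cube is covered by the cells
  have hout : ∫⁻ p in Bᶜ,
      ENNReal.ofReal (Real.log (f p.2 p.1 / exactMixture P n (f p.2) p.1)) ∂F ≤
      ENNReal.ofReal ((Cδ * √D / 2 * S + (Cg * Cr + 2 * Ce)) * b) := by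
    have hgt : P.gaussianTerms n ≤ (Cg * Cr + 2 * Ce) * b := by
      have e : P.gaussianTerms n = Cg * (P.delta n ^ (D - 1) * P.side n / P.sigma n ^ D) +
          2 * Real.exp (-(P.delta n / P.sigma n) ^ 2 / 8) := by
        rw [PartitionData.gaussianTerms, hCg]; field_simp
      rw [e]
      calc _ ≤ Cg * (Cr * b) + 2 * (Ce * b) := by gcongr
        _ = _ := by ring
    calc _ ≤ ∫⁻ p in Bᶜ, (ENNReal.ofReal (P.delta n * √D / 2) * gradSup f (r s) p.2 p.1 +
          ENNReal.ofReal (P.gaussianTerms n)) ∂F := by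
          refine lintegral_mono_ae ?_
          filter_upwards [ae_restrict_of_ae (ae_of_ae_snd (h.ae_isChargingDensity hD hreg P)),
            ae_restrict_of_ae (ae_of_ae_snd hθ.isC1), ae_restrict_mem hBm.compl] with p hp hpc hpB
          have hnb : (p.1, p.2) ∉ boundaryEvent P n d := by
            have hy : ∀ i, |p.1 i| ≤ κ * m ^ (β / (θ - 2)) := fun i =>
              not_lt.mp fun hi => hpB ⟨i, hi⟩
            exact Set.not_nonempty_iff_eq_empty.mpr
              (Set.disjoint_iff_inter_eq_empty.mp (hcovn p.1 hy))
          refine (hoff true p.2 p.1 (hp n) (fun _ => hpc) hnb).trans ?_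
          simp only [localOsc, if_true]
          gcongr
          exact biSup_mono fun u hu i => (hu i).trans (by linarith)
      _ ≤ ∫⁻ p, (ENNReal.ofReal (P.delta n * √D / 2) * gradSup f (r s) p.2 p.1 +
          ENNReal.ofReal (P.gaussianTerms n)) ∂F := setLIntegral_le_lintegral _ _
      _ = ENNReal.ofReal (P.delta n * √D / 2) * ENNReal.ofReal S +
          ENNReal.ofReal (P.gaussianTerms n) := by
          rw [lintegral_add_right _ measurable_const, lintegral_const, measure_univ, mul_one,
            lintegral_const_mul' _ _ ENNReal.ofReal_ne_top, hSe]
      _ ≤ ENNReal.ofReal (Cδ * √D / 2 * S * b) + ENNReal.ofReal ((Cg * Cr + 2 * Ce) * b) := by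
          rw [← ENNReal.ofReal_mul (by positivity)]
          refine add_le_add (ENNReal.ofReal_le_ofReal ?_) (ENNReal.ofReal_le_ofReal hgt)
          calc P.delta n * √D / 2 * S ≤ Cδ * b * √D / 2 * S := by gcongr
            _ = _ := by ring
      _ = _ := by
          rw [← ENNReal.ofReal_add (by positivity) (by positivity)]
          congr 1; ring
  rw [exactError, ← lintegral_add_compl _ hBm]
  refine (add_le_add hin hout).trans (le_of_eq ?_)
  rw [← ENNReal.ofReal_add (by positivity) (by positivity)]
  congr 1; ring

end Rate

/-! ### Tuned partitions -/

section TunedPartition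

variable {D : ℕ}

/-- The centers of the `N ^ D` grid cells of side `h` that tile the cube of half-width `N h / 2`
around the origin. -/
noncomputable def gridCenter (N : ℕ) (h : ℝ) (j : Fin (N ^ D)) : Vec D :=
  WithLp.toLp 2 fun i => -(N * h / 2) + h / 2 + h * (finFunctionFinEquiv.symm j i : ℕ)

lemma iUnion_cell_gridCenter (N : ℕ) {h : ℝ} (hh : 0 < h) :
    ⋃ j, cell h (gridCenter N h j) =
      {y : Vec D | ∀ i, -(N * h / 2) ≤ y i ∧ y i < N * h / 2} := by
  ext y
  simp only [Set.mem_iUnion, cell, gridCenter, Set.mem_ofPred_eq]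
  constructor
  · rintro ⟨j, hj⟩ i
    obtain ⟨h1, h2⟩ := hj i
    have h3 : ((finFunctionFinEquiv.symm j i : ℕ) : ℝ) + 1 ≤ N := by
      exact_mod_cast (finFunctionFinEquiv.symm j i).isLt
    have h4 := mul_le_mul_of_nonneg_left h3 hh.le
    have h5 : 0 ≤ h * ((finFunctionFinEquiv.symm j i : ℕ) : ℝ) := by positivity
    constructor <;> linarith
  · intro hy
    have h0 : ∀ i, 0 ≤ (y i + N * h / 2) / h := fun i =>
      div_nonneg (by linarith [(hy i).1]) hh.le
    have hlt : ∀ i, ⌊(y i + N * h / 2) / h⌋₊ < N := fun i => by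
      rw [Nat.floor_lt (h0 i), div_lt_iff₀ hh]
      linarith [(hy i).2]
    refine ⟨finFunctionFinEquiv fun i => ⟨⌊(y i + N * h / 2) / h⌋₊, hlt i⟩, fun i => ?_⟩
    rw [Equiv.symm_apply_apply]
    have h1 := mul_le_mul_of_nonneg_left (Nat.floor_le (h0 i)) hh.le
    have h2 := mul_lt_mul_of_pos_left (Nat.lt_floor_add_one ((y i + N * h / 2) / h)) hh
    rw [mul_div_cancel₀ _ hh.ne'] at h1 h2
    constructor <;> simp only <;> linarith

lemma gridCenter_injective (N : ℕ) {h : ℝ} (hh : 0 < h) :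
    Function.Injective (gridCenter N h : Fin (N ^ D) → Vec D) := by
  intro j k hjk
  refine finFunctionFinEquiv.symm.injective (funext fun i => Fin.ext ?_)
  have h1 := congrArg (fun v : Vec D => v i) hjk
  simp only [gridCenter, add_right_inj, mul_eq_mul_left_iff, hh.ne', or_false] at h1
  exact_mod_cast h1

/-- Inside a centred box the corner cube points towards the origin. -/
lemma hasCornerCube_box {W ℓ : ℝ} (hW : ℓ ≤ W) {y : Vec D} (hy : ∀ i, -W ≤ y i ∧ y i < W) :
    HasCornerCube ℓ {u : Vec D | ∀ i, -W ≤ u i ∧ u i < W} y := by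
  refine ⟨fun i => if y i < 0 then 1 else -1, fun i => by
    dsimp only
    split_ifs <;> simp, fun u hu i => ?_⟩
  have h1 := hu i
  have h2 := hy i
  simp only at h1
  split_ifs at h1 <;> constructor <;> linarith

/-- Outside a centred box the corner cube points away from it in a violated coordinate. -/
lemma hasCornerCube_compl_box {W ℓ : ℝ} {y : Vec D} (hy : ¬ ∀ i, -W ≤ y i ∧ y i < W) :
    HasCornerCube ℓ {u : Vec D | ∀ i, -W ≤ u i ∧ u i < W}ᶜ y := by
  obtain ⟨k, hk⟩ := not_forall.mp hy
  refine ⟨fun _ => if W ≤ y k then 1 else -1, fun _ => by split_ifs <;> simp, fun u hu hbox => hk ?_⟩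
  have h1 := (hu k).1
  have h2 := hbox k
  split_ifs at h1 <;> constructor <;> linarith

/-- Powers of the logarithm are negligible against powers. -/
lemma tendsto_sqrt_log_pow_mul_rpow (k : ℝ) {ε : ℝ} (hε : 0 < ε) :
    Tendsto (fun x : ℝ => √(k * Real.log x) ^ D * x ^ (-ε)) atTop (𝓝 0) := by
  have h1 := (isLittleO_log_rpow_rpow_atTop ((D : ℝ) / 2) hε).tendsto_div_nhds_zero
  have h2 := h1.const_mul (√k ^ D)
  rw [mul_zero] at h2
  refine h2.congr' ?_
  filter_upwards [eventually_ge_atTop 1] with x hx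
  have hl := Real.log_nonneg hx
  rw [mul_comm k, Real.sqrt_mul hl, mul_pow, Real.rpow_neg (by linarith),
    Real.rpow_div_two_eq_sqrt _ hl, Real.rpow_natCast]
  ring

/-- Tuned partitions exist: with `m = (n + 2) ^ D` cells of side `h = m^{-β(2+ξ)}` tiling a cube
around the origin, `δ = m^{-β}` and `σ = δ / √(8 β log m)`, the cube has side `m^{β/(θ-2)}`. -/
lemma exists_calibrated (hD : 1 ≤ D) {r θ ξ : ℝ} (hr : 0 < r) (hθ : 2 < θ) (hξ : 0 < ξ) :
    ∃ P : PartitionData D r, P.Calibrated θ ξ := by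
  have hθ' : 0 < θ - 2 := by linarith
  have hD0 : (0 : ℝ) < D := by exact_mod_cast hD
  set β := rateExponent D θ ξ with hβdef
  have hβ : 0 < β := rateExponent_pos hD hθ hξ
  -- the defining relation of `β`; it splits `m^{1/D}` cells per direction into range and resolution
  have hβD : (D : ℝ)⁻¹ = β * (2 + 1 / (θ - 2) + ξ) := by
    rw [hβdef, rateExponent, div_mul_cancel₀]
    positivity
  set m : ℕ → ℕ := fun n => (n + 2) ^ D with hm
  have hm2 : ∀ n, 2 ≤ m n := fun n =>
    (show 2 ≤ n + 2 by omega).trans (Nat.le_self_pow (by omega) _)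
  have hmtop : Tendsto m atTop atTop :=
    tendsto_atTop_mono (fun n => (show n ≤ n + 2 by omega).trans (Nat.le_self_pow (by omega) _))
      tendsto_id
  have hMtop : Tendsto (fun n => (m n : ℝ)) atTop atTop :=
    tendsto_natCast_atTop_atTop.comp hmtop
  have hM0 : ∀ n, (0 : ℝ) < m n := fun n => by exact_mod_cast (by norm_num : 0 < 2).trans_le (hm2 n)
  have hlog : ∀ n, 0 < Real.log (m n) := fun n =>
    Real.log_pos (by exact_mod_cast (by norm_num : 1 < 2).trans_le (hm2 n))
  set h : ℕ → ℝ := fun n => (m n : ℝ) ^ (-(β * (2 + ξ))) with hh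
  set δ : ℕ → ℝ := fun n => (m n : ℝ) ^ (-β) with hδ
  set σ : ℕ → ℝ := fun n => δ n / √(8 * β * Real.log (m n)) with hσ
  set τ := β / (θ - 2) with hτ
  have hτ0 : 0 < τ := by positivity
  have hh0 : ∀ n, 0 < h n := fun n => Real.rpow_pos_of_pos (hM0 n) _
  have hδ0 : ∀ n, 0 < δ n := fun n => Real.rpow_pos_of_pos (hM0 n) _
  have hq0 : ∀ n, 0 < √(8 * β * Real.log (m n)) := fun n =>
    Real.sqrt_pos.mpr (mul_pos (by positivity) (hlog n))
  have hσ0 : ∀ n, 0 < σ n := fun n => div_pos (hδ0 n) (hq0 n)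
  have hδlim : Tendsto δ atTop (𝓝 0) := (tendsto_rpow_neg_atTop hβ).comp hMtop
  have hhlim : Tendsto h atTop (𝓝 0) := (tendsto_rpow_neg_atTop (by positivity)).comp hMtop
  have hWlim : Tendsto (fun n => (m n : ℝ) ^ τ) atTop atTop := (tendsto_rpow_atTop hτ0).comp hMtop
  have hW : ∀ n, ((n + 2 : ℕ) : ℝ) * h n = (m n : ℝ) ^ τ := fun n => by
    have e : ((n + 2 : ℕ) : ℝ) = (m n : ℝ) ^ (D : ℝ)⁻¹ := by
      rw [hm]
      push_cast
      rw [← Real.rpow_natCast, Real.rpow_rpow_inv (by positivity) hD0.ne']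
    rw [e, ← Real.rpow_add (hM0 n), hβD, hτ]
    congr 1
    field_simp
    ring
  have hU : ∀ n, ⋃ j, cell (h n) (gridCenter (n + 2) (h n) j) =
      {y : Vec D | ∀ i, -((m n : ℝ) ^ τ / 2) ≤ y i ∧ y i < (m n : ℝ) ^ τ / 2} := fun n => by
    simp only [iUnion_cell_gridCenter _ (hh0 n), hW n]
  have hcube : ∀ (n : ℕ) (y : Vec D), (∀ i, |y i| + δ n / 2 < (m n : ℝ) ^ τ / 2) →
      cube (δ n) y ⊆ ⋃ j, cell (h n) (gridCenter (n + 2) (h n) j) := fun n y hy u hu => by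
    rw [hU]
    intro i
    have h1 := abs_le.mp (hu i)
    have h2 := hy i
    have h3 := neg_abs_le (y i)
    have h4 := le_abs_self (y i)
    constructor <;> linarith
  have hδσ : ∀ n, δ n / σ n = √(8 * β * Real.log (m n)) := fun n =>
    div_div_cancel₀ (hδ0 n).ne'
  -- the Riemann term is `m^{-β}` up to a power of the logarithm, which `m^{-βξ}` absorbs
  have hriem : ∀ n, δ n ^ (D - 1) * h n / σ n ^ D =
      δ n * (√(8 * β * Real.log (m n)) ^ D * (m n : ℝ) ^ (-(β * ξ))) := fun n => by
    have e1 : h n = δ n * δ n * (m n : ℝ) ^ (-(β * ξ)) := by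
      rw [hh, hδ]
      simp only
      rw [← Real.rpow_add (hM0 n), ← Real.rpow_add (hM0 n)]
      congr 1
      ring
    have e2 : δ n ^ D = δ n ^ (D - 1) * δ n := by rw [← pow_succ, Nat.sub_add_cancel hD]
    have := (hδ0 n).ne'
    have := (hq0 n).ne'
    rw [hσ]
    simp only
    rw [div_pow, e2, e1]
    field_simp
  have hlim := (tendsto_sqrt_log_pow_mul_rpow (D := D) (8 * β) (mul_pos hβ hξ)).comp hMtop
  have hsz : Tendsto (fun n => σ n / δ n) atTop (𝓝 0) := by
    have e : (fun n => σ n / δ n) = fun n => (√(8 * β * Real.log (m n)))⁻¹ :=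
      funext fun n => by rw [← hδσ, inv_div]
    rw [e]
    exact (Real.tendsto_sqrt_atTop.comp ((Real.tendsto_log_atTop.comp hMtop).const_mul_atTop
      (by positivity))).inv_tendsto_atTop
  have hπ := Real.pi_pos
  let P : PartitionData D r :=
    { size := m
      side := h
      center := fun n => gridCenter (n + 2) (h n)
      delta := δ
      sigma := σ
      -- the side condition on `σ₀` becomes `(1 / 4) ^ D ≤ 2⁻¹ ^ (D + 1)`
      sigmaZero := 2 * r / √(2 * Real.pi)
      size_pos := fun n => (by norm_num : 0 < 2).trans_le (hm2 n)
      tendsto_size := hmtop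
      side_pos := hh0
      tendsto_side := hhlim
      center_injective := fun n => gridCenter_injective _ (hh0 n)
      grid := fun n => ⟨fun _ => -((n + 2 : ℕ) * h n / 2) + h n / 2, fun j =>
        ⟨fun i => (finFunctionFinEquiv.symm j i : ℕ), fun i => by
          simp only [gridCenter, Int.cast_natCast]⟩⟩
      delta_pos := hδ0
      tendsto_delta := hδlim
      sigma_pos := hσ0
      sigmaZero_pos := by positivity
      eventually_misses := fun y => by
        filter_upwards [hWlim.eventually_gt_atTop (2 * ‖y‖ + 2),
          hδlim.eventually_le_const one_pos] with n h1 h2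
        refine hcube n y fun i => ?_
        have h3 := PiLp.norm_apply_le y i
        rw [Real.norm_eq_abs] at h3
        linarith
      eventually_corner := by
        filter_upwards [hWlim.eventually_ge_atTop r] with n hn
        rw [hU]
        exact ⟨fun y hy => hasCornerCube_compl_box hy,
          fun y hy => hasCornerCube_box (by linarith) hy⟩
      tendsto_sigma_div_delta := hsz
      tendsto_riemann := by
        simp_rw [hriem]
        simpa using hδlim.mul hlim
      sigmaZero_bound := by
        have e : 2 * Real.pi * (2 * r / √(2 * Real.pi)) ^ 2 = (2 * r) ^ 2 := by
          rw [div_pow, Real.sq_sqrt (by positivity)]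
          field_simp
        rw [e, Real.rpow_div_two_eq_sqrt _ (by positivity), Real.sqrt_sq (by positivity),
          Real.rpow_natCast, ← div_pow, ← inv_pow]
        have e2 : r / 2 / (2 * r) = 2⁻¹ ^ 2 := by field_simp
        rw [e2, ← pow_mul]
        exact pow_le_pow_of_le_one (by norm_num) (by norm_num) (by omega) }
  refine ⟨P, isBigO_refl _ _, ?_, ?_, 1 / 4, by norm_num, ?_⟩
  · change (fun n => δ n ^ (D - 1) * h n / σ n ^ D) =O[atTop] δ
    simp_rw [hriem]
    simpa using (isBigO_refl δ atTop).mul (hlim.isBigO_one ℝ)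
  · refine (isBigO_refl δ atTop).congr_left fun n => ?_
    change δ n = Real.exp (-(δ n / σ n) ^ 2 / 8)
    rw [hδσ, Real.sq_sqrt (mul_pos (by positivity) (hlog n)).le, hδ]
    simp only
    rw [Real.rpow_def_of_pos (hM0 n)]
    congr 1
    ring
  · filter_upwards [hWlim.eventually_gt_atTop 2, hδlim.eventually_le_const one_pos] with n h1 h2 y hy
    refine Set.disjoint_compl_right_iff_subset.mpr (hcube n y fun i => ?_)
    have h3 : |y i| ≤ 1 / 4 * (m n : ℝ) ^ τ := hy i
    linarith

end TunedPartition

end CondDiffusion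

open CondDiffusion
theorem theorem3p10 {𝒞 : Type*} [MeasurableSpace 𝒞] [StandardBorelSpace 𝒞]
    (D : ℕ) (hD : 1 ≤ D) (T : ℕ) (X : DiffusionProblem 𝒞 D T)
    (r : Fin T → ℝ) (hreg : RegularityAssumption X r)
    (d : Fin T → ℕ) (hd : ∀ t, 1 ≤ d t)
    (φ : (t : Fin T) → 𝒞 × Vec D → Fin (d t) → ℝ)
    (K : (t : Fin T) → Set (Fin (d t) → ℝ))
    (f : (t : Fin T) → (Fin (d t) → ℝ) → Vec D → ℝ)
    (hfeat : ∀ t, FeatureAssumption X t (φ t) (K t) (f t))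
    (P : (t : Fin T) → PartitionData D (r t))
    (s : Fin T → ℕ) (hs : ∀ t, 1 ≤ s t)
    (lo : (t : Fin T) → Fin (d t) → ℝ) (len : Fin T → ℝ)
    (Lam : (t : Fin T) → (n : ℕ) → Fin ((P t).size n) → (Fin (d t) → ℝ) → ℝ)
    (hsmooth : ∀ t, SmoothLogOdds (P t) (f t) (K t) (s t) (lo t) (len t) (Lam t)) :
    -- networks of the prescribed size and accuracy exist
    (∀ (t : Fin T) (n N L : ℕ), 1 ≤ N → 1 ≤ L →
      ∃ a : ReLUNet (d t) ((P t).size n),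
        (a.width : ℝ) ≤ (P t).size n * (17 * (s t : ℝ) ^ (d t + 1) * 3 ^ d t * d t *
          (N + 2) * Real.logb 2 (8 * N)) ∧
        (a.depth : ℝ) ≤ 18 * (s t : ℝ) ^ 2 * (L + 2) * Real.logb 2 (4 * L) + 2 * d t ∧
        logitError (P t) (f t) (K t) n a ≤
          85 * logitRate (s t) (d t) N L (lamMax (s t) (lo t) (len t) (Lam t n))) ∧
    -- total error in terms of the explicit mixture bound, for all fine enough partitions
    (∃ n₀ : Fin T → ℕ, ∀ n : Fin T → ℕ, (∀ t, n₀ t ≤ n t) →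
      ∀ N L : Fin T → ℕ, (∀ t, 1 ≤ N t) → (∀ t, 1 ≤ L t) →
      ∀ a : (t : Fin T) → ReLUNet (d t) ((P t).size (n t)),
      (∀ t, logitError (P t) (f t) (K t) (n t) (a t) ≤
        85 * logitRate (s t) (d t) (N t) (L t)
          (lamMax (s t) (lo t) (len t) (Lam t (n t)))) →
      ∀ c1 : Fin T → Bool,
      (∀ t, c1 t = true → IsC1Density (f t) (X.featureLaw t (φ t))) →
      X.outputKL (X.predictor fun t => neuralKernel (φ t) (P t) (n t) (a t)) ≤
        X.terminalMismatch + ∑ t,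
          (noretsBound (P t) (n t) (c1 t) (f t) (X.featureLaw t (φ t)) +
            170 * logitRate (s t) (d t) (N t) (L t)
              (lamMax (s t) (lo t) (len t) (Lam t (n t))))) ∧
    -- power rate under the `C¹` hypotheses, for suitably tuned partitions, which exist
    (∀ θ ξ : Fin T → ℝ,
      (∀ t, PowerRateHyp (r t) (f t) (X.featureLaw t (φ t)) (θ t)) → (∀ t, 0 < ξ t) →
      (∀ t, ∃ P' : PartitionData D (r t), P'.Calibrated (θ t) (ξ t)) ∧
      ((∀ t, (P t).Calibrated (θ t) (ξ t)) →
        ∃ C : Fin T → ℝ, ∀ n N L : Fin T → ℕ, (∀ t, 1 ≤ N t) → (∀ t, 1 ≤ L t) →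
        ∀ a : (t : Fin T) → ReLUNet (d t) ((P t).size (n t)),
        (∀ t, logitError (P t) (f t) (K t) (n t) (a t) ≤
          85 * logitRate (s t) (d t) (N t) (L t)
            (lamMax (s t) (lo t) (len t) (Lam t (n t)))) →
        X.outputKL (X.predictor fun t => neuralKernel (φ t) (P t) (n t) (a t)) ≤
          X.terminalMismatch + ∑ t,
            (ENNReal.ofReal (C t * ((P t).size (n t) : ℝ) ^
                (-rateExponent D (θ t) (ξ t))) +
              170 * logitRate (s t) (d t) (N t) (L t)
                (lamMax (s t) (lo t) (len t) (Lam t (n t)))))) := by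
  have hstep : ∀ (n : Fin T → ℕ) (N L : Fin T → ℕ)
      (a : (t : Fin T) → ReLUNet (d t) ((P t).size (n t))) (B : Fin T → ℝ≥0∞),
      (∀ t, logitError (P t) (f t) (K t) (n t) (a t) ≤
        85 * logitRate (s t) (d t) (N t) (L t) (lamMax (s t) (lo t) (len t) (Lam t (n t)))) →
      (∀ t, exactError (P t) (n t) (f t) (X.featureLaw t (φ t)) ≤ B t) →
      X.outputKL (X.predictor fun t => neuralKernel (φ t) (P t) (n t) (a t)) ≤
        X.terminalMismatch + ∑ t, (B t + 170 * logitRate (s t) (d t) (N t) (L t)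
          (lamMax (s t) (lo t) (len t) (Lam t (n t)))) := by
    intro n N L a B ha hB
    have : ∀ t, IsMarkovKernel (neuralKernel (φ t) (P t) (n t) (a t)) := fun t =>
      isMarkovKernel_neuralKernel (P t) (n t) (hfeat t).measurable_feature (a t)
    refine (X.outputKL_predictor_le _).trans ?_
    gcongr with t
    refine (lintegral_klDiv_le_exactError (hfeat t) hD hreg (P t) (n t) (a t)).trans ?_
    refine add_le_add (hB t) ((mul_le_mul_right (ha t) 2).trans (le_of_eq ?_))
    rw [← mul_assoc]
    norm_num
  refine ⟨fun t n N L hN hL => exists_accurate_net (hd t) (hs t) (hsmooth t) n hN hL, ?_, ?_⟩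
  · choose n₀ hn₀ using fun t =>
      eventually_atTop.mp ((hfeat t).eventually_exactError_le hD hreg (P t))
    exact ⟨n₀, fun n hn N L _ _ a ha c1 hc1 =>
      hstep n N L a _ ha fun t => hn₀ t (n t) (hn t) (c1 t) (hc1 t)⟩
  · intro θ ξ hθ hξ
    refine ⟨fun t => exists_calibrated hD (hreg.side_pos t) (hθ t).two_lt (hξ t), fun hcal => ?_⟩
    choose C hC using fun t => (hfeat t).exists_exactError_le hD hreg (hθ t) (hξ t) (hcal t)
    exact ⟨C, fun n N L _ _ a ha => hstep n N L a _ ha fun t => hC t (n t)⟩
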